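/- Theorem. On $J^1=\mathbb{R}^5$ with coordinates $(x,y,z,p,q)$ let $U=dz-p\,dx-q\,dy$, let $\mathcal C=\{U=0\}$ be the contact distribution, and put $\widehat\partial_x=\partial_x+p\,\partial_z$, $\widehat\partial_y=\partial_y+q\,\partial_z$. Let $\Omega\subset J^1$ be open and let $\mathcal D$ be a $C^\infty$ lagrangian distribution on $\Omega$, that is, a $C^\infty$ distribution of rank $2$ contained in $\mathcal C$ which equals its own orthogonal complement in $\mathcal C$ with respect to $dU$. For a field of subspaces $\mathcal P$ write $\mathcal P'=\mathcal P+[\mathcal P,\mathcal P]$ (its value at a point is spanned by the value of $\mathcal P$ and by the values of the brackets of local $C^\infty$ sections of $\mathcal P$), and $\mathcal P''=(\mathcal P')'$. Assume that $\mathcal D$ is non-generic: $\dim\mathcal D''_\theta<5$ for every $\theta\in\Omega$. Consider, for $\theta\in\Omega$, the following normal forms, each required to hold on a neighbourhood of $\theta$ in suitable $C^\infty$ local contact coordinates $(x,y,z,p,q)$ (coordinates in which $\mathcal C=\{dz-p\,dx-q\,dy=0\}$): - (a) $\mathcal D=\langle\widehat\partial_x,\ \partial_q\rangle$; - (b) $\mathcal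 D=\langle\partial_p,\ \widehat\partial_y+b\,\partial_q\rangle$ with $b$ a $C^\infty$ function and $\partial_p b\neq0$; - (c) $\mathcal D=\langle\partial_p+z\,\partial_q,\ \widehat\partial_y-z\,\widehat\partial_x+b\,\partial_q\rangle$ with $b$ a $C^\infty$ function, $\partial_p b+z\,\partial_z b\neq0$ and $\partial_p b+z\,\partial_q b\neq q-zp$ (the last inequality says that the two generators do not commute). Then there is an open dense subset of $\Omega$ around each point of which $\mathcal D$ takes one of the forms (a), (b), (c). More precisely, for $\theta\in\Omega$: 1. if $\mathcal D'=\mathcal D$ near $\theta$ (so $\mathcal D$ is integrable there), then $\mathcal D$ takes the form (a) around $\theta$; 2. if $\dim\mathcal D'_\theta=3$ and $\mathcal D''$ is integrable near $\theta$ (that is, $[\mathcal D'',\mathcal D'']\subset\mathcal D''$), then $\mathcal D$ takes the form (b) around $\theta$; 3. if $\dim\mathcal D'_\theta=3$ and $[\mathcal D,\mathcal D'']_\theta\not\subset\mathcal D''_\theta$, then $\mathcal D$ takes the form (c) around $\theta$. -/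

import Mathlib

open Set Filter Topology
open scoped ContDiff

/-- The space `J¹(τ)` of 1-jets of functions of two variables, in its natural chart
`(x, y, z, p, q)`, with `x, y, z, p, q` the coordinates of index `0, 1, 2, 3, 4`. -/
abbrev J1 : Type := Fin 5 → ℝ

/-- The coordinate field `∂_z`. -/
def dZ : J1 := ![0, 0, 1, 0, 0]

/-- The coordinate field `∂_p`. -/
def dP : J1 := ![0, 0, 0, 1, 0]

/-- The coordinate field `∂_q`. -/
def dQ : J1 := ![0, 0, 0, 0, 1]

/-- The total derivative `∂̂_x = ∂_x + p ∂_z`. -/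
def hatX (η : J1) : J1 := ![1, 0, η 3, 0, 0]

/-- The total derivative `∂̂_y = ∂_y + q ∂_z`. -/
def hatY (η : J1) : J1 := ![0, 1, η 4, 0, 0]

/-- The contact form `U = dz - p dx - q dy`. -/
noncomputable def contactForm (θ : J1) : J1 →L[ℝ] ℝ :=
  ContinuousLinearMap.proj (R := ℝ) (φ := fun _ : Fin 5 => ℝ) 2
    - θ 3 • ContinuousLinearMap.proj (R := ℝ) (φ := fun _ : Fin 5 => ℝ) 0
    - θ 4 • ContinuousLinearMap.proj (R := ℝ) (φ := fun _ : Fin 5 => ℝ) 1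

/-- The exterior derivative `dU` of the contact form. -/
noncomputable def dContactForm (θ v w : J1) : ℝ :=
  fderiv ℝ contactForm θ v w - fderiv ℝ contactForm θ w v

theorem contactForm_apply (θ v : J1) :
    contactForm θ v = v 2 - θ 3 * v 0 - θ 4 * v 1 := by
  simp [contactForm]

theorem hasFDerivAt_contactForm (θ : J1) :
    HasFDerivAt contactForm
      (-((ContinuousLinearMap.proj (R := ℝ) (φ := fun _ : Fin 5 => ℝ) 3).smulRight
          (ContinuousLinearMap.proj (R := ℝ) (φ := fun _ : Fin 5 => ℝ) 0))
        - (ContinuousLinearMap.proj (R := ℝ) (φ := fun _ : Fin 5 => ℝ) 4).smulRight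
          (ContinuousLinearMap.proj (R := ℝ) (φ := fun _ : Fin 5 => ℝ) 1)) θ := by
  have h3 := (hasFDerivAt_apply (𝕜 := ℝ) (3 : Fin 5) θ).smul_const
    (ContinuousLinearMap.proj (R := ℝ) (φ := fun _ : Fin 5 => ℝ) 0)
  have h4 := (hasFDerivAt_apply (𝕜 := ℝ) (4 : Fin 5) θ).smul_const
    (ContinuousLinearMap.proj (R := ℝ) (φ := fun _ : Fin 5 => ℝ) 1)
  have h := (h3.const_sub
    (ContinuousLinearMap.proj (R := ℝ) (φ := fun _ : Fin 5 => ℝ) 2)).sub h4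
  exact h

/-- In coordinates, `dU = dx ∧ dp + dy ∧ dq`. -/
theorem dContactForm_apply (θ v w : J1) :
    dContactForm θ v w = (v 0 * w 3 - v 3 * w 0) + (v 1 * w 4 - v 4 * w 1) := by
  simp only [dContactForm, (hasFDerivAt_contactForm θ).fderiv]
  simp
  ring

/-- The contact distribution `𝒞 = {U = 0}`. -/
noncomputable def contactDist (θ : J1) : Submodule ℝ J1 :=
  LinearMap.ker (contactForm θ : J1 →ₗ[ℝ] ℝ)

/-- `X` is a smooth section over the open set `W` of the field of subspaces `P`. -/
def IsSectionOn (P : J1 → Submodule ℝ J1) (W : Set J1) (X : J1 → J1) : Prop :=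
  ContDiffOn ℝ ∞ X W ∧ ∀ θ ∈ W, X θ ∈ P θ

/-- `D` is a smooth distribution of rank 2 on `Ω`: it is locally spanned by two smooth,
pointwise linearly independent vector fields. -/
def IsRankTwoDist (Ω : Set J1) (D : J1 → Submodule ℝ J1) : Prop :=
  ∀ θ ∈ Ω, ∃ W : Set J1, IsOpen W ∧ θ ∈ W ∧ W ⊆ Ω ∧ ∃ X Y : J1 → J1,
    ContDiffOn ℝ ∞ X W ∧ ContDiffOn ℝ ∞ Y W ∧
    ∀ η ∈ W, LinearIndependent ℝ ![X η, Y η] ∧ D η = Submodule.span ℝ {X η, Y η}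

/-- `D` is a lagrangian subdistribution of the contact distribution over `Ω`: at each point it is
contained in `𝒞` and is its own orthogonal complement in `𝒞` with respect to `dU`. -/
def IsLagrangianOn (Ω : Set J1) (D : J1 → Submodule ℝ J1) : Prop :=
  ∀ θ ∈ Ω, ∀ v : J1, v ∈ D θ ↔ v ∈ contactDist θ ∧ ∀ w ∈ D θ, dContactForm θ v w = 0

/-- The derived distribution `P' = P + [P, P]` over the open set `Ω`: its value at `θ` is spanned by
`P θ` and the values at `θ` of the Lie brackets of local smooth sections of `P`. -/
noncomputable def derivedDist (Ω : Set J1) (P : J1 → Submodule ℝ J1) (θ : J1) : Submodule ℝ J1 :=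
  Submodule.span ℝ ((P θ : Set J1) ∪
    {v | ∃ (W : Set J1) (X Y : J1 → J1), IsOpen W ∧ θ ∈ W ∧ W ⊆ Ω ∧
      IsSectionOn P W X ∧ IsSectionOn P W Y ∧ v = VectorField.lieBracket ℝ X Y θ})

/-- `Φ` is a local system of contact coordinates around `θ`, with domain in `Ω`: a smooth chart,
with smooth inverse, in which `𝒞` is given by `dz - p dx - q dy = 0`. -/
def IsContactChartAt (Ω : Set J1) (θ : J1) (Φ : OpenPartialHomeomorph J1 J1) : Prop :=
  θ ∈ Φ.source ∧ Φ.source ⊆ Ω ∧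
  ContDiffOn ℝ ∞ Φ Φ.source ∧ ContDiffOn ℝ ∞ Φ.symm Φ.target ∧
  ∀ η ∈ Φ.source, (contactDist η).map (fderiv ℝ Φ η : J1 →ₗ[ℝ] J1) = contactDist (Φ η)

/-- In the chart `Φ`, the distribution `D` is `⟨X, Y⟩`. -/
def IsSpannedInChart (Φ : OpenPartialHomeomorph J1 J1) (D : J1 → Submodule ℝ J1)
    (X Y : J1 → J1) : Prop :=
  ∀ η ∈ Φ.source,
    (D η).map (fderiv ℝ Φ η : J1 →ₗ[ℝ] J1) = Submodule.span ℝ {X (Φ η), Y (Φ η)}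

/-- Around `θ`, in some contact coordinates, `D = ⟨∂̂_x, ∂_q⟩`. -/
def HasNormalFormA (Ω : Set J1) (D : J1 → Submodule ℝ J1) (θ : J1) : Prop :=
  ∃ Φ : OpenPartialHomeomorph J1 J1, IsContactChartAt Ω θ Φ ∧
    IsSpannedInChart Φ D hatX (fun _ => dQ)

/-- Around `θ`, in some contact coordinates, `D = ⟨∂_p, ∂̂_y + b ∂_q⟩` with `∂_p b ≠ 0`. -/
def HasNormalFormB (Ω : Set J1) (D : J1 → Submodule ℝ J1) (θ : J1) : Prop :=
  ∃ Φ : OpenPartialHomeomorph J1 J1, IsContactChartAt Ω θ Φ ∧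
    ∃ b : J1 → ℝ, ContDiffOn ℝ ∞ b Φ.target ∧
      IsSpannedInChart Φ D (fun _ => dP) (fun η => hatY η + b η • dQ) ∧
      ∀ η ∈ Φ.target, fderiv ℝ b η dP ≠ 0

/-- Around `θ`, in some contact coordinates, `D = ⟨∂_p + z ∂_q, ∂̂_y - z ∂̂_x + b ∂_q⟩` with
`∂_p b + z ∂_z b ≠ 0` and `∂_p b + z ∂_q b ≠ q - z p`. The second inequality says that the bracket
`(∂_p b + z ∂_q b - (q - z p)) ∂_q` of the two generators does not vanish. -/
def HasNormalFormC (Ω : Set J1) (D : J1 → Submodule ℝ J1) (θ : J1) : Prop :=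
  ∃ Φ : OpenPartialHomeomorph J1 J1, IsContactChartAt Ω θ Φ ∧
    ∃ b : J1 → ℝ, ContDiffOn ℝ ∞ b Φ.target ∧
      IsSpannedInChart Φ D (fun η => dP + η 2 • dQ)
        (fun η => hatY η - η 2 • hatX η + b η • dQ) ∧
      ∀ η ∈ Φ.target,
        fderiv ℝ b η dP + η 2 * fderiv ℝ b η dZ ≠ 0 ∧
        fderiv ℝ b η dP + η 2 * fderiv ℝ b η dQ ≠ η 4 - η 2 * η 3

/-! Everything rests on how brackets of sections of `D` sit with respect to `U` and `dU`.

Integrable case. By Frobenius, `D` is the common kernel of three differentials. Since `U` vanishes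
on `D`, it is a combination of these differentials, hence proportional to some `dz - p dx - q dy`
with `D = {dx = dy = dz = 0}`. A partial Legendre transformation in `(x, p)` turns `D` into the form
(a).

Non-integrable case. Take a frame `X, Y` of `D` and put `Z = [X, Y]`. Cartan's formula and the
lagrangian condition give `U(Z) = -dU(X, Y) = 0`. As `Z` is not in `D`, it is not `dU`-orthogonal to
all of `D`, so the frame can be chosen with `dU(X, Z) = 0` and `dU(Y, Z) ≠ 0`. Then `T = [Y, Z]`
leaves the contact distribution, and non-genericity forces `D'' = ⟨X, Y, Z, T⟩`. Intersecting with
`{U = 0}` gives `[X, Z] ∈ ⟨X, Y, Z⟩`, and the Jacobi identity gives `[X, T] ∈ D''`: the field `X` is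
characteristic for `D''`. This is `exists_adaptedFrame`. The only bracket left to decide the type is
`[Y, T]` modulo `D''`.

If `[Y, T] ∈ D''` near the point, then `D''` is integrable and has a first integral `x`. If `[Y, T]
∉ D''` at the point, a second characteristic field `S = Z + μ Y` is determined by `[S, T] ∈ D''`. In
both cases there is such an `S` with `⟨X, S⟩` integrable, and `x, y, z` are taken among its first
integrals, so that `U` is proportional to `dz - p dx - q dy`. In the first case `dx` vanishes on
`Y`. In the second, `dx + z dy` vanishes on `D''`, where `z` is the slope `-(Yx)/(Yy)`. The common
computation `exists_normalForm_chart` treats `dx + ε z dy = 0` on `Y`: `ε = 0` yields (b) and `ε =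
1` yields (c). The inequality on `b` there says that `Z` is not in `D`. The other inequality in (c)
is obtained at the base point by moving it to `z = q = 0`, and near it by continuity.

Density follows because the alternatives "`D' = D` nearby" and "`[Y, T] ∈ D''` nearby" can fail only
if points of the opposite kind accumulate.

Frobenius is built one field at a time by `IsFirstIntegral.exists_cons`, which uses the
straightening theorem `exists_flowBox`. That theorem rests on `exists_smooth_flow`, where smooth
dependence on initial data comes from the inverse function theorem in a space of curves. -/

/-- `f` is smooth on a neighbourhood of `a`. -/
def SmoothNear {E F : Type*} [NormedAddCommGroup E] [NormedSpace ℝ E]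
    [NormedAddCommGroup F] [NormedSpace ℝ F] (f : E → F) (a : E) : Prop :=
  ∀ᶠ x in 𝓝 a, ContDiffAt ℝ ∞ f x

/-! ### Left composition as a smooth operator on spaces of continuous maps -/

section CompositionOperator

variable {K : Type} [TopologicalSpace K] [CompactSpace K]

/-- The pointwise application `C(K, F →L G) →L C(K, F) →L C(K, G)`. -/
noncomputable def pointwiseApply (K : Type) [TopologicalSpace K] [CompactSpace K]
    (F G : Type) [NormedAddCommGroup F] [NormedSpace ℝ F] [NormedAddCommGroup G]
    [NormedSpace ℝ G] : C(K, F →L[ℝ] G) →L[ℝ] C(K, F) →L[ℝ] C(K, G) :=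
  LinearMap.mkContinuous₂
    (LinearMap.mk₂ ℝ (fun (A : C(K, F →L[ℝ] G)) (v : C(K, F)) =>
        (⟨fun s => A s (v s), by fun_prop⟩ : C(K, G)))
      (by intros; ext; simp) (by intros; ext; simp)
      (by intros; ext; simp) (by intros; ext; simp)) 1
    (by
      intro A v
      rw [one_mul, ContinuousMap.norm_le _ (by positivity)]
      intro s
      exact ((A s).le_opNorm _).trans
        (mul_le_mul (A.norm_coe_le_norm s) (v.norm_coe_le_norm s) (norm_nonneg _)
          (norm_nonneg (A : C(K, F →L[ℝ] G)))))

@[simp]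
theorem pointwiseApply_apply (F G : Type) [NormedAddCommGroup F] [NormedSpace ℝ F]
    [NormedAddCommGroup G] [NormedSpace ℝ G] (A : C(K, F →L[ℝ] G)) (v : C(K, F)) (s : K) :
    pointwiseApply K F G A v s = A s (v s) := rfl

/-- The mean value inequality on the segment from `α s` to `α s + v s` bounds the remainder by the
oscillation of `h'` there. Continuity of `β ↦ h' ∘ β` in the sup norm makes this bound uniform in
`s`. -/
theorem hasFDerivAt_comp_left {F G : Type} [NormedAddCommGroup F] [NormedSpace ℝ F]
    [NormedAddCommGroup G] [NormedSpace ℝ G] (h : C(F, G)) (h' : C(F, F →L[ℝ] G))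
    (hh : ∀ x, HasFDerivAt h (h' x) x) (α : C(K, F)) :
    HasFDerivAt (fun α : C(K, F) => h.comp α) (pointwiseApply K F G (h'.comp α)) α := by
  rw [hasFDerivAt_iff_isLittleO_nhds_zero, Asymptotics.isLittleO_iff]
  intro c hc
  have hcont : ContinuousAt (fun β : C(K, F) => h'.comp β) α :=
    (ContinuousMap.continuous_postcomp h').continuousAt
  obtain ⟨δ, hδ, H⟩ := (Metric.continuousAt_iff (α := C(K, F)) (β := C(K, F →L[ℝ] G))).1 hcont c hc
  filter_upwards [Metric.ball_mem_nhds (0 : C(K, F)) hδ] with v hv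
  rw [mem_ball_zero_iff] at hv
  rw [ContinuousMap.norm_le _ (by positivity)]
  intro s
  have key : ‖h (α s + v s) - h (α s) - h' (α s) (α s + v s - α s)‖ ≤ c * ‖α s + v s - α s‖ := by
    refine (convex_segment (α s) (α s + v s)).norm_image_sub_le_of_norm_hasFDerivWithin_le'
      (fun x _ => (hh x).hasFDerivWithinAt) ?_ (left_mem_segment ..) (right_mem_segment ..)
    intro x hx
    rw [segment_eq_image'] at hx
    obtain ⟨t, ht, rfl⟩ := hx
    have h1 : dist (α + t • v) α < δ := by
      rw [dist_eq_norm, add_sub_cancel_left, norm_smul, Real.norm_of_nonneg ht.1]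
      exact (mul_le_of_le_one_left (norm_nonneg _) ht.2).trans_lt hv
    have h2 := (ContinuousMap.dist_apply_le_dist s).trans (H h1).le
    rw [dist_eq_norm] at h2
    simpa using h2
  have : ‖v s‖ ≤ ‖v‖ := v.norm_coe_le_norm s
  simp only [add_sub_cancel_left] at key
  exact key.trans (by gcongr)

/-- The derivative of composition with `h` is composition with `h'` followed by a fixed continuous
linear map. The induction replaces the target `G` by `F →L G`, so the spaces are quantified inside
it. -/
theorem contDiff_nat_comp_left (n : ℕ) : ∀ {F G : Type} [NormedAddCommGroup F] [NormedSpace ℝ F]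
    [NormedAddCommGroup G] [NormedSpace ℝ G] (h : C(F, G)), ContDiff ℝ n h →
    ContDiff ℝ n (fun α : C(K, F) => h.comp α) := by
  induction n with
  | zero =>
    intro F G _ _ _ _ h _
    simpa using ContinuousMap.continuous_postcomp h
  | succ n ih =>
    intro F G _ _ _ _ h hh
    obtain ⟨h', hc, hd⟩ := contDiff_succ_iff_hasFDerivAt.1 hh
    let k : C(F, F →L[ℝ] G) := ⟨h', hc.continuous⟩
    refine contDiff_succ_iff_hasFDerivAt.2
      ⟨fun α => pointwiseApply K F G (k.comp α), ?_, hasFDerivAt_comp_left h k hd⟩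
    exact (pointwiseApply K F G).contDiff.comp (ih k hc)

/-- Composition on the left with a smooth map is a smooth operation on continuous maps with
compact domain. -/
theorem contDiff_comp_left {F G : Type} [NormedAddCommGroup F] [NormedSpace ℝ F]
    [NormedAddCommGroup G] [NormedSpace ℝ G] (h : C(F, G)) (hh : ContDiff ℝ ∞ h) :
    ContDiff ℝ ∞ (fun α : C(K, F) => h.comp α) :=
  contDiff_infty.2 fun n => contDiff_nat_comp_left n h (contDiff_infty.1 hh n)

end CompositionOperator

/-! ### Smooth inverse function theorem on a domain -/

section InverseFunction

/-- The smooth inverse function theorem, with a domain on which both directions are smooth. -/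
theorem SmoothNear.exists_openPartialHomeomorph {E F : Type*} [NormedAddCommGroup E]
    [NormedSpace ℝ E] [CompleteSpace E] [NormedAddCommGroup F] [NormedSpace ℝ F]
    {f : E → F} {a : E} (hf : SmoothNear f a) (e : E ≃L[ℝ] F)
    (he : HasFDerivAt f (e : E →L[ℝ] F) a) {N : Set E} (hN : N ∈ 𝓝 a) :
    ∃ φ : OpenPartialHomeomorph E F, (φ : E → F) = f ∧ a ∈ φ.source ∧ φ.source ⊆ N ∧
      ContDiffOn ℝ ∞ f φ.source ∧ ContDiffOn ℝ ∞ φ.symm φ.target ∧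
      ∀ x ∈ φ.source, ∃ e' : E ≃L[ℝ] F, HasFDerivAt f (e' : E →L[ℝ] F) x := by
  have ha : ContDiffAt ℝ ∞ f a := hf.self_of_nhds
  let φ₀ := ha.toOpenPartialHomeomorph f he (by simp)
  have hφ₀ : (φ₀ : E → F) = f := rfl
  have hcont : ContinuousAt (fderiv ℝ f) a :=
    (ha.fderiv_right (m := ∞) (by simp)).continuousAt
  -- Invertibility of the derivative is open. After shrinking it holds on the whole source, so the
  -- inverse is smooth on the whole target and not only at the image of `a`.
  have hinv : ∀ᶠ x in 𝓝 a, fderiv ℝ f x ∈ range ((↑) : (E ≃L[ℝ] F) → E →L[ℝ] F) := by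
    apply hcont
    rw [he.fderiv]
    exact ContinuousLinearEquiv.nhds e
  obtain ⟨W, hW, hWo, haW⟩ := _root_.eventually_nhds_iff.1 (hf.and (hinv.and hN))
  refine ⟨φ₀.restrOpen W hWo, by simp [hφ₀], ?_, ?_, ?_, ?_, ?_⟩
  · simp only [OpenPartialHomeomorph.restrOpen_source]
    exact ⟨ha.mem_toOpenPartialHomeomorph_source he (by simp), haW⟩
  · rintro x ⟨_, hx⟩
    exact (hW x hx).2.2
  · rintro x ⟨_, hx⟩
    exact (hW x hx).1.contDiffWithinAt
  · intro y hy
    have hs := (φ₀.restrOpen W hWo).map_target hy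
    obtain ⟨e', he'⟩ := (hW _ hs.2).2.1
    refine (OpenPartialHomeomorph.contDiffAt_symm (φ₀.restrOpen W hWo) (f₀' := e') hy ?_
      ?_).contDiffWithinAt
    · rw [he']
      exact ((hW _ hs.2).1.differentiableAt (by simp)).hasFDerivAt
    · exact (hW _ hs.2).1
  · rintro x ⟨_, hx⟩
    obtain ⟨e', he'⟩ := (hW x hx).2.1
    refine ⟨e', ?_⟩
    rw [he']
    exact ((hW x hx).1.differentiableAt (by simp)).hasFDerivAt

end InverseFunction

/-! ### Smooth local flows by the inverse function theorem in a space of curves -/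

section Flow

/-- The constant map as a continuous linear map `F →L C(K, F)`. -/
noncomputable def constMapL (K F : Type) [TopologicalSpace K] [CompactSpace K]
    [NormedAddCommGroup F] [NormedSpace ℝ F] : F →L[ℝ] C(K, F) :=
  LinearMap.mkContinuous
    { toFun := fun v => ContinuousMap.const K v
      map_add' := fun _ _ => rfl
      map_smul' := fun _ _ => rfl } 1
    (fun v => by
      rw [ContinuousMap.norm_le _ (by positivity)]
      intro s
      exact (one_mul ‖v‖).ge)

@[simp]
theorem constMapL_apply (K F : Type) [TopologicalSpace K] [CompactSpace K]
    [NormedAddCommGroup F] [NormedSpace ℝ F] (v : F) (s : K) : constMapL K F v s = v := rfl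

theorem continuous_comp_projIcc {F : Type} [TopologicalSpace F] (β : C(Icc (0 : ℝ) 1, F)) :
    Continuous fun r : ℝ => β (projIcc 0 1 zero_le_one r) :=
  β.continuous.comp continuous_projIcc

variable {F : Type} [NormedAddCommGroup F] [NormedSpace ℝ F]

/-- The primitive vanishing at `0`, as an operator on `C([0, 1], F)`. -/
noncomputable def primitiveL (F : Type) [NormedAddCommGroup F] [NormedSpace ℝ F]
    [CompleteSpace F] : C(Icc (0 : ℝ) 1, F) →L[ℝ] C(Icc (0 : ℝ) 1, F) :=
  LinearMap.mkContinuous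
    { toFun := fun β => ⟨fun s => ∫ r in (0 : ℝ)..s, β (projIcc 0 1 zero_le_one r),
        (intervalIntegral.continuous_primitive
          (fun a b => (continuous_comp_projIcc β).intervalIntegrable a b) 0).comp
          continuous_subtype_val⟩
      map_add' := fun β γ => by
        ext s
        exact intervalIntegral.integral_add
          ((continuous_comp_projIcc β).intervalIntegrable _ _)
          ((continuous_comp_projIcc γ).intervalIntegrable _ _)
      map_smul' := fun c β => by
        ext s
        exact intervalIntegral.integral_smul c _ } 1
    (fun β => by
      rw [one_mul, ContinuousMap.norm_le _ (norm_nonneg β)]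
      intro s
      have h := intervalIntegral.norm_integral_le_of_norm_le_const (a := 0) (b := (s : ℝ))
        (f := fun r : ℝ => β (projIcc 0 1 zero_le_one r)) (C := ‖β‖)
        (fun x _ => β.norm_coe_le_norm _)
      refine h.trans ?_
      rw [sub_zero, abs_of_nonneg s.2.1]
      exact mul_le_of_le_one_right (norm_nonneg β) s.2.2)

theorem primitiveL_apply [CompleteSpace F] (β : C(Icc (0 : ℝ) 1, F)) (s : Icc (0 : ℝ) 1) :
    primitiveL F β s = ∫ r in (0 : ℝ)..s, β (projIcc 0 1 zero_le_one r) := rfl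

/-- Multiplication by `s ∈ [0, 1]` on `[0, 1]`. -/
def scaleIcc (s : Icc (0 : ℝ) 1) : C(Icc (0 : ℝ) 1, Icc (0 : ℝ) 1) :=
  ⟨fun r => s * r, by fun_prop⟩

/-- This is the substitution `x ↦ s x`. It shows that a solution of the integral equation with
parameter `τ`, run at speed `s`, solves the equation with parameter `s τ`. -/
theorem primitiveL_comp_scaleIcc [CompleteSpace F] (β : C(Icc (0 : ℝ) 1, F))
    (s r : Icc (0 : ℝ) 1) :
    (s : ℝ) • primitiveL F (β.comp (scaleIcc s)) r = primitiveL F β (s * r) := by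
  rw [primitiveL_apply, primitiveL_apply]
  have h := intervalIntegral.smul_integral_comp_mul_left (a := 0) (b := (r : ℝ))
    (fun x => β (projIcc 0 1 zero_le_one x)) (s : ℝ)
  rw [mul_zero] at h
  rw [show ((s * r : Icc (0 : ℝ) 1) : ℝ) = s * r from rfl, ← h]
  congr 1
  refine intervalIntegral.integral_congr fun x hx => ?_
  rw [uIcc_of_le r.2.1] at hx
  have hx1 : x ∈ Icc (0 : ℝ) 1 := ⟨hx.1, hx.2.trans r.2.2⟩
  have hx2 : (s : ℝ) * x ∈ Icc (0 : ℝ) 1 :=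
    ⟨mul_nonneg s.2.1 hx1.1, mul_le_one₀ s.2.2 hx1.1 hx1.2⟩
  simp only [ContinuousMap.comp_apply, projIcc_of_mem _ hx1, projIcc_of_mem _ hx2]
  rfl

/-- The map whose zeros over `(y, τ)` are the curves `α` with `α(0) = y` and `α' = τ h(α)`. -/
noncomputable def integralCurveMap [CompleteSpace F] (h : C(F, F))
    (w : (F × ℝ) × C(Icc (0 : ℝ) 1, F)) : (F × ℝ) × C(Icc (0 : ℝ) 1, F) :=
  (w.1, w.2 - (constMapL (Icc (0 : ℝ) 1) F w.1.1 + w.1.2 • primitiveL F (h.comp w.2)))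

theorem contDiff_integralCurveMap [CompleteSpace F] (h : C(F, F)) (hh : ContDiff ℝ ∞ h) :
    ContDiff ℝ ∞ (integralCurveMap h) := by
  have h1 : ContDiff ℝ ∞ fun w : (F × ℝ) × C(Icc (0 : ℝ) 1, F) => h.comp w.2 :=
    (contDiff_comp_left h hh).comp contDiff_snd
  have h2 : ContDiff ℝ ∞ fun w : (F × ℝ) × C(Icc (0 : ℝ) 1, F) => primitiveL F (h.comp w.2) :=
    (primitiveL F).contDiff.comp h1
  have h3 : ContDiff ℝ ∞ fun w : (F × ℝ) × C(Icc (0 : ℝ) 1, F) =>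
      constMapL (Icc (0 : ℝ) 1) F w.1.1 :=
    (constMapL (Icc (0 : ℝ) 1) F).contDiff.comp (contDiff_fst.comp contDiff_fst)
  exact contDiff_fst.prodMk
    (contDiff_snd.sub (h3.add ((contDiff_snd.comp contDiff_fst).smul h2)))

/-- The derivative of the nonlinear term in the curve direction carries the factor `τ = 0`. What
remains is triangular, the identity plus a map `A` from the parameters to the curves, so its inverse
is explicit and no contraction estimate is needed. -/
theorem hasFDerivAt_integralCurveMap [CompleteSpace F] (h : C(F, F)) (hh : ContDiff ℝ ∞ h)
    (y : F) : ∃ e : ((F × ℝ) × C(Icc (0 : ℝ) 1, F)) ≃L[ℝ] (F × ℝ) × C(Icc (0 : ℝ) 1, F),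
      HasFDerivAt (integralCurveMap h)
        (e : ((F × ℝ) × C(Icc (0 : ℝ) 1, F)) →L[ℝ] (F × ℝ) × C(Icc (0 : ℝ) 1, F))
        ((y, 0), constMapL (Icc (0 : ℝ) 1) F y) := by
  set w₀ : (F × ℝ) × C(Icc (0 : ℝ) 1, F) := ((y, 0), constMapL (Icc (0 : ℝ) 1) F y) with hw₀
  let P : (F × ℝ) × C(Icc (0 : ℝ) 1, F) → C(Icc (0 : ℝ) 1, F) := fun w => primitiveL F (h.comp w.2)
  have hP : DifferentiableAt ℝ P w₀ :=
    (((primitiveL F).contDiff.comp ((contDiff_comp_left h hh).comp contDiff_snd)).differentiable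
      (by simp)).differentiableAt
  let A : F × ℝ →L[ℝ] C(Icc (0 : ℝ) 1, F) :=
    (constMapL (Icc (0 : ℝ) 1) F).comp (ContinuousLinearMap.fst ℝ F ℝ)
      + (ContinuousLinearMap.snd ℝ F ℝ).smulRight (P w₀)
  let e : ((F × ℝ) × C(Icc (0 : ℝ) 1, F)) ≃L[ℝ] (F × ℝ) × C(Icc (0 : ℝ) 1, F) :=
    ContinuousLinearEquiv.equivOfInverse
      ((ContinuousLinearMap.fst ℝ _ _).prod
        (ContinuousLinearMap.snd ℝ _ _ - A.comp (ContinuousLinearMap.fst ℝ _ _)))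
      ((ContinuousLinearMap.fst ℝ _ _).prod
        (ContinuousLinearMap.snd ℝ _ _ + A.comp (ContinuousLinearMap.fst ℝ _ _)))
      (fun w => by simp) (fun w => by simp)
  refine ⟨e, ?_⟩
  have h1 := ((constMapL (Icc (0 : ℝ) 1) F).comp
    ((ContinuousLinearMap.fst ℝ F ℝ).comp
      (ContinuousLinearMap.fst ℝ (F × ℝ) C(Icc (0 : ℝ) 1, F)))).hasFDerivAt (x := w₀)
  have h2 := ((ContinuousLinearMap.snd ℝ F ℝ).comp
      (ContinuousLinearMap.fst ℝ (F × ℝ) C(Icc (0 : ℝ) 1, F))).hasFDerivAt (x := w₀)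
  have h3 := (ContinuousLinearMap.fst ℝ (F × ℝ) C(Icc (0 : ℝ) 1, F)).hasFDerivAt (x := w₀)
  have h4 := (ContinuousLinearMap.snd ℝ (F × ℝ) C(Icc (0 : ℝ) 1, F)).hasFDerivAt (x := w₀)
  have h5 := h3.prodMk (h4.sub (h1.add (h2.smul hP.hasFDerivAt)))
  refine HasFDerivAt.congr_fderiv (f' := _) h5 ?_
  ext w <;> simp [e, A, hw₀]

/-- Existence of a smooth local flow for a smooth vector field. -/
theorem exists_smooth_flow [CompleteSpace F] (h : C(F, F)) (hh : ContDiff ℝ ∞ h) (y₀ : F) :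
    ∃ ψ : F × ℝ → F, SmoothNear ψ (y₀, 0) ∧ (∀ᶠ y in 𝓝 y₀, ψ (y, 0) = y) ∧
      ∀ᶠ u in 𝓝 (y₀, (0 : ℝ)), HasDerivAt (fun t => ψ (u.1, t)) (h (ψ u)) u.2 := by
  obtain ⟨e, he⟩ := hasFDerivAt_integralCurveMap h hh y₀
  set w₀ : (F × ℝ) × C(Icc (0 : ℝ) 1, F) := ((y₀, 0), constMapL (Icc (0 : ℝ) 1) F y₀) with hw₀
  have hsm : SmoothNear (integralCurveMap h) w₀ :=
    Eventually.of_forall fun x => (contDiff_integralCurveMap h hh).contDiffAt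
  obtain ⟨φ, hφ, hws, -, -, hsymm, -⟩ := hsm.exists_openPartialHomeomorph e he univ_mem
  -- `α (y, τ)` is the curve on `[0, 1]` starting at `y` with velocity `τ h`, read off from the
  -- local inverse over the zero second component.
  let α : F × ℝ → C(Icc (0 : ℝ) 1, F) := fun u => (φ.symm (u, 0)).2
  have hΨ₀ : φ w₀ = ((y₀, 0), 0) := by
    rw [hφ, hw₀]
    ext <;> simp [integralCurveMap]
  have hα₀ : α (y₀, 0) = constMapL (Icc (0 : ℝ) 1) F y₀ := by
    show (φ.symm ((y₀, 0), 0)).2 = _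
    rw [← hΨ₀, φ.left_inv hws]
  have htgt : ∀ᶠ u in 𝓝 (y₀, (0 : ℝ)), (u, (0 : C(Icc (0 : ℝ) 1, F))) ∈ φ.target := by
    have : Tendsto (fun u : F × ℝ => (u, (0 : C(Icc (0 : ℝ) 1, F)))) (𝓝 (y₀, 0))
        (𝓝 ((y₀, 0), 0)) := (Continuous.prodMk_left _).tendsto _
    exact this (φ.open_target.mem_nhds (hΨ₀ ▸ φ.map_source hws))
  have hαsm : ∀ᶠ u in 𝓝 (y₀, (0 : ℝ)), ContDiffAt ℝ ∞ α u := by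
    filter_upwards [htgt] with u hu
    have h1 := (hsymm _ hu).contDiffAt (φ.open_target.mem_nhds hu)
    exact contDiffAt_snd.comp _ (h1.comp u (contDiff_prodMk_left _).contDiffAt)
  have hαeq : ∀ u, (u, (0 : C(Icc (0 : ℝ) 1, F))) ∈ φ.target →
      α u = constMapL (Icc (0 : ℝ) 1) F u.1 + u.2 • primitiveL F (h.comp (α u)) := by
    intro u hu
    have h1 := φ.right_inv hu
    rw [hφ] at h1
    have h2 : (φ.symm (u, 0)).1 = u := congrArg Prod.fst h1
    have h3 := congrArg Prod.snd h1
    simp only [integralCurveMap, h2] at h3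
    exact sub_eq_zero.1 h3
  obtain ⟨ε, hε, hball⟩ := Metric.mem_nhds_iff.1 (φ.open_source.mem_nhds hws)
  have hαball : ∀ᶠ u in 𝓝 (y₀, (0 : ℝ)), dist (α u) (constMapL (Icc (0 : ℝ) 1) F y₀) < ε := by
    have h1 : ContinuousAt α (y₀, 0) := hαsm.self_of_nhds.continuousAt
    have h2 := h1 (Metric.ball_mem_nhds (α (y₀, 0)) hε)
    rw [hα₀] at h2
    exact h2
  obtain ⟨r₀, hr₀, H₀⟩ := Metric.eventually_nhds_iff.1 (htgt.and (hαsm.and hαball))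
  set r := min r₀ ε with hr
  have hrpos : 0 < r := lt_min hr₀ hε
  have H : ∀ y : F, ∀ τ : ℝ, dist y y₀ < r → |τ| < r → dist (y, τ) (y₀, (0 : ℝ)) < r := by
    intro y τ hy hτ
    rw [Prod.dist_eq, max_lt_iff]
    exact ⟨hy, by simpa using hτ⟩
  -- Uniqueness comes from injectivity of `φ` on its source: the rescaled curve stays in the same
  -- ball and solves the equation for `s τ`.
  have hscale : ∀ y : F, ∀ τ : ℝ, dist y y₀ < r → |τ| < r → ∀ s : Icc (0 : ℝ) 1,
      α (y, s * τ) = (α (y, τ)).comp (scaleIcc s) := by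
    intro y τ hy hτ s
    have hu := H₀ ((H y τ hy hτ).trans_le (min_le_left _ _))
    have hsτ : |(s : ℝ) * τ| < r := by
      rw [abs_mul, abs_of_nonneg s.2.1]
      exact (mul_le_of_le_one_left (abs_nonneg _) s.2.2).trans_lt hτ
    have hmem : ((y, (s : ℝ) * τ), (α (y, τ)).comp (scaleIcc s)) ∈ φ.source := by
      apply hball
      rw [Metric.mem_ball, Prod.dist_eq, max_lt_iff]
      refine ⟨(H y _ hy hsτ).trans_le (min_le_right _ _), ?_⟩
      refine lt_of_le_of_lt ?_ hu.2.2
      rw [ContinuousMap.dist_le dist_nonneg]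
      intro x
      exact ContinuousMap.dist_apply_le_dist (f := α (y, τ))
        (g := constMapL (Icc (0 : ℝ) 1) F y₀) (scaleIcc s x)
    have hval : φ ((y, (s : ℝ) * τ), (α (y, τ)).comp (scaleIcc s)) = ((y, (s : ℝ) * τ), 0) := by
      rw [hφ]
      refine Prod.ext rfl ?_
      simp only [integralCurveMap]
      rw [sub_eq_zero]
      ext x
      have h1 := congrArg (fun β : C(Icc (0 : ℝ) 1, F) => β (s * x)) (hαeq (y, τ) hu.1)
      have h2 := primitiveL_comp_scaleIcc (h.comp (α (y, τ))) s x
      simp only [ContinuousMap.add_apply, ContinuousMap.smul_apply, constMapL_apply] at h1 ⊢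
      rw [← h2] at h1
      rw [mul_comm, mul_smul]
      exact h1
    show (φ.symm ((y, (s : ℝ) * τ), 0)).2 = _
    rw [← hval, φ.left_inv hmem]
  -- The flow at time `τ` is the time-one value of the curve with velocity `τ h`.
  let one : Icc (0 : ℝ) 1 := ⟨1, by simp⟩
  refine ⟨fun u => α u one, ?_, ?_, ?_⟩
  · filter_upwards [hαsm] with u hu
    exact ((ContinuousMap.evalCLM (M := F) ℝ one).contDiff.contDiffAt).comp u hu
  · filter_upwards [Metric.ball_mem_nhds y₀ hrpos] with y hy
    have hu := H₀ ((H y 0 hy (by simpa using hrpos)).trans_le (min_le_left _ _))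
    have h1 := hαeq (y, 0) hu.1
    rw [zero_smul, add_zero] at h1
    show α (y, 0) one = y
    rw [h1, constMapL_apply]
  · filter_upwards [Metric.ball_mem_nhds (y₀, (0 : ℝ)) (half_pos hrpos)] with ⟨y, τ⟩ hu
    rw [Metric.mem_ball, Prod.dist_eq, max_lt_iff] at hu
    have hy : dist y y₀ < r := hu.1.trans (half_lt_self hrpos)
    have hτ : |τ| < r / 2 := by simpa using hu.2
    -- A nonzero `τ₁` with `τ = s₀ τ₁` lets the derivative at `τ` be computed along a single fixed
    -- curve, including at `τ = 0`.
    obtain ⟨τ₁, hτ₁, hτ₁r, s₀, hs₀⟩ : ∃ τ₁ : ℝ, τ₁ ≠ 0 ∧ |τ₁| < r ∧ ∃ s₀ : Icc (0 : ℝ) 1,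
        (s₀ : ℝ) * τ₁ = τ := by
      have habs : |τ| / (r / 2) ≤ 1 := (div_le_one (half_pos hrpos)).2 hτ.le
      refine ⟨if 0 ≤ τ then r / 2 else -(r / 2), ?_, ?_,
        ⟨|τ| / (r / 2), by positivity, habs⟩, ?_⟩
      · split_ifs
        · exact (half_pos hrpos).ne'
        · exact neg_ne_zero.2 (half_pos hrpos).ne'
      · split_ifs
        · rw [abs_of_pos (half_pos hrpos)]
          exact half_lt_self hrpos
        · rw [abs_neg, abs_of_pos (half_pos hrpos)]
          exact half_lt_self hrpos
      · have := (half_pos hrpos).ne'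
        split_ifs with h0
        · show |τ| / (r / 2) * (r / 2) = τ
          rw [div_mul_cancel₀ _ this, abs_of_nonneg h0]
        · show |τ| / (r / 2) * -(r / 2) = τ
          rw [mul_neg, div_mul_cancel₀ _ this, abs_of_neg (not_le.1 h0), neg_neg]
    have hu₁ := H₀ ((H y τ₁ hy hτ₁r).trans_le (min_le_left _ _))
    have hu₂ := H₀ ((H y τ hy (hτ.trans (half_lt_self hrpos))).trans_le (min_le_left _ _))
    set β := h.comp (α (y, τ₁)) with hβ
    have hval : ∀ s : Icc (0 : ℝ) 1, α (y, s * τ₁) one =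
        y + τ₁ • ∫ x in (0 : ℝ)..s, β (projIcc 0 1 zero_le_one x) := by
      intro s
      rw [hscale y τ₁ hy hτ₁r s]
      have h1 := congrArg (fun β : C(Icc (0 : ℝ) 1, F) => β s) (hαeq (y, τ₁) hu₁.1)
      have h2 : scaleIcc s one = s := by
        ext
        simp [scaleIcc, one]
      rw [ContinuousMap.comp_apply, h2]
      exact h1
    have hdiff : DifferentiableAt ℝ (fun t : ℝ => α (y, t) one) τ := by
      have h1 : ContDiffAt ℝ ∞ (fun u => α u one) (y, τ) :=
        ((ContinuousMap.evalCLM (M := F) ℝ one).contDiff.contDiffAt).comp (y, τ) hu₂.2.1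
      have h2 : ContDiffAt ℝ ∞ (fun t : ℝ => (y, t)) τ := (contDiff_prodMk_right y).contDiffAt
      exact (ContDiffAt.comp τ h1 h2).differentiableAt (by simp)
    have hd := hdiff.hasDerivAt
    have h1 : HasDerivAt (fun s : ℝ => α (y, s * τ₁) one)
        (τ₁ • deriv (fun t : ℝ => α (y, t) one) τ) s₀ := by
      rw [← hs₀] at hd ⊢
      exact hd.scomp (s₀ : ℝ) (hasDerivAt_mul_const τ₁)
    have h2 : HasDerivAt (fun s : ℝ => y + τ₁ • ∫ x in (0 : ℝ)..s,
        β (projIcc 0 1 zero_le_one x)) (τ₁ • β s₀) s₀ := by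
      have h3 := intervalIntegral.integral_hasDerivAt_right
        ((continuous_comp_projIcc β).intervalIntegrable 0 (s₀ : ℝ))
        ((continuous_comp_projIcc β).stronglyMeasurableAtFilter _ _)
        (continuous_comp_projIcc β).continuousAt
      rw [projIcc_val] at h3
      exact (h3.const_smul τ₁).const_add y
    -- The two functions are known to agree only on `[0, 1]`, and `s₀` may be the endpoint `0`, so
    -- derivatives within the interval are compared.
    have h4 : τ₁ • deriv (fun t : ℝ => α (y, t) one) τ = τ₁ • β s₀ := by
      refine (uniqueDiffOn_Icc_zero_one (s₀ : ℝ) s₀.2).eq_deriv _ h1.hasDerivWithinAt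
        (h2.hasDerivWithinAt.congr ?_ (hval s₀))
      intro s hs
      exact hval ⟨s, hs⟩
    have h5 : deriv (fun t : ℝ => α (y, t) one) τ = β s₀ := smul_right_injective F hτ₁ h4
    rw [h5, hβ] at hd
    have h6 : α (y, τ₁) s₀ = α (y, τ) one := by
      rw [← hs₀, hscale y τ₁ hy hτ₁r s₀, ContinuousMap.comp_apply]
      congr 1
      ext
      simp [scaleIcc, one]
    rw [ContinuousMap.comp_apply, h6] at hd
    exact hd

end Flow

/-! ### Closure properties of smooth germs -/

namespace SmoothNear

variable {E F G : Type*} [NormedAddCommGroup E] [NormedSpace ℝ E] [NormedAddCommGroup F]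
  [NormedSpace ℝ F] [NormedAddCommGroup G] [NormedSpace ℝ G] {a : E}

theorem contDiffAt {f : E → F} (hf : SmoothNear f a) : ContDiffAt ℝ ∞ f a := hf.self_of_nhds

theorem differentiableAt {f : E → F} (hf : SmoothNear f a) : DifferentiableAt ℝ f a :=
  hf.contDiffAt.differentiableAt (by simp)

theorem continuousAt {f : E → F} (hf : SmoothNear f a) : ContinuousAt f a :=
  hf.contDiffAt.continuousAt

theorem eventually {f : E → F} (hf : SmoothNear f a) : ∀ᶠ x in 𝓝 a, SmoothNear f x :=
  eventually_eventually_nhds.2 hf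

theorem of_contDiff {f : E → F} (hf : ContDiff ℝ ∞ f) : SmoothNear f a :=
  Eventually.of_forall fun _ => hf.contDiffAt

theorem const (c : F) : SmoothNear (fun _ : E => c) a := of_contDiff contDiff_const

theorem add {f g : E → F} (hf : SmoothNear f a) (hg : SmoothNear g a) :
    SmoothNear (fun x => f x + g x) a := by
  filter_upwards [hf, hg] with x h1 h2 using h1.add h2

theorem sub {f g : E → F} (hf : SmoothNear f a) (hg : SmoothNear g a) :
    SmoothNear (fun x => f x - g x) a := by
  filter_upwards [hf, hg] with x h1 h2 using h1.sub h2

theorem neg {f : E → F} (hf : SmoothNear f a) : SmoothNear (fun x => -f x) a := by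
  filter_upwards [hf] with x h1 using h1.neg

theorem smul {f : E → ℝ} {g : E → F} (hf : SmoothNear f a) (hg : SmoothNear g a) :
    SmoothNear (fun x => f x • g x) a := by
  filter_upwards [hf, hg] with x h1 h2 using h1.smul h2

theorem mul {f g : E → ℝ} (hf : SmoothNear f a) (hg : SmoothNear g a) :
    SmoothNear (fun x => f x * g x) a := by
  filter_upwards [hf, hg] with x h1 h2 using h1.mul h2

theorem eventually_ne {f : E → F} (hf : SmoothNear f a) {c : F} (h : f a ≠ c) :
    ∀ᶠ x in 𝓝 a, f x ≠ c := hf.continuousAt.eventually_ne h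

theorem inv {f : E → ℝ} (hf : SmoothNear f a) (h : f a ≠ 0) :
    SmoothNear (fun x => (f x)⁻¹) a := by
  filter_upwards [hf, hf.eventually_ne h] with x h1 h2 using h1.inv h2

theorem div {f g : E → ℝ} (hf : SmoothNear f a) (hg : SmoothNear g a) (h : g a ≠ 0) :
    SmoothNear (fun x => f x / g x) a := by
  simpa only [div_eq_mul_inv] using hf.mul (hg.inv h)

theorem clm {f : E → F} (hf : SmoothNear f a) (L : F →L[ℝ] G) :
    SmoothNear (fun x => L (f x)) a := by
  filter_upwards [hf] with x h1 using L.contDiff.contDiffAt.comp x h1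

theorem clm_apply {f : E → F →L[ℝ] G} {g : E → F} (hf : SmoothNear f a) (hg : SmoothNear g a) :
    SmoothNear (fun x => f x (g x)) a := by
  filter_upwards [hf, hg] with x h1 h2 using h1.clm_apply h2

theorem clm_comp {H : Type*} [NormedAddCommGroup H] [NormedSpace ℝ H] {f : E → G →L[ℝ] H}
    {g : E → F →L[ℝ] G} (hf : SmoothNear f a) (hg : SmoothNear g a) :
    SmoothNear (fun x => (f x).comp (g x)) a := by
  filter_upwards [hf, hg] with x h1 h2 using h1.clm_comp h2

theorem fderiv {f : E → F} (hf : SmoothNear f a) : SmoothNear (fderiv ℝ f) a := by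
  filter_upwards [hf] with x h1 using h1.fderiv_right (by simp)

/-- The derivative of a smooth function along a smooth vector field is smooth. -/
theorem along {f : E → F} {V : E → E} (hf : SmoothNear f a) (hV : SmoothNear V a) :
    SmoothNear (fun x => _root_.fderiv ℝ f x (V x)) a := hf.fderiv.clm_apply hV

theorem lieBracket {V W : E → E} (hV : SmoothNear V a) (hW : SmoothNear W a) :
    SmoothNear (VectorField.lieBracket ℝ V W) a :=
  (hW.along hV).sub (hV.along hW)

theorem comp {f : E → F} {g : F → G} (hg : SmoothNear g (f a)) (hf : SmoothNear f a) :
    SmoothNear (fun x => g (f x)) a := by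
  filter_upwards [hf, hf.continuousAt.eventually hg] with x h1 h2 using h2.comp x h1

theorem apply {n : ℕ} {f : E → Fin n → ℝ} (hf : SmoothNear f a) (i : Fin n) :
    SmoothNear (fun x => f x i) a :=
  hf.clm (ContinuousLinearMap.proj (R := ℝ) (φ := fun _ : Fin n => ℝ) i)

theorem pi {ι : Type*} [Fintype ι] {f : ι → E → F} (hf : ∀ i, SmoothNear (f i) a) :
    SmoothNear (fun x i => f i x) a := by
  filter_upwards [eventually_all.2 hf] with x h1 using contDiffAt_pi.2 h1

theorem sum {ι : Type*} [Fintype ι] {f : ι → E → F} (hf : ∀ i, SmoothNear (f i) a) :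
    SmoothNear (fun x => ∑ i, f i x) a := by
  filter_upwards [eventually_all.2 hf] with x h1 using ContDiffAt.sum fun i _ => h1 i

theorem ringInverse [CompleteSpace F] {f : E → F →L[ℝ] F} (hf : SmoothNear f a)
    (h : IsUnit (f a)) : SmoothNear (fun x => Ring.inverse (f x)) a := by
  have h2 : ∀ᶠ x in 𝓝 a, IsUnit (f x) := hf.continuousAt (Units.nhds h.unit)
  filter_upwards [hf, h2] with x h1 h2
  obtain ⟨u, hu⟩ := h2
  have h3 : ContDiffAt ℝ ∞ Ring.inverse (f x) := hu ▸ contDiffAt_ringInverse ℝ u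
  exact h3.comp x h1

end SmoothNear

/-! ### Smooth factorisation through surjections -/

section Factor

variable {E F G : Type*} [NormedAddCommGroup E] [NormedSpace ℝ E] [NormedAddCommGroup F]
  [NormedSpace ℝ F] [FiniteDimensional ℝ F] [NormedAddCommGroup G] [NormedSpace ℝ G]

/-- A smooth family of linear maps vanishing on the kernels of a smooth family of surjections
factors smoothly through it. -/
theorem exists_smooth_factor {θ : E} {M : E → E →L[ℝ] F} {β : E → E →L[ℝ] G}
    (hM : SmoothNear M θ) (hβ : SmoothNear β θ) (hsurj : Function.Surjective (M θ))
    (hker : ∀ᶠ η in 𝓝 θ, ∀ v, M η v = 0 → β η v = 0) :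
    ∃ A : E → F →L[ℝ] G, SmoothNear A θ ∧ ∀ᶠ η in 𝓝 θ, ∀ v, β η v = A η (M η v) := by
  obtain ⟨R, hR⟩ := (M θ : E →ₗ[ℝ] F).exists_rightInverse_of_surjective
    (LinearMap.range_eq_top.2 hsurj)
  let R₀ : F →L[ℝ] E := LinearMap.toContinuousLinearMap R
  have : CompleteSpace F := FiniteDimensional.complete ℝ F
  have hQ : SmoothNear (fun η => (M η).comp R₀) θ := hM.clm_comp (SmoothNear.const R₀)
  have h1 : (M θ).comp R₀ = 1 := by
    ext v
    exact LinearMap.congr_fun hR v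
  have hunit : IsUnit ((M θ).comp R₀) := h1 ▸ isUnit_one
  have hu : ∀ᶠ η in 𝓝 θ, IsUnit ((M η).comp R₀) := hQ.continuousAt (Units.nhds hunit.unit)
  -- A right inverse `R₀` at `θ` is corrected to the smooth family `R₀ (M η R₀)⁻¹` of right
  -- inverses. The kernel condition makes `β η` insensitive to the choice of preimage.
  refine ⟨fun η => ((β η).comp R₀).comp (Ring.inverse ((M η).comp R₀)),
    (hβ.clm_comp (SmoothNear.const R₀)).clm_comp (hQ.ringInverse hunit), ?_⟩
  filter_upwards [hker, hu] with η h2 h3 v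
  have h4 := congrArg (fun L : F →L[ℝ] F => L (M η v)) (Ring.mul_inverse_cancel _ h3)
  have h5 := h2 (v - R₀ (Ring.inverse ((M η).comp R₀) (M η v))) (by
    rw [map_sub, sub_eq_zero]
    exact h4.symm)
  rw [map_sub, sub_eq_zero] at h5
  exact h5

theorem eventually_surjective {θ : E} {M : E → E →L[ℝ] F} (hM : SmoothNear M θ)
    (hsurj : Function.Surjective (M θ)) : ∀ᶠ η in 𝓝 θ, Function.Surjective (M η) := by
  obtain ⟨R, hR⟩ := (M θ : E →ₗ[ℝ] F).exists_rightInverse_of_surjective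
    (LinearMap.range_eq_top.2 hsurj)
  let R₀ : F →L[ℝ] E := LinearMap.toContinuousLinearMap R
  have : CompleteSpace F := FiniteDimensional.complete ℝ F
  have hQ : SmoothNear (fun η => (M η).comp R₀) θ := hM.clm_comp (SmoothNear.const R₀)
  have h1 : (M θ).comp R₀ = 1 := by
    ext v
    exact LinearMap.congr_fun hR v
  have hunit : IsUnit ((M θ).comp R₀) := h1 ▸ isUnit_one
  have hu : ∀ᶠ η in 𝓝 θ, IsUnit ((M η).comp R₀) := hQ.continuousAt (Units.nhds hunit.unit)
  filter_upwards [hu] with η h3 w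
  exact ⟨_, congrArg (fun L : F →L[ℝ] F => L w) (Ring.mul_inverse_cancel _ h3)⟩

end Factor

/-! ### Smooth frames, coefficients and brackets -/

section Frame

variable {E : Type*} [NormedAddCommGroup E] [NormedSpace ℝ E]

/-- A smooth section of the span of a smooth frame has smooth coefficients. -/
theorem exists_smooth_coeffs [FiniteDimensional ℝ E] {k : ℕ} {θ : E} {A : Fin k → E → E} {V : E → E}
    (hA : ∀ i, SmoothNear (A i) θ) (hli : LinearIndependent ℝ fun i => A i θ)
    (hV : SmoothNear V θ) (hmem : ∀ᶠ η in 𝓝 θ, V η ∈ Submodule.span ℝ (range fun i => A i η)) :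
    ∃ c : Fin k → E → ℝ, (∀ i, SmoothNear (c i) θ) ∧
      ∀ᶠ η in 𝓝 θ, V η = ∑ i, c i η • A i η := by
  let M : E → (Fin k → ℝ) →L[ℝ] E := fun η =>
    ∑ i, (ContinuousLinearMap.proj (R := ℝ) (φ := fun _ : Fin k => ℝ) i).smulRight (A i η)
  have hMap : ∀ η c, M η c = ∑ i, c i • A i η := fun η c => by simp [M]
  have hM : SmoothNear M θ := by
    refine SmoothNear.sum fun i => ?_
    exact (hA i).clm (ContinuousLinearMap.smulRightL ℝ (Fin k → ℝ) E
      (ContinuousLinearMap.proj (R := ℝ) (φ := fun _ : Fin k => ℝ) i))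
  have hinj : LinearMap.ker (M θ : (Fin k → ℝ) →ₗ[ℝ] E) = ⊥ := by
    rw [LinearMap.ker_eq_bot']
    intro c hc
    rw [ContinuousLinearMap.coe_coe, hMap] at hc
    exact funext fun i => Fintype.linearIndependent_iff.1 hli c hc i
  obtain ⟨L, hL⟩ := (M θ : (Fin k → ℝ) →ₗ[ℝ] E).exists_leftInverse_of_injective hinj
  let L₀ : E →L[ℝ] (Fin k → ℝ) := LinearMap.toContinuousLinearMap L
  have hQ : SmoothNear (fun η => L₀.comp (M η)) θ := (SmoothNear.const L₀).clm_comp hM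
  have h1 : L₀.comp (M θ) = 1 := by
    apply ContinuousLinearMap.coe_injective
    exact hL
  have hunit : IsUnit (L₀.comp (M θ)) := h1 ▸ isUnit_one
  have hu : ∀ᶠ η in 𝓝 θ, IsUnit (L₀.comp (M η)) := hQ.continuousAt (Units.nhds hunit.unit)
  refine ⟨fun i η => Ring.inverse (L₀.comp (M η)) (L₀ (V η)) i, fun i =>
    ((hQ.ringInverse hunit).clm_apply (hV.clm L₀)).apply i, ?_⟩
  filter_upwards [hmem, hu] with η h2 h3
  obtain ⟨a, ha⟩ := (Submodule.mem_span_range_iff_exists_fun ℝ).1 h2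
  have h4 : Ring.inverse (L₀.comp (M η)) (L₀ (V η)) = a := by
    rw [← ha, ← hMap]
    exact congrArg (fun L : (Fin k → ℝ) →L[ℝ] (Fin k → ℝ) => L a) (Ring.inverse_mul_cancel _ h3)
  simp only [h4, ha]

/-- In the Leibniz expansion, derivatives of the coefficients multiply only values of the frame
fields. Hence it suffices that `M` contains those values and the brackets of the frame fields at the
single point `θ`. -/
theorem lieBracket_mem_of_eventuallyEq_sum {k l : ℕ} {θ : E} {A : Fin k → E → E}
    {B : Fin l → E → E} {a : Fin k → E → ℝ} {b : Fin l → E → ℝ} {V W : E → E}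
    (hA : ∀ i, SmoothNear (A i) θ) (hB : ∀ j, SmoothNear (B j) θ)
    (ha : ∀ i, SmoothNear (a i) θ) (hb : ∀ j, SmoothNear (b j) θ)
    (hV : ∀ᶠ η in 𝓝 θ, V η = ∑ i, a i η • A i η) (hW : ∀ᶠ η in 𝓝 θ, W η = ∑ j, b j η • B j η)
    {M : Submodule ℝ E} (hAM : ∀ i, A i θ ∈ M) (hBM : ∀ j, B j θ ∈ M)
    (hAB : ∀ i j, VectorField.lieBracket ℝ (A i) (B j) θ ∈ M) :
    VectorField.lieBracket ℝ V W θ ∈ M := by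
  rw [Filter.EventuallyEq.lieBracket_vectorField_eq (V₁ := V) hV hW]
  have hfd : ∀ {n : ℕ} (c : Fin n → E → ℝ) (C : Fin n → E → E), (∀ i, SmoothNear (c i) θ) →
      (∀ i, SmoothNear (C i) θ) → ∀ v, fderiv ℝ (fun η => ∑ i, c i η • C i η) θ v
        = ∑ i, (c i θ • fderiv ℝ (C i) θ v + fderiv ℝ (c i) θ v • C i θ) := by
    intro n c C hc hC v
    have : HasFDerivAt (fun η => ∑ i, c i η • C i η)
        (∑ i, (c i θ • fderiv ℝ (C i) θ + (fderiv ℝ (c i) θ).smulRight (C i θ))) θ :=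
      HasFDerivAt.fun_sum fun i _ =>
        (hc i).differentiableAt.hasFDerivAt.smul (hC i).differentiableAt.hasFDerivAt
    rw [this.fderiv]
    simp
  have key : VectorField.lieBracket ℝ (fun η => ∑ i, a i η • A i η)
      (fun η => ∑ j, b j η • B j η) θ =
      (∑ i, ∑ j, (a i θ * b j θ) • VectorField.lieBracket ℝ (A i) (B j) θ)
      + ∑ j, fderiv ℝ (b j) θ (∑ i, a i θ • A i θ) • B j θ
      - ∑ i, fderiv ℝ (a i) θ (∑ j, b j θ • B j θ) • A i θ := by
    have e1 : ∑ i, ∑ j, (a i θ * b j θ) • VectorField.lieBracket ℝ (A i) (B j) θ =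
        ∑ j, b j θ • fderiv ℝ (B j) θ (∑ i, a i θ • A i θ)
        - ∑ i, a i θ • fderiv ℝ (A i) θ (∑ j, b j θ • B j θ) := by
      simp only [VectorField.lieBracket, smul_sub, Finset.sum_sub_distrib, map_sum, map_smul,
        Finset.smul_sum, smul_smul]
      congr 1
      rw [Finset.sum_comm]
      simp only [mul_comm]
    rw [e1]
    simp only [VectorField.lieBracket]
    rw [hfd b B hb hB, hfd a A ha hA, Finset.sum_add_distrib, Finset.sum_add_distrib]
    abel
  rw [key]
  refine M.sub_mem (M.add_mem ?_ ?_) ?_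
  · exact M.sum_mem fun i _ => M.sum_mem fun j _ => M.smul_mem _ (hAB i j)
  · exact M.sum_mem fun j _ => M.smul_mem _ (hBM j)
  · exact M.sum_mem fun i _ => M.smul_mem _ (hAM i)

/-- The bracket of two sections of spans of smooth frames lies in any subspace containing the
values of the frames and of their brackets. -/
theorem lieBracket_mem_of_frames [FiniteDimensional ℝ E] {k l : ℕ} {θ : E} {A : Fin k → E → E}
    {B : Fin l → E → E} {V W : E → E}
    (hA : ∀ i, SmoothNear (A i) θ) (hB : ∀ j, SmoothNear (B j) θ)
    (hAli : LinearIndependent ℝ fun i => A i θ) (hBli : LinearIndependent ℝ fun j => B j θ)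
    (hVs : SmoothNear V θ) (hWs : SmoothNear W θ)
    (hV : ∀ᶠ η in 𝓝 θ, V η ∈ Submodule.span ℝ (range fun i => A i η))
    (hW : ∀ᶠ η in 𝓝 θ, W η ∈ Submodule.span ℝ (range fun j => B j η))
    {M : Submodule ℝ E} (hAM : ∀ i, A i θ ∈ M) (hBM : ∀ j, B j θ ∈ M)
    (hAB : ∀ i j, VectorField.lieBracket ℝ (A i) (B j) θ ∈ M) :
    VectorField.lieBracket ℝ V W θ ∈ M := by
  obtain ⟨a, ha, hVa⟩ := exists_smooth_coeffs hA hAli hVs hV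
  obtain ⟨b, hb, hWb⟩ := exists_smooth_coeffs hB hBli hWs hW
  exact lieBracket_mem_of_eventuallyEq_sum hA hB ha hb hVa hWb hAM hBM hAB

theorem eventually_linearIndependent {k : ℕ} {θ : E} {A : Fin k → E → E}
    (hA : ∀ i, SmoothNear (A i) θ) (hli : LinearIndependent ℝ fun i => A i θ) :
    ∀ᶠ η in 𝓝 θ, LinearIndependent ℝ fun i => A i η := by
  have h : ContinuousAt (fun η i => A i η) θ := (SmoothNear.pi hA).continuousAt
  exact h (isOpen_setOfPred_linearIndependent.mem_nhds hli)

end Frame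

/-- Multiplying by a bump function gives a global representative of the germ, as the flow
construction works with globally smooth fields. -/
theorem SmoothNear.exists_contDiff_eventuallyEq {E F : Type*} [NormedAddCommGroup E]
    [NormedSpace ℝ E] [FiniteDimensional ℝ E] [NormedAddCommGroup F] [NormedSpace ℝ F]
    {f : E → F} {a : E} (hf : SmoothNear f a) :
    ∃ g : E → F, ContDiff ℝ ∞ g ∧ g =ᶠ[𝓝 a] f := by
  obtain ⟨ε, hε, hb⟩ := Metric.eventually_nhds_iff.1 hf
  let χ : ContDiffBump a := ⟨ε / 4, ε / 2, by positivity, by linarith⟩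
  refine ⟨fun x => χ x • f x, ?_, ?_⟩
  · refine contDiff_iff_contDiffAt.2 fun x => ?_
    by_cases hx : x ∈ Metric.closedBall a (ε / 2)
    · refine χ.contDiffAt.smul (hb ?_)
      exact (Metric.mem_closedBall.1 hx).trans_lt (half_lt_self hε)
    · have h1 : (Metric.closedBall a (ε / 2))ᶜ ∈ 𝓝 x :=
        Metric.isClosed_closedBall.isOpen_compl.mem_nhds hx
      refine (contDiffAt_const (c := (0 : F))).congr_of_eventuallyEq ?_
      filter_upwards [h1] with y hy
      rw [χ.zero_of_le_dist (le_of_lt (by simpa using hy)), zero_smul]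
  · filter_upwards [χ.eventuallyEq_one] with x hx
    simp [hx]

/-! ### Straightening a nonvanishing vector field -/

section FlowBox

/-- Straightening: a nonvanishing smooth vector field on `ℝ^(m+1)` has `m` independent smooth
first integrals near any point. -/
theorem exists_flowBox {m : ℕ} {h : (Fin (m + 1) → ℝ) → Fin (m + 1) → ℝ} {y₀ : Fin (m + 1) → ℝ}
    (hh : SmoothNear h y₀) (h0 : h y₀ ≠ 0) :
    ∃ g : (Fin (m + 1) → ℝ) → Fin m → ℝ, SmoothNear g y₀ ∧
      Function.Surjective (fderiv ℝ g y₀) ∧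
      ∀ᶠ y in 𝓝 y₀, ∀ w, fderiv ℝ g y w = 0 ↔ ∃ c : ℝ, w = c • h y := by
  obtain ⟨h₁, hh₁, heq⟩ := hh.exists_contDiff_eventuallyEq
  obtain ⟨ψ, hψ, hψ0, hψd⟩ := exists_smooth_flow ⟨h₁, hh₁.continuous⟩ hh₁ y₀
  simp only [ContinuousMap.coe_mk] at hψd
  have hh₁0 : h₁ y₀ = h y₀ := heq.self_of_nhds
  -- `e` sends the time axis to `h y₀` and the remaining factor onto a complement. It will be the
  -- derivative at `0` of the flow box.
  obtain ⟨e, he⟩ : ∃ e : (ℝ × (Fin m → ℝ)) ≃L[ℝ] (Fin (m + 1) → ℝ), e (1, 0) = h₁ y₀ := by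
    rw [hh₁0]
    obtain ⟨q, hq⟩ := (Submodule.span ℝ {h y₀}).exists_isCompl
    have hfin : Module.finrank ℝ q = Module.finrank ℝ (Fin m → ℝ) := by
      have h1 := Submodule.finrank_add_eq_of_isCompl hq
      rw [finrank_span_singleton h0] at h1
      simp only [Module.finrank_fin_fun] at h1 ⊢
      omega
    let e₁ := LinearEquiv.toSpanNonzeroSingleton ℝ _ (h y₀) h0
    let e₂ := LinearEquiv.ofFinrankEq (Fin m → ℝ) q hfin.symm
    let e₃ := (LinearEquiv.prodCongr e₁ e₂).trans (Submodule.prodEquivOfIsCompl _ _ hq)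
    refine ⟨e₃.toContinuousLinearEquiv, ?_⟩
    simp [e₃, e₁, LinearEquiv.toSpanNonzeroSingleton]
  -- The flow starts from the affine slice `y₀ + e (0, u)`, transversal to `h`; the slice parameter
  -- `u` becomes the vector of first integrals.
  let aff : ℝ × (Fin m → ℝ) → (Fin (m + 1) → ℝ) × ℝ := fun u => (y₀ + e (0, u.2), u.1)
  have haff : ContDiff ℝ ∞ aff := by
    refine ContDiff.prodMk (contDiff_const.add ?_) contDiff_fst
    exact e.contDiff.comp (contDiff_const.prodMk contDiff_snd)
  have haff0 : aff 0 = (y₀, 0) := by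
    have : e ((0 : ℝ), (0 : Fin m → ℝ)) = 0 := e.map_zero
    simp [aff, this]
  let Ψ : ℝ × (Fin m → ℝ) → (Fin (m + 1) → ℝ) := fun u => ψ (aff u)
  have hΨ : SmoothNear Ψ 0 := SmoothNear.comp (haff0 ▸ hψ) (SmoothNear.of_contDiff haff)
  have htend : Tendsto aff (𝓝 0) (𝓝 (y₀, 0)) := haff0 ▸ haff.continuous.tendsto 0
  have hΨd : ∀ᶠ u in 𝓝 (0 : ℝ × (Fin m → ℝ)), fderiv ℝ Ψ u (1, 0) = h₁ (Ψ u) := by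
    filter_upwards [htend.eventually hψd, hΨ] with u h1 h2
    have h3 : HasDerivAt (fun t : ℝ => (t, u.2)) ((1 : ℝ), (0 : Fin m → ℝ)) u.1 :=
      (hasDerivAt_id u.1).prodMk (hasDerivAt_const u.1 u.2)
    have h4 := HasFDerivAt.comp_hasDerivAt u.1 (f := fun t : ℝ => (t, u.2)) (l := Ψ)
      (h2.differentiableAt (by simp)).hasFDerivAt h3
    exact h4.unique h1
  have hder0 : HasFDerivAt Ψ (e : (ℝ × (Fin m → ℝ)) →L[ℝ] (Fin (m + 1) → ℝ)) 0 := by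
    refine hΨ.differentiableAt.hasFDerivAt.congr_fderiv ?_
    have h1 : ∀ u : Fin m → ℝ, fderiv ℝ Ψ 0 (0, u) = e (0, u) := by
      intro u
      have h2 : HasDerivAt (fun t : ℝ => t • ((0 : ℝ), u)) ((0 : ℝ), u) 0 := by
        simpa using (hasDerivAt_id (0 : ℝ)).smul_const ((0 : ℝ), u)
      have h3 : HasFDerivAt Ψ (fderiv ℝ Ψ 0) ((0 : ℝ) • ((0 : ℝ), u)) := by
        rw [zero_smul]
        exact hΨ.differentiableAt.hasFDerivAt
      have h4 := h3.comp_hasDerivAt 0 h2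
      have h5 : HasDerivAt (fun t : ℝ => y₀ + t • e (0, u)) (e (0, u)) 0 := by
        simpa using ((hasDerivAt_id (0 : ℝ)).smul_const (e (0, u))).const_add y₀
      have h6 : Tendsto (fun t : ℝ => y₀ + t • e (0, u)) (𝓝 0) (𝓝 y₀) := by
        simpa using h5.continuousAt.tendsto
      refine (h5.congr_of_eventuallyEq ?_).unique h4 |>.symm
      filter_upwards [h6.eventually hψ0] with t ht
      have h7 : e ((0 : ℝ), t • u) = t • e (0, u) := by
        rw [← map_smul, Prod.smul_mk, smul_zero]
      simp only [Function.comp_apply, Ψ, aff, Prod.smul_mk, smul_zero, h7]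
      exact ht
    have h2 := hΨd.self_of_nhds
    have h3 : Ψ 0 = y₀ := by
      simp only [Ψ, haff0]
      exact hψ0.self_of_nhds
    rw [h3, ← he] at h2
    ext : 1
    · ext1
      exact h2
    · ext1 u
      exact h1 u
  have hΨ00 : Ψ 0 = y₀ := by
    simp only [Ψ, haff0]
    exact hψ0.self_of_nhds
  have hgood : ∀ᶠ u in 𝓝 (0 : ℝ × (Fin m → ℝ)), fderiv ℝ Ψ u (1, 0) = h (Ψ u) := by
    have h1 : Tendsto Ψ (𝓝 0) (𝓝 y₀) := hΨ00 ▸ hΨ.continuousAt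
    filter_upwards [hΨd, h1.eventually heq] with u h2 h3
    rw [h2, h3]
  obtain ⟨φ, hφ, hs, hN, -, hsymm, hinv⟩ := hΨ.exists_openPartialHomeomorph e hder0 hgood
  have hy₀ : y₀ ∈ φ.target := by
    rw [← hΨ00, ← hφ]
    exact φ.map_source hs
  have hsm : ∀ y ∈ φ.target, ContDiffAt ℝ ∞ φ.symm y := fun y hy =>
    (hsymm y hy).contDiffAt (φ.open_target.mem_nhds hy)
  have hd : ∀ y ∈ φ.target, ∃ e' : (ℝ × (Fin m → ℝ)) ≃L[ℝ] (Fin (m + 1) → ℝ),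
      HasFDerivAt (fun y => (φ.symm y).2)
        ((ContinuousLinearMap.snd ℝ ℝ (Fin m → ℝ)).comp
          (e'.symm : (Fin (m + 1) → ℝ) →L[ℝ] ℝ × (Fin m → ℝ))) y ∧ e' (1, 0) = h y := by
    intro y hy
    have h1 := φ.map_target hy
    obtain ⟨e', he'⟩ := hinv _ h1
    have h2 : HasFDerivAt φ.symm
        (e'.symm : (Fin (m + 1) → ℝ) →L[ℝ] ℝ × (Fin m → ℝ)) y :=
      φ.hasFDerivAt_symm hy (hφ ▸ he')
    refine ⟨e', (ContinuousLinearMap.snd ℝ ℝ (Fin m → ℝ)).hasFDerivAt.comp y h2, ?_⟩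
    have h3 : fderiv ℝ Ψ (φ.symm y) (1, 0) = h (Ψ (φ.symm y)) := hN h1
    rw [he'.fderiv, ← hφ, φ.right_inv hy] at h3
    exact h3
  refine ⟨fun y => (φ.symm y).2, ?_, ?_, ?_⟩
  · filter_upwards [φ.open_target.mem_nhds hy₀] with y hy
    exact contDiffAt_snd.comp y (hsm y hy)
  · obtain ⟨e', he', -⟩ := hd y₀ hy₀
    rw [he'.fderiv]
    intro w
    exact ⟨e' (0, w), by simp⟩
  · filter_upwards [φ.open_target.mem_nhds hy₀] with y hy w
    obtain ⟨e', he', h1⟩ := hd y hy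
    rw [he'.fderiv]
    constructor
    · intro h2
      refine ⟨(e'.symm w).1, ?_⟩
      have h3 : e'.symm w = (e'.symm w).1 • ((1 : ℝ), (0 : Fin m → ℝ)) := by
        ext1
        · simp
        · simpa using h2
      rw [← h1, ← map_smul, ← h3, e'.apply_symm_apply]
    · rintro ⟨c, rfl⟩
      simp [← h1]

end FlowBox

/-! ### Functions constant along the fibres of a submersion -/

section Submersion

variable {E F G : Type*} [NormedAddCommGroup E] [NormedSpace ℝ E] [FiniteDimensional ℝ E]
  [NormedAddCommGroup F] [NormedSpace ℝ F] [FiniteDimensional ℝ F]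
  [NormedAddCommGroup G] [NormedSpace ℝ G]

/-- A smooth map which is infinitesimally constant along the fibres of a submersion factors
through it. -/
theorem exists_eq_comp_of_submersion {θ : E} {f : E → F} {H : E → G} (hf : SmoothNear f θ)
    (hH : SmoothNear H θ) (hsurj : Function.Surjective (fderiv ℝ f θ))
    (hker : ∀ᶠ η in 𝓝 θ, ∀ v, fderiv ℝ f η v = 0 → fderiv ℝ H η v = 0) :
    ∃ h : F → G, SmoothNear h (f θ) ∧ ∀ᶠ η in 𝓝 θ, H η = h (f η) := by
  have : CompleteSpace E := FiniteDimensional.complete ℝ E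
  set K : Submodule ℝ E := LinearMap.ker (fderiv ℝ f θ : E →ₗ[ℝ] F) with hK
  obtain ⟨P, hP⟩ := Submodule.ClosedComplemented.of_finiteDimensional_quotient
    (p := K) K.closed_of_finiteDimensional
  -- A projection `P` onto the kernel completes `f` to a local diffeomorphism whose first component
  -- is `f`.
  let e : E ≃L[ℝ] F × K := ContinuousLinearEquiv.ofBijective ((fderiv ℝ f θ).prod P)
    (by
      rw [LinearMap.ker_eq_bot']
      intro v hv
      have h1 : fderiv ℝ f θ v = 0 := congrArg Prod.fst hv
      have h2 : P v = 0 := congrArg Prod.snd hv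
      have h3 := hP ⟨v, h1⟩
      rw [h2] at h3
      exact (congrArg Subtype.val h3).symm)
    (by
      rw [LinearMap.range_eq_top]
      rintro ⟨w, k⟩
      obtain ⟨v, rfl⟩ := hsurj w
      refine ⟨v - P v + k, Prod.ext ?_ ?_⟩
      · have h1 : fderiv ℝ f θ (P v) = 0 := (P v).2
        have h2 : fderiv ℝ f θ k = 0 := k.2
        simp [h1, h2]
      · simp [hP])
  let Φ : E → F × K := fun η => (f η, P η)
  have hΦ : SmoothNear Φ θ := by
    filter_upwards [hf] with η h1 using h1.prodMk P.contDiff.contDiffAt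
  have hΦd : HasFDerivAt Φ (e : E →L[ℝ] F × K) θ :=
    hf.differentiableAt.hasFDerivAt.prodMk P.hasFDerivAt
  obtain ⟨φ, hφ, hs, hN, -, hsymm, hinv⟩ :=
    hΦ.exists_openPartialHomeomorph e hΦd ((hf.and hH).and hker)
  have hsm : ∀ y ∈ φ.target, ContDiffAt ℝ ∞ φ.symm y := fun y hy =>
    (hsymm y hy).contDiffAt (φ.open_target.mem_nhds hy)
  have ht : (f θ, P θ) ∈ φ.target := by
    have := φ.map_source hs
    rwa [hφ] at this
  obtain ⟨ε, hε, hball⟩ := Metric.mem_nhds_iff.1 (φ.open_target.mem_nhds ht)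
  -- `h` is `H` restricted to the slice `P = P θ`. Within a fibre the remaining variable ranges over
  -- a convex ball on which the derivative of `H` vanishes.
  refine ⟨fun y => H (φ.symm (y, P θ)), ?_, ?_⟩
  · filter_upwards [Metric.ball_mem_nhds (f θ) hε] with y hy
    have h1 : (y, P θ) ∈ φ.target := hball (by
      rw [Metric.mem_ball, Prod.dist_eq, max_lt_iff]
      exact ⟨hy, by simpa using hε⟩)
    exact (hN (φ.map_target h1)).1.2.comp y ((hsm _ h1).comp y
      (contDiff_prodMk_left (P θ)).contDiffAt)
  · filter_upwards [hf.continuousAt (Metric.ball_mem_nhds (f θ) hε),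
      P.continuous.continuousAt (Metric.ball_mem_nhds (P θ) hε),
      φ.open_source.mem_nhds hs] with η h1 h2 h3
    have hmem : ∀ k ∈ Metric.ball (P θ) ε, (f η, k) ∈ φ.target := fun k hk => hball (by
      rw [Metric.mem_ball, Prod.dist_eq, max_lt_iff]
      exact ⟨h1, hk⟩)
    have hd : ∀ k ∈ Metric.ball (P θ) ε,
        HasFDerivAt (fun k => H (φ.symm (f η, k))) (0 : K →L[ℝ] G) k := by
      intro k hk
      have h4 := hmem k hk
      have h5 := φ.map_target h4
      obtain ⟨e', he'⟩ := hinv _ h5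
      have h6 : HasFDerivAt φ.symm (e'.symm : F × K →L[ℝ] E) (f η, k) :=
        φ.hasFDerivAt_symm h4 (hφ ▸ he')
      have h7 : HasFDerivAt (fun k : K => (f η, k)) (ContinuousLinearMap.inr ℝ F K) k :=
        hasFDerivAt_prodMk_right (f η) k
      have h8 := (((hN h5).1.2.differentiableAt (by simp)).hasFDerivAt.comp (f η, k) h6).comp k h7
      refine h8.congr_fderiv ?_
      ext k'
      have h9 : HasFDerivAt f
          ((ContinuousLinearMap.fst ℝ F K).comp (e' : E →L[ℝ] F × K)) (φ.symm (f η, k)) :=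
        (ContinuousLinearMap.fst ℝ F K).hasFDerivAt.comp _ he'
      refine (hN h5).2 (e'.symm (0, k')) ?_
      rw [h9.fderiv]
      simp
    have hconst := (convex_ball (P θ) ε).is_const_of_fderivWithin_eq_zero (𝕜 := ℝ)
      (f := fun k => H (φ.symm (f η, k)))
      (fun k hk => (hd k hk).differentiableAt.differentiableWithinAt)
      (fun k hk => by
        rw [fderivWithin_of_isOpen Metric.isOpen_ball hk]
        exact (hd k hk).fderiv) h2 (Metric.mem_ball_self hε)
    have h10 : φ.symm (f η, P η) = η := by
      have := φ.left_inv h3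
      rwa [hφ] at this
    simp only [h10] at hconst
    exact hconst

end Submersion

/-! ### First integrals and the inductive step of Frobenius -/

section FirstIntegrals

variable {E : Type*} [NormedAddCommGroup E] [NormedSpace ℝ E]

/-- `f` is a submersion near `θ` whose fibres are tangent to the span of the fields `V i`. -/
def IsFirstIntegral {k m : ℕ} (θ : E) (V : Fin k → E → E) (f : E → Fin m → ℝ) : Prop :=
  SmoothNear f θ ∧ Function.Surjective (fderiv ℝ f θ) ∧
    ∀ᶠ η in 𝓝 θ, ∀ v, fderiv ℝ f η v = 0 ↔ v ∈ Submodule.span ℝ (range fun i => V i η)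

/-- The derivative along a Lie bracket is the commutator of the derivatives along the fields. -/
theorem fderiv_lieBracket {F : Type*} [NormedAddCommGroup F] [NormedSpace ℝ F] {θ : E}
    {f : E → F} {V W : E → E} (hf : SmoothNear f θ) (hV : SmoothNear V θ) (hW : SmoothNear W θ) :
    fderiv ℝ f θ (VectorField.lieBracket ℝ V W θ) =
      fderiv ℝ (fun η => fderiv ℝ f η (W η)) θ (V θ) -
        fderiv ℝ (fun η => fderiv ℝ f η (V η)) θ (W θ) :=
  VectorField.fderiv_apply_lieBracket
    (hf.contDiffAt.of_le (m := 2) (WithTop.coe_le_coe.2 le_top)) (by simp)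
    hW.differentiableAt hV.differentiableAt

theorem fderiv_eq_zero_of_eventually {F : Type*} [NormedAddCommGroup F] [NormedSpace ℝ F] {θ : E}
    {f : E → F} {c : F} (h : ∀ᶠ η in 𝓝 θ, f η = c) : fderiv ℝ f θ = 0 := by
  rw [Filter.EventuallyEq.fderiv_eq (f := fun _ => c) h]
  simp

theorem fderiv_coord {m : ℕ} {θ : E} {f : E → Fin m → ℝ} (hf : DifferentiableAt ℝ f θ)
    (i : Fin m) (v : E) : fderiv ℝ (fun η => f η i) θ v = fderiv ℝ f θ v i := by
  have h := (ContinuousLinearMap.proj (R := ℝ) (φ := fun _ : Fin m => ℝ)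
    i).hasFDerivAt.comp θ hf.hasFDerivAt
  exact congrArg (fun L : E →L[ℝ] ℝ => L v) h.fderiv

variable [FiniteDimensional ℝ E]

/-- Adding `Y` costs one first integral. The bracket condition makes the direction of `df(Y)`
constant along the fibres of `f`, so after normalisation it descends to a nonvanishing field `h` on
the target. Composing `f` with first integrals of `h` gives those of the enlarged family. -/
theorem IsFirstIntegral.exists_cons {k m : ℕ} {θ : E} {V : Fin k → E → E}
    {f : E → Fin (m + 1) → ℝ} {Y : E → E} (hf : IsFirstIntegral θ V f)
    (hV : ∀ i, SmoothNear (V i) θ) (hY : SmoothNear Y θ)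
    (hYV : Y θ ∉ Submodule.span ℝ (range fun i => V i θ))
    (hbr : ∀ᶠ η in 𝓝 θ, ∀ i, VectorField.lieBracket ℝ (V i) Y η ∈
      Submodule.span ℝ (range fun j => (Fin.cons Y V : Fin (k + 1) → E → E) j η)) :
    ∃ g : E → Fin m → ℝ, IsFirstIntegral θ (Fin.cons Y V : Fin (k + 1) → E → E) g := by
  obtain ⟨hfs, hsurj, hker⟩ := hf
  have hVker : ∀ᶠ η in 𝓝 θ, ∀ i, fderiv ℝ f η (V i η) = 0 := by
    filter_upwards [hker] with η h i
    exact (h _).2 (Submodule.subset_span ⟨i, rfl⟩)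
  set H₀ : E → Fin (m + 1) → ℝ := fun η => fderiv ℝ f η (Y η) with hH₀
  have hH₀s : SmoothNear H₀ θ := hfs.along hY
  have hH₀θ : H₀ θ ≠ 0 := fun h => hYV ((hker.self_of_nhds _).1 h)
  obtain ⟨i₀, hi₀⟩ : ∃ i, H₀ θ i ≠ 0 := Function.ne_iff.1 hH₀θ
  have hus : SmoothNear (fun η => H₀ η i₀) θ := hH₀s.apply i₀
  have hspan : ∀ η, Submodule.span ℝ (range fun j => (Fin.cons Y V : Fin (k + 1) → E → E) j η) =
      Submodule.span ℝ {Y η} ⊔ Submodule.span ℝ (range fun i => V i η) := by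
    intro η
    rw [← Submodule.span_union]
    congr 1
    ext v
    simp only [mem_range, Fin.exists_fin_succ, Fin.cons_zero, Fin.cons_succ, singleton_union,
      mem_insert_iff, eq_comm]
  -- Along `V i` the derivative of `df(Y)` is `df([V i, Y])`, because `df(V i) = 0`; only the `Y`
  -- component of the bracket survives.
  have hdH₀ : ∀ᶠ η in 𝓝 θ, ∀ v, fderiv ℝ f η v = 0 → ∃ c : ℝ, fderiv ℝ H₀ η v = c • H₀ η := by
    filter_upwards [hker, hbr, hVker.eventually_nhds, hfs.eventually, hY.eventually,
      eventually_all.2 fun i => (hV i).eventually] with η h1 h2 h3 h4 h5 h6 v hv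
    have h7 : Submodule.span ℝ (range fun i => V i η) ≤
        (Submodule.span ℝ {H₀ η}).comap (fderiv ℝ H₀ η : E →ₗ[ℝ] Fin (m + 1) → ℝ) := by
      rw [Submodule.span_le]
      rintro _ ⟨i, rfl⟩
      have h8 := fderiv_lieBracket h4 (h6 i) h5
      rw [fderiv_eq_zero_of_eventually (h3.mono fun y hy => hy i), zero_apply,
        sub_zero] at h8
      have h9 := h2 i
      rw [hspan, Submodule.mem_sup] at h9
      obtain ⟨a, ha, b, hb, hab⟩ := h9
      obtain ⟨c, rfl⟩ := Submodule.mem_span_singleton.1 ha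
      refine Submodule.mem_span_singleton.2 ⟨c, ?_⟩
      show _ = fderiv ℝ H₀ η (V i η)
      rw [← h8, ← hab, map_add, (h1 b).2 hb, map_smul, add_zero]
    obtain ⟨c, hc⟩ := Submodule.mem_span_singleton.1 (h7 ((h1 v).1 hv))
    exact ⟨c, hc.symm⟩
  -- Dividing by a nonzero component cancels the proportionality factor, so `H` is constant along
  -- the fibres and not merely up to scale.
  set H : E → Fin (m + 1) → ℝ := fun η => (H₀ η i₀)⁻¹ • H₀ η with hH
  have hHs : SmoothNear H θ := (hus.inv hi₀).smul hH₀s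
  have hdH : ∀ᶠ η in 𝓝 θ, ∀ v, fderiv ℝ f η v = 0 → fderiv ℝ H η v = 0 := by
    filter_upwards [hdH₀, hH₀s.eventually, hus.eventually_ne hi₀] with η h1 h2 h3 v hv
    obtain ⟨c, hc⟩ := h1 v hv
    have h4 := h2.differentiableAt.hasFDerivAt
    have h5 := (h2.apply i₀).differentiableAt.hasFDerivAt
    have h6 : fderiv ℝ (fun η => H₀ η i₀) η v = c * H₀ η i₀ := by
      rw [fderiv_coord h2.differentiableAt, hc]
      rfl
    have h9 := ((hasDerivAt_inv h3).comp_hasFDerivAt η h5).smul h4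
    rw [HasFDerivAt.fderiv (f := H) h9]
    ext j
    simp only [Function.comp_apply, add_apply, smul_apply,
      ContinuousLinearMap.smulRight_apply, hc, h6, Pi.add_apply, Pi.smul_apply, smul_eq_mul,
      Pi.zero_apply]
    field_simp
    ring
  obtain ⟨h, hh, hHh⟩ := exists_eq_comp_of_submersion hfs hHs hsurj hdH
  have hh0 : h (f θ) ≠ 0 := by
    rw [← hHh.self_of_nhds]
    exact smul_ne_zero (inv_ne_zero hi₀) hH₀θ
  obtain ⟨g, hg, hgsurj, hgker⟩ := exists_flowBox hh hh0
  have hcomp : ∀ᶠ η in 𝓝 θ, ∀ v, fderiv ℝ (fun η => g (f η)) η v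
      = fderiv ℝ g (f η) (fderiv ℝ f η v) := by
    filter_upwards [hfs, hfs.continuousAt.eventually hg] with η h1 h2 v
    rw [show (fun η => g (f η)) = g ∘ f from rfl, fderiv_comp η (h2.differentiableAt (by simp))
      (h1.differentiableAt (by simp))]
    rfl
  refine ⟨fun η => g (f η), hg.comp hfs, ?_, ?_⟩
  · intro w
    obtain ⟨u, rfl⟩ := hgsurj w
    obtain ⟨v, rfl⟩ := hsurj u
    exact ⟨v, hcomp.self_of_nhds v⟩
  · filter_upwards [hcomp, hker, hfs.continuousAt.eventually hgker, hHh,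
      hus.eventually_ne hi₀] with η h1 h2 h3 h4 h5 v
    rw [h1, h3, ← h4, hspan, Submodule.mem_sup]
    constructor
    · rintro ⟨c, hc⟩
      refine ⟨(c * (H₀ η i₀)⁻¹) • Y η, Submodule.mem_span_singleton.2 ⟨_, rfl⟩,
        v - (c * (H₀ η i₀)⁻¹) • Y η, (h2 _).1 ?_, by abel⟩
      rw [map_sub, hc, map_smul, hH, mul_smul]
      exact sub_self _
    · rintro ⟨a, ha, b, hb, rfl⟩
      obtain ⟨c, rfl⟩ := Submodule.mem_span_singleton.1 ha
      refine ⟨c * H₀ η i₀, ?_⟩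
      rw [map_add, (h2 b).2 hb, map_smul, add_zero, hH, mul_smul]
      simp only [smul_inv_smul₀ h5]
      rfl

end FirstIntegrals

/-! ### Cartan's formula, nondegeneracy and contact coordinates -/

section ContactForm

theorem contDiff_contactForm : ContDiff ℝ ∞ contactForm := by
  have h : ∀ i : Fin 5, ContDiff ℝ ∞ fun θ : J1 => θ i := fun i => contDiff_apply ℝ ℝ i
  exact (contDiff_const.sub ((h 3).smul contDiff_const)).sub ((h 4).smul contDiff_const)

theorem smoothNear_contactForm (θ : J1) : SmoothNear contactForm θ :=
  SmoothNear.of_contDiff contDiff_contactForm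

theorem mem_contactDist {θ v : J1} : v ∈ contactDist θ ↔ contactForm θ v = 0 := Iff.rfl

/-- Cartan's formula for the contact form on sections of the contact distribution. -/
theorem contactForm_lieBracket {θ : J1} {V W : J1 → J1} (hV : SmoothNear V θ)
    (hW : SmoothNear W θ) (hV0 : ∀ᶠ η in 𝓝 θ, contactForm η (V η) = 0)
    (hW0 : ∀ᶠ η in 𝓝 θ, contactForm η (W η) = 0) :
    contactForm θ (VectorField.lieBracket ℝ V W θ) = -dContactForm θ (V θ) (W θ) := by
  have hU : HasFDerivAt contactForm (fderiv ℝ contactForm θ) θ :=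
    (smoothNear_contactForm θ).differentiableAt.hasFDerivAt
  have h1 := (hU.clm_apply hV.differentiableAt.hasFDerivAt).fderiv
  have h2 := (hU.clm_apply hW.differentiableAt.hasFDerivAt).fderiv
  rw [fderiv_eq_zero_of_eventually hV0] at h1
  rw [fderiv_eq_zero_of_eventually hW0] at h2
  have h3 := congrArg (fun L : J1 →L[ℝ] ℝ => L (W θ)) h1
  have h4 := congrArg (fun L : J1 →L[ℝ] ℝ => L (V θ)) h2
  simp at h3 h4
  simp only [VectorField.lieBracket, dContactForm, map_sub]
  linarith

theorem dContactForm_swap (θ v w : J1) : dContactForm θ v w = -dContactForm θ w v := by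
  simp only [dContactForm]
  ring

/-- `dU` is nondegenerate on the contact distribution: pairing with the frame `∂_p, ∂_q, ∂̂_x, ∂̂_y`
recovers four components of `v`, and `U(v) = 0` gives the fifth. -/
theorem eq_zero_of_dContactForm_eq_zero {θ v : J1} (hv : contactForm θ v = 0)
    (h : ∀ w, contactForm θ w = 0 → dContactForm θ v w = 0) : v = 0 := by
  have h1 := h dP (by simp [contactForm_apply, dP])
  have h2 := h dQ (by simp [contactForm_apply, dQ])
  have h3 := h (hatX θ) (by simp [contactForm_apply, hatX])
  have h4 := h (hatY θ) (by simp [contactForm_apply, hatY])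
  simp [dContactForm_apply, dP, dQ, hatX, hatY] at h1 h2 h3 h4
  rw [contactForm_apply, h1, h2] at hv
  ext i
  fin_cases i
  · exact h1
  · exact h2
  · simpa using hv
  · exact h3
  · exact h4

/-- The exterior derivative of `lam (dz - p dx - q dy)`. -/
theorem dContactForm_eq_of_contactForm_eq {θ : J1} {x y z p q lam : J1 → ℝ}
    (hx : SmoothNear x θ) (hy : SmoothNear y θ) (hz : SmoothNear z θ) (hp : SmoothNear p θ)
    (hq : SmoothNear q θ) (hl : SmoothNear lam θ)
    (hU : ∀ᶠ η in 𝓝 θ, ∀ v, contactForm η v =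
      lam η * (fderiv ℝ z η v - p η * fderiv ℝ x η v - q η * fderiv ℝ y η v)) (v w : J1) :
    dContactForm θ v w =
      fderiv ℝ lam θ v * (fderiv ℝ z θ w - p θ * fderiv ℝ x θ w - q θ * fderiv ℝ y θ w)
      - fderiv ℝ lam θ w * (fderiv ℝ z θ v - p θ * fderiv ℝ x θ v - q θ * fderiv ℝ y θ v)
      + lam θ * (fderiv ℝ x θ v * fderiv ℝ p θ w - fderiv ℝ p θ v * fderiv ℝ x θ w
        + (fderiv ℝ y θ v * fderiv ℝ q θ w - fderiv ℝ q θ v * fderiv ℝ y θ w)) := by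
  -- Symmetry of second derivatives is `d² = 0`: it removes all second-order terms after
  -- antisymmetrisation.
  have hsymm : ∀ {f : J1 → ℝ}, SmoothNear f θ → ∀ a b,
      fderiv ℝ (fderiv ℝ f) θ a b = fderiv ℝ (fderiv ℝ f) θ b a := fun hf a b =>
    (hf.contDiffAt.isSymmSndFDerivAt (by simp; exact WithTop.coe_le_coe.2 le_top)).eq a b
  have key : ∀ v w, fderiv ℝ contactForm θ v w =
      fderiv ℝ lam θ v * (fderiv ℝ z θ w - p θ * fderiv ℝ x θ w - q θ * fderiv ℝ y θ w)
      + lam θ * (fderiv ℝ (fderiv ℝ z) θ v w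
        - (fderiv ℝ p θ v * fderiv ℝ x θ w + p θ * fderiv ℝ (fderiv ℝ x) θ v w)
        - (fderiv ℝ q θ v * fderiv ℝ y θ w + q θ * fderiv ℝ (fderiv ℝ y) θ v w)) := by
    intro v w
    have hd : ∀ {f : J1 → ℝ}, SmoothNear f θ →
        HasFDerivAt (fun η => fderiv ℝ f η w) ((fderiv ℝ (fderiv ℝ f) θ).flip w) θ := by
      intro f hf
      have := (hf.fderiv.differentiableAt.hasFDerivAt).clm_apply (hasFDerivAt_const w θ)
      refine this.congr_fderiv ?_
      ext; simp
    have h1 := hl.differentiableAt.hasFDerivAt.mul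
      (((hd hz).sub (hp.differentiableAt.hasFDerivAt.mul (hd hx))).sub
        (hq.differentiableAt.hasFDerivAt.mul (hd hy)))
    have hU' := (smoothNear_contactForm θ).differentiableAt.hasFDerivAt.clm_apply
      (hasFDerivAt_const w θ)
    have h2 := (h1.congr_of_eventuallyEq (f₁ := fun η => contactForm η w)
      (hU.mono fun η h => h w)).unique hU'
    have h3 := congrArg (fun L : J1 →L[ℝ] ℝ => L v) h2
    simp at h3
    rw [← h3]
    ring
  rw [dContactForm, key, key, hsymm hx w v, hsymm hy w v, hsymm hz w v]
  ring

/-- Functions `x, y, z, p, q` in which the contact form is proportional to `dz - p dx - q dy` are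
contact coordinates. -/
theorem exists_contactChart {Ω : Set J1} (hΩ : IsOpen Ω) {θ : J1} (hθ : θ ∈ Ω)
    {x y z p q lam : J1 → ℝ}
    (hx : SmoothNear x θ) (hy : SmoothNear y θ) (hz : SmoothNear z θ) (hp : SmoothNear p θ)
    (hq : SmoothNear q θ) (hl : SmoothNear lam θ)
    (hU : ∀ᶠ η in 𝓝 θ, ∀ v, contactForm η v =
      lam η * (fderiv ℝ z η v - p η * fderiv ℝ x η v - q η * fderiv ℝ y η v))
    {N : Set J1} (hN : N ∈ 𝓝 θ) :
    ∃ Φ : OpenPartialHomeomorph J1 J1, IsContactChartAt Ω θ Φ ∧ Φ.source ⊆ N ∧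
      (∀ η, Φ η = ![x η, y η, z η, p η, q η]) ∧
      ∀ η ∈ Φ.source, Function.Injective (fderiv ℝ Φ η) ∧ ∀ v, fderiv ℝ Φ η v =
        ![fderiv ℝ x η v, fderiv ℝ y η v, fderiv ℝ z η v, fderiv ℝ p η v, fderiv ℝ q η v] := by
  -- The factor cannot vanish, since `U(∂_z) = 1`.
  have hl0 : ∀ η, (∀ v, contactForm η v =
      lam η * (fderiv ℝ z η v - p η * fderiv ℝ x η v - q η * fderiv ℝ y η v)) → lam η ≠ 0 := by
    intro η h h0
    have := h dZ
    rw [h0, zero_mul] at this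
    simp [contactForm_apply, dZ] at this
  let f : J1 → J1 := fun η => ![x η, y η, z η, p η, q η]
  have hf : SmoothNear f θ := by
    filter_upwards [hx, hy, hz, hp, hq] with η h1 h2 h3 h4 h5
    refine contDiffAt_pi.2 fun i => ?_
    fin_cases i
    · exact h1
    · exact h2
    · exact h3
    · exact h4
    · exact h5
  have hfd : ∀ᶠ η in 𝓝 θ, ∀ v, fderiv ℝ f η v =
      ![fderiv ℝ x η v, fderiv ℝ y η v, fderiv ℝ z η v, fderiv ℝ p η v, fderiv ℝ q η v] := by
    filter_upwards [hf] with η h v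
    have h1 := fun i => fderiv_coord (h.differentiableAt (by simp)) i v
    ext i
    rw [← h1]
    fin_cases i <;> rfl
  -- A vector killed by all five differentials lies in the contact distribution and is
  -- `dU`-orthogonal to it, so nondegeneracy alone makes the five functions independent.
  have hker : LinearMap.ker (fderiv ℝ f θ : J1 →ₗ[ℝ] J1) = ⊥ := by
    rw [LinearMap.ker_eq_bot']
    intro v hv
    rw [ContinuousLinearMap.coe_coe, hfd.self_of_nhds] at hv
    have e0 : fderiv ℝ x θ v = 0 := congrFun hv 0
    have e1 : fderiv ℝ y θ v = 0 := congrFun hv 1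
    have e2 : fderiv ℝ z θ v = 0 := congrFun hv 2
    have e3 : fderiv ℝ p θ v = 0 := congrFun hv 3
    have e4 : fderiv ℝ q θ v = 0 := congrFun hv 4
    have hθU := hU.self_of_nhds
    refine eq_zero_of_dContactForm_eq_zero (θ := θ) ?_ fun w hw => ?_
    · rw [hθU, e0, e1, e2]
      ring
    · rw [hθU] at hw
      have hα := (mul_eq_zero.1 hw).resolve_left (hl0 θ hθU)
      rw [dContactForm_eq_of_contactForm_eq hx hy hz hp hq hl hU, hα, e0, e1, e2, e3, e4]
      ring
  let e : J1 ≃L[ℝ] J1 := (LinearEquiv.ofInjectiveEndo (fderiv ℝ f θ : J1 →ₗ[ℝ] J1)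
    (LinearMap.ker_eq_bot.1 hker)).toContinuousLinearEquiv
  have he : HasFDerivAt f (e : J1 →L[ℝ] J1) θ := by
    refine hf.differentiableAt.hasFDerivAt.congr_fderiv ?_
    ext v : 1
    rfl
  obtain ⟨Φ, hΦ, hs, hsN, h1, h2, h3⟩ := hf.exists_openPartialHomeomorph e he
    (N := {η | η ∈ N ∧ η ∈ Ω ∧ (∀ v, contactForm η v =
      lam η * (fderiv ℝ z η v - p η * fderiv ℝ x η v - q η * fderiv ℝ y η v)) ∧
      ∀ v, fderiv ℝ f η v = ![fderiv ℝ x η v, fderiv ℝ y η v, fderiv ℝ z η v, fderiv ℝ p η v,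
        fderiv ℝ q η v]})
    (by filter_upwards [hN, hΩ.mem_nhds hθ, hU, hfd] with η a1 a2 a3 a4 using ⟨a1, a2, a3, a4⟩)
  refine ⟨Φ, ⟨hs, fun η hη => (hsN hη).2.1, hΦ ▸ h1, h2, ?_⟩, fun η hη => (hsN hη).1,
    fun η => congrFun hΦ η, ?_⟩
  · intro η hη
    obtain ⟨-, -, hUη, hdη⟩ := hsN hη
    obtain ⟨e', he'⟩ := h3 η hη
    have hval : ∀ v, contactForm η v = lam η * contactForm (Φ η) (fderiv ℝ Φ η v) := by
      intro v
      rw [hΦ, hdη, contactForm_apply (f η), hUη]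
      rfl
    have hval0 : ∀ v, contactForm η v = 0 ↔ contactForm (Φ η) (fderiv ℝ Φ η v) = 0 := by
      intro v
      rw [hval, mul_eq_zero, or_iff_right (hl0 η hUη)]
    ext w
    rw [Submodule.mem_map]
    constructor
    · rintro ⟨v, hv, rfl⟩
      exact (hval0 v).1 hv
    · intro hw
      have h4 : fderiv ℝ Φ η (e'.symm w) = w := by
        rw [hΦ, he'.fderiv]
        simp
      refine ⟨e'.symm w, (hval0 _).2 ?_, h4⟩
      rw [h4]
      exact hw
  · intro η hη
    obtain ⟨e', he'⟩ := h3 η hη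
    rw [hΦ]
    refine ⟨?_, (hsN hη).2.2.2⟩
    rw [he'.fderiv]
    exact e'.injective

end ContactForm

/-! ### Spans read in a chart -/

section Charts

theorem IsContactChartAt.restrOpen {Ω : Set J1} {θ : J1} {Φ : OpenPartialHomeomorph J1 J1}
    (h : IsContactChartAt Ω θ Φ) {S : Set J1} (hS : IsOpen S) (hθ : θ ∈ S) :
    IsContactChartAt Ω θ (Φ.restrOpen S hS) := by
  obtain ⟨h1, h2, h3, h4, h5⟩ := h
  refine ⟨⟨h1, hθ⟩, inter_subset_left.trans h2, h3.mono inter_subset_left, ?_, fun η hη =>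
    h5 η hη.1⟩
  exact h4.mono fun w hw => hw.1

/-- Two vectors span at most a plane and an injective derivative preserves rank 2, so one inclusion
suffices and independence of the two generators comes for free. -/
theorem isSpannedInChart_of_forall_mem {Φ : OpenPartialHomeomorph J1 J1}
    {D : J1 → Submodule ℝ J1} {X Y : J1 → J1}
    (hD : ∀ η ∈ Φ.source, Module.finrank ℝ (D η) = 2)
    (hinj : ∀ η ∈ Φ.source, Function.Injective (fderiv ℝ Φ η))
    (h : ∀ η ∈ Φ.source, ∀ v ∈ D η, fderiv ℝ Φ η v ∈ Submodule.span ℝ {X (Φ η), Y (Φ η)}) :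
    IsSpannedInChart Φ D X Y := by
  intro η hη
  apply Submodule.eq_of_le_of_finrank_le
  · rintro _ ⟨v, hv, rfl⟩
    exact h η hη v hv
  · have h1 : Module.finrank ℝ ((D η).map (fderiv ℝ Φ η : J1 →ₗ[ℝ] J1)) = 2 := by
      rw [← hD η hη]
      exact (Submodule.equivMapOfInjective _ (hinj η hη) (D η)).finrank_eq.symm
    rw [h1]
    classical
    have h2 := finrank_span_finset_le_card (R := ℝ) ({X (Φ η), Y (Φ η)} : Finset J1)
    simp only [Finset.coe_insert, Finset.coe_singleton] at h2
    exact h2.trans Finset.card_le_two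

end Charts

section Frames

variable {E : Type*}

theorem range_frame_one (A : E → E) (η : E) : (range fun i => ![A] i η) = {A η} := by
  simp

theorem range_frame_two (A B : E → E) (η : E) : (range fun i => ![A, B] i η) = {A η, B η} := by
  ext v
  simp only [mem_range, Fin.exists_fin_succ, mem_insert_iff, mem_singleton_iff]
  simp [eq_comm]

theorem range_frame_three (A B C : E → E) (η : E) :
    (range fun i => ![A, B, C] i η) = {A η, B η, C η} := by
  ext v
  simp only [mem_range, Fin.exists_fin_succ, mem_insert_iff, mem_singleton_iff]
  simp [eq_comm]

theorem range_frame_four (A B C D : E → E) (η : E) :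
    (range fun i => ![A, B, C, D] i η) = {A η, B η, C η, D η} := by
  ext v
  simp only [mem_range, Fin.exists_fin_succ, mem_insert_iff, mem_singleton_iff]
  simp [eq_comm]

end Frames

/-! ### Sections and frames of distributions -/

section Distributions

theorem lieBracket_mem_derivedDist {Ω : Set J1} (hΩ : IsOpen Ω) {P : J1 → Submodule ℝ J1} {θ : J1}
    (hθ : θ ∈ Ω) {X Y : J1 → J1} (hX : SmoothNear X θ) (hY : SmoothNear Y θ)
    (hXP : ∀ᶠ η in 𝓝 θ, X η ∈ P η) (hYP : ∀ᶠ η in 𝓝 θ, Y η ∈ P η) :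
    VectorField.lieBracket ℝ X Y θ ∈ derivedDist Ω P θ := by
  obtain ⟨W, hW, hWo, hθW⟩ := _root_.eventually_nhds_iff.1
    ((hX.and hY).and ((hXP.and hYP).and (hΩ.mem_nhds hθ)))
  refine Submodule.subset_span (Or.inr ⟨W, X, Y, hWo, hθW, fun η h => (hW η h).2.2,
    ⟨fun η h => (hW η h).1.1.contDiffWithinAt, fun η h => (hW η h).2.1.1⟩,
    ⟨fun η h => (hW η h).1.2.contDiffWithinAt, fun η h => (hW η h).2.1.2⟩, rfl⟩)

theorem le_derivedDist (Ω : Set J1) (P : J1 → Submodule ℝ J1) (θ : J1) :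
    P θ ≤ derivedDist Ω P θ := fun _ hv => Submodule.subset_span (Or.inl hv)

theorem IsSectionOn.smoothNear {P : J1 → Submodule ℝ J1} {W : Set J1} {X : J1 → J1} {θ : J1}
    (h : IsSectionOn P W X) (hW : IsOpen W) (hθ : θ ∈ W) : SmoothNear X θ := by
  filter_upwards [hW.mem_nhds hθ] with η hη using (h.1 η hη).contDiffAt (hW.mem_nhds hη)

theorem IsSectionOn.eventually_mem {P : J1 → Submodule ℝ J1} {W : Set J1} {X : J1 → J1} {θ : J1}
    (h : IsSectionOn P W X) (hW : IsOpen W) (hθ : θ ∈ W) : ∀ᶠ η in 𝓝 θ, X η ∈ P η := by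
  filter_upwards [hW.mem_nhds hθ] with η hη using h.2 η hη

theorem IsRankTwoDist.exists_frame {Ω : Set J1} {D : J1 → Submodule ℝ J1}
    (hD : IsRankTwoDist Ω D) {θ : J1} (hθ : θ ∈ Ω) :
    ∃ X Y : J1 → J1, SmoothNear X θ ∧ SmoothNear Y θ ∧
      ∀ᶠ η in 𝓝 θ, LinearIndependent ℝ ![X η, Y η] ∧ D η = Submodule.span ℝ {X η, Y η} := by
  obtain ⟨W, hW, hθW, -, X, Y, hX, hY, h⟩ := hD θ hθ
  refine ⟨X, Y, ?_, ?_, ?_⟩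
  · filter_upwards [hW.mem_nhds hθW] with η hη using (hX η hη).contDiffAt (hW.mem_nhds hη)
  · filter_upwards [hW.mem_nhds hθW] with η hη using (hY η hη).contDiffAt (hW.mem_nhds hη)
  · filter_upwards [hW.mem_nhds hθW] with η hη using h η hη

theorem IsRankTwoDist.finrank_eq {Ω : Set J1} {D : J1 → Submodule ℝ J1}
    (hD : IsRankTwoDist Ω D) {θ : J1} (hθ : θ ∈ Ω) : Module.finrank ℝ (D θ) = 2 := by
  obtain ⟨W, -, hθW, -, X, Y, -, -, h⟩ := hD θ hθ
  obtain ⟨h1, h2⟩ := h θ hθW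
  have h3 := finrank_span_eq_card h1
  rw [Matrix.range_cons, Matrix.range_cons, Matrix.range_empty, union_empty, singleton_union] at h3
  rw [h2, h3, Fintype.card_fin]

end Distributions

/-! ### First integrals of one field and expansion of the contact form -/

section Darboux

/-- The identity is a first integral of the empty family, which starts the Frobenius induction. -/
theorem exists_firstIntegral_one {X : J1 → J1} {θ : J1} (hX : SmoothNear X θ) (h0 : X θ ≠ 0) :
    ∃ f : J1 → Fin 4 → ℝ, IsFirstIntegral θ ![X] f := by
  have h : IsFirstIntegral (m := 5) θ (![] : Fin 0 → J1 → J1) (fun η => η) := by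
    refine ⟨SmoothNear.of_contDiff contDiff_id, ?_, Eventually.of_forall fun η v => ?_⟩
    · rw [fderiv_fun_id]
      exact Function.surjective_id
    · rw [fderiv_fun_id]
      simp
  exact h.exists_cons (Y := X) (fun i => i.elim0) hX (by simpa using h0)
    (Eventually.of_forall fun η i => i.elim0)

/-- A contact form vanishing on the fibres of a submersion onto `ℝ³` is a smooth combination of the
differentials of its components. -/
theorem exists_contactForm_eq_sum {θ : J1} {g : J1 → Fin 3 → ℝ} (hg : SmoothNear g θ)
    (hsurj : Function.Surjective (fderiv ℝ g θ))
    (hker : ∀ᶠ η in 𝓝 θ, ∀ v, fderiv ℝ g η v = 0 → contactForm η v = 0) :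
    ∃ A : Fin 3 → J1 → ℝ, (∀ i, SmoothNear (A i) θ) ∧
      ∀ᶠ η in 𝓝 θ, ∀ v, contactForm η v = ∑ i, A i η * fderiv ℝ (fun η => g η i) η v := by
  obtain ⟨A, hA, h⟩ := exists_smooth_factor hg.fderiv (smoothNear_contactForm θ) hsurj hker
  refine ⟨fun i η => A η (Pi.single i 1), fun i => hA.clm_apply (SmoothNear.const _), ?_⟩
  filter_upwards [h, hg] with η h1 h2 v
  rw [h1]
  conv_lhs => rw [pi_eq_sum_univ' (fderiv ℝ g η v), map_sum]
  refine Finset.sum_congr rfl fun i _ => ?_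
  rw [fderiv_coord (h2.differentiableAt (by simp)), map_smul, smul_eq_mul, mul_comm]

end Darboux

/-! ### The integrable case and form (a) -/

section CaseA

theorem hasNormalFormA_of_integrable {Ω : Set J1} (hΩ : IsOpen Ω) {D : J1 → Submodule ℝ J1}
    (hD : IsRankTwoDist Ω D) (hL : IsLagrangianOn Ω D) {θ : J1} (hθ : θ ∈ Ω)
    (hint : ∀ᶠ η in 𝓝 θ, derivedDist Ω D η = D η) : HasNormalFormA Ω D θ := by
  obtain ⟨X, Y, hX, hY, hXY⟩ := hD.exists_frame hθ
  have hΩn : ∀ᶠ η in 𝓝 θ, η ∈ Ω := hΩ.mem_nhds hθ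
  obtain ⟨hli, hDθ⟩ := hXY.self_of_nhds
  have hXD : ∀ᶠ η in 𝓝 θ, X η ∈ D η := by
    filter_upwards [hXY] with η h
    rw [h.2]
    exact Submodule.subset_span (by simp)
  have hYD : ∀ᶠ η in 𝓝 θ, Y η ∈ D η := by
    filter_upwards [hXY] with η h
    rw [h.2]
    exact Submodule.subset_span (by simp)
  obtain ⟨f, hf⟩ := exists_firstIntegral_one hX (hli.ne_zero 0)
  obtain ⟨g, hg, hgsurj, hgker⟩ := hf.exists_cons (Y := Y) (fun i => by fin_cases i; exact hX) hY
    (by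
      rw [range_frame_one, Submodule.mem_span_singleton]
      rintro ⟨a, ha⟩
      exact (LinearIndependent.pair_iff' (hli.ne_zero 0)).1 hli a ha)
    (by
      filter_upwards [hX.eventually, hY.eventually, hXD.eventually_nhds, hYD.eventually_nhds, hΩn,
        hint, hXY] with η h1 h2 h3 h4 h5 h6 h7 i
      have h8 := lieBracket_mem_derivedDist hΩ h5 h1 h2 h3 h4
      rw [h6, h7.2] at h8
      fin_cases i
      show _ ∈ Submodule.span ℝ (range fun j => ![Y, X] j η)
      rw [range_frame_two, pair_comm]
      exact h8)
  have hker : ∀ᶠ η in 𝓝 θ, ∀ v, fderiv ℝ g η v = 0 ↔ v ∈ D η := by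
    filter_upwards [hgker, hXY] with η h1 h2 v
    rw [h1, h2.2, pair_comm, ← range_frame_two]
    rfl
  obtain ⟨A, hA, hU⟩ := exists_contactForm_eq_sum hg hgsurj (by
    filter_upwards [hker, hΩn] with η h1 h2 v hv
    exact ((hL η h2 v).1 ((h1 v).1 hv)).1)
  obtain ⟨i, hi⟩ : ∃ i, A i θ ≠ 0 := by
    by_contra! h
    have := hU.self_of_nhds dZ
    simp [h, contactForm_apply, dZ] at this
  -- The permutation names `z` a first integral whose coefficient in `U` is nonzero, so that one can
  -- divide by it.
  let σ : Equiv.Perm (Fin 3) := Equiv.swap i 2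
  have hσ : σ 2 = i := Equiv.swap_apply_right i 2
  have hg' : ∀ j, SmoothNear (fun η => g η j) θ := hg.apply
  set x : J1 → ℝ := fun η => g η (σ 0) with hx
  set y : J1 → ℝ := fun η => g η (σ 1) with hy
  set z : J1 → ℝ := fun η => g η (σ 2) with hz
  set P : J1 → ℝ := fun η => -(A (σ 0) η / A i η) with hP
  set q : J1 → ℝ := fun η => -(A (σ 1) η / A i η) with hq
  have hPs : SmoothNear P θ := ((hA _).div (hA i) hi).neg
  have hqs : SmoothNear q θ := ((hA _).div (hA i) hi).neg
  have hxs : SmoothNear x θ := hg' _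
  have hys : SmoothNear y θ := hg' _
  have hzs : SmoothNear z θ := hg' _
  have hU' : ∀ᶠ η in 𝓝 θ, ∀ v, contactForm η v =
      A i η * (fderiv ℝ z η v - P η * fderiv ℝ x η v - q η * fderiv ℝ y η v) := by
    filter_upwards [hU, (hA i).eventually_ne hi] with η h1 h2 v
    rw [h1, ← Equiv.sum_comp σ, Fin.sum_univ_three]
    simp only [hP, hq, hx, hy, hz, hσ]
    field_simp
    ring
  have hPx : ∀ᶠ η in 𝓝 θ, ∀ v, fderiv ℝ (fun η => z η - P η * x η) η v =
      fderiv ℝ z η v - P η * fderiv ℝ x η v - x η * fderiv ℝ P η v := by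
    filter_upwards [hxs, hzs, hPs] with η h1 h2 h3 v
    have h4 := ((h2.differentiableAt (by simp)).hasFDerivAt).sub
      (((h3.differentiableAt (by simp)).hasFDerivAt).mul
        ((h1.differentiableAt (by simp)).hasFDerivAt))
    rw [HasFDerivAt.fderiv (f := fun η => z η - P η * x η) h4]
    simp
    ring
  have hxneg : ∀ η v, fderiv ℝ (fun η => -x η) η v = -fderiv ℝ x η v := by
    intro η v
    rw [fderiv_fun_neg]
    rfl
  -- Partial Legendre transformation: the new coordinates are `(P, y, z - P x, -x, q)`. On `D`,
  -- where `dx = dy = dz = 0`, only `P` and `q` vary freely, and `d(z - P x) = -x dP`.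
  obtain ⟨Φ, hΦ, hN, hval, hd⟩ := exists_contactChart hΩ hθ hPs hys (hzs.sub (hPs.mul hxs))
    hxs.neg hqs (hA i)
    (by
      filter_upwards [hU', hPx] with η h1 h2 v
      rw [h1, h2]
      ring)
    (N := {η | (∀ v ∈ D η, fderiv ℝ g η v = 0) ∧ ContDiffAt ℝ ∞ g η ∧
      ∀ v, fderiv ℝ (fun η => z η - P η * x η) η v =
      fderiv ℝ z η v - P η * fderiv ℝ x η v - x η * fderiv ℝ P η v})
    (by filter_upwards [hker, hg, hPx] with η h1 h2 h3 using ⟨fun v => (h1 v).2, h2, h3⟩)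
  refine ⟨Φ, hΦ, isSpannedInChart_of_forall_mem (fun η hη => hD.finrank_eq (hΦ.2.1 hη))
    (fun η hη => (hd η hη).1) ?_⟩
  intro η hη v hv
  obtain ⟨h1, h2, h3⟩ := hN hη
  have h4 : ∀ j, fderiv ℝ (fun η => g η j) η v = 0 := by
    intro j
    rw [fderiv_coord (h2.differentiableAt (by simp)), h1 v hv]
    rfl
  refine Submodule.mem_span_pair.2 ⟨fderiv ℝ P η v, fderiv ℝ q η v, ?_⟩
  rw [(hd η hη).2, h3, hxneg, hx, hy, hz, h4, h4, h4]
  ext j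
  fin_cases j <;> simp [hatX, dQ, hval, hx]
  ring

end CaseA

/-! ### Linear algebra of short tuples -/

section Frames

variable {E : Type*}

theorem frame_one (A : E → E) (η : E) : (fun i => ![A] i η) = ![A η] := by
  ext i
  fin_cases i
  rfl

theorem frame_two (A B : E → E) (η : E) : (fun i => ![A, B] i η) = ![A η, B η] := by
  ext i
  fin_cases i <;> rfl

theorem frame_three (A B C : E → E) (η : E) :
    (fun i => ![A, B, C] i η) = ![A η, B η, C η] := by
  ext i
  fin_cases i <;> rfl

theorem frame_four (A B C D : E → E) (η : E) :
    (fun i => ![A, B, C, D] i η) = ![A η, B η, C η, D η] := by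
  ext i
  fin_cases i <;> rfl

variable [AddCommGroup E] [Module ℝ E]

theorem LinearIndependent.three_of_four {a b c d : E} (h : LinearIndependent ℝ ![a, b, c, d]) :
    LinearIndependent ℝ ![a, b, c] := by
  have := h.comp Fin.castSucc (Fin.castSucc_injective 3)
  convert this using 1
  ext i
  fin_cases i <;> rfl

theorem LinearIndependent.two_of_three {a b c : E} (h : LinearIndependent ℝ ![a, b, c]) :
    LinearIndependent ℝ ![a, b] := by
  have := h.comp Fin.castSucc (Fin.castSucc_injective 2)
  convert this using 1
  ext i
  fin_cases i <;> rfl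

theorem LinearIndependent.three_of_notMem {a b c : E} (h : LinearIndependent ℝ ![a, b])
    (hc : c ∉ Submodule.span ℝ {a, b}) : LinearIndependent ℝ ![c, a, b] := by
  refine linearIndependent_finCons.2 ⟨h, ?_⟩
  have : range ![a, b] = {a, b} := by
    ext v
    simp only [mem_range, Fin.exists_fin_succ, mem_insert_iff, mem_singleton_iff]
    simp [eq_comm]
  rwa [this]

theorem mem_span_quadruple {v a b c d : E} : v ∈ Submodule.span ℝ {a, b, c, d} ↔
    ∃ r s t u : ℝ, r • a + s • b + t • c + u • d = v := by
  rw [Submodule.mem_span_insert]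
  simp_rw [Submodule.mem_span_triple]
  constructor
  · rintro ⟨r, _, ⟨s, t, u, rfl⟩, rfl⟩
    exact ⟨r, s, t, u, by abel⟩
  · rintro ⟨r, s, t, u, rfl⟩
    exact ⟨r, _, ⟨s, t, u, rfl⟩, by abel⟩

theorem finrank_span_quadruple {a b c d : E} (h : LinearIndependent ℝ ![a, b, c, d]) :
    Module.finrank ℝ (Submodule.span ℝ {a, b, c, d}) = 4 := by
  have h1 := finrank_span_eq_card h
  have : range ![a, b, c, d] = {a, b, c, d} := by
    ext v
    simp only [mem_range, Fin.exists_fin_succ, mem_insert_iff, mem_singleton_iff]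
    simp [eq_comm]
  rwa [this, Fintype.card_fin] at h1

end Frames

/-! ### Adapted frames of non-integrable lagrangian distributions -/

section Distributions

theorem derivedDist_le_of_frame {Ω : Set J1} {P : J1 → Submodule ℝ J1} {θ : J1} {k : ℕ}
    {A : Fin k → J1 → J1} (hA : ∀ i, SmoothNear (A i) θ)
    (hli : LinearIndependent ℝ fun i => A i θ)
    (hP : ∀ᶠ η in 𝓝 θ, P η = Submodule.span ℝ (range fun i => A i η)) {M : Submodule ℝ J1}
    (hAM : ∀ i, A i θ ∈ M) (hbr : ∀ i j, VectorField.lieBracket ℝ (A i) (A j) θ ∈ M) :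
    derivedDist Ω P θ ≤ M := by
  refine Submodule.span_le.2 (union_subset ?_ ?_)
  · rw [hP.self_of_nhds]
    refine Submodule.span_le.2 ?_
    rintro _ ⟨i, rfl⟩
    exact hAM i
  · rintro _ ⟨W, V₁, V₂, hW, hθW, -, h1, h2, rfl⟩
    refine lieBracket_mem_of_frames hA hA hli hli (h1.smoothNear hW hθW) (h2.smoothNear hW hθW)
      ?_ ?_ hAM hAM hbr
    · filter_upwards [h1.eventually_mem hW hθW, hP] with η h3 h4
      rwa [h4] at h3
    · filter_upwards [h2.eventually_mem hW hθW, hP] with η h3 h4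
      rwa [h4] at h3

/-- A frame `X, Y` of a nongeneric lagrangian distribution near a point where its derived
distribution has rank 3, such that `X` is characteristic for the derived distribution. -/
structure IsAdaptedFrame (D : J1 → Submodule ℝ J1) (θ : J1) (X Y Z T : J1 → J1) : Prop where
  smoothX : SmoothNear X θ
  smoothY : SmoothNear Y θ
  smoothZ : SmoothNear Z θ
  smoothT : SmoothNear T θ
  brXY : VectorField.lieBracket ℝ X Y = Z
  brYZ : VectorField.lieBracket ℝ Y Z = T
  dist_eq : ∀ᶠ η in 𝓝 θ, D η = Submodule.span ℝ {X η, Y η}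
  li : ∀ᶠ η in 𝓝 θ, LinearIndependent ℝ ![X η, Y η, Z η, T η]
  contactX : ∀ᶠ η in 𝓝 θ, contactForm η (X η) = 0
  contactY : ∀ᶠ η in 𝓝 θ, contactForm η (Y η) = 0
  contactZ : ∀ᶠ η in 𝓝 θ, contactForm η (Z η) = 0
  contactT : contactForm θ (T θ) ≠ 0
  brXZ : ∀ᶠ η in 𝓝 θ,
    VectorField.lieBracket ℝ X Z η ∈ Submodule.span ℝ {X η, Y η, Z η}
  brXT : ∀ᶠ η in 𝓝 θ,
    VectorField.lieBracket ℝ X T η ∈ Submodule.span ℝ {X η, Y η, Z η, T η}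

theorem dContactForm_add_smul_left (θ u v w : J1) (c : ℝ) :
    dContactForm θ (u + c • v) w = dContactForm θ u w + c * dContactForm θ v w := by
  simp only [dContactForm, map_add, map_smul, add_apply, smul_apply, smul_eq_mul]
  ring

theorem dContactForm_add_smul_right (θ u v w : J1) (c : ℝ) :
    dContactForm θ w (u + c • v) = dContactForm θ w u + c * dContactForm θ w v := by
  rw [dContactForm_swap, dContactForm_add_smul_left, dContactForm_swap θ u, dContactForm_swap θ v]
  ring

theorem dContactForm_self (θ v : J1) : dContactForm θ v v = 0 := by
  simp [dContactForm]

theorem SmoothNear.dContactForm {θ : J1} {V W : J1 → J1} (hV : SmoothNear V θ)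
    (hW : SmoothNear W θ) : SmoothNear (fun η => dContactForm η (V η) (W η)) θ :=
  (((smoothNear_contactForm θ).along hV).clm_apply hW).sub
    (((smoothNear_contactForm θ).along hW).clm_apply hV)

/-- The field `X₀` is corrected by a multiple of `Y` until it is `dU`-orthogonal to the bracket.
Then `[Y, Z]` is transversal to the contact distribution, the rank bound determines `D''`, and the
remaining bracket relations follow from `U` and Jacobi. -/
theorem exists_adaptedFrame_of_ne {Ω : Set J1} (hΩ : IsOpen Ω) {D : J1 → Submodule ℝ J1}
    (hL : IsLagrangianOn Ω D)
    (hng : ∀ θ ∈ Ω, Module.finrank ℝ (derivedDist Ω (derivedDist Ω D) θ) < 5) {θ : J1}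
    (hθ : θ ∈ Ω) {X₀ Y : J1 → J1} (hX₀ : SmoothNear X₀ θ) (hY : SmoothNear Y θ)
    (hli₀ : LinearIndependent ℝ ![X₀ θ, Y θ])
    (hD₀ : ∀ᶠ η in 𝓝 θ, D η = Submodule.span ℝ {X₀ η, Y η})
    (hZ₀ : VectorField.lieBracket ℝ X₀ Y θ ∉ D θ)
    (hne : dContactForm θ (Y θ) (VectorField.lieBracket ℝ X₀ Y θ) ≠ 0) :
    ∃ X Y Z T : J1 → J1, IsAdaptedFrame D θ X Y Z T ∧ ∀ᶠ η in 𝓝 θ,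
      derivedDist Ω (derivedDist Ω D) η = Submodule.span ℝ {X η, Y η, Z η, T η} := by
  have hΩn : ∀ᶠ η in 𝓝 θ, η ∈ Ω := hΩ.mem_nhds hθ
  set Z₀ := VectorField.lieBracket ℝ X₀ Y with hZ₀def
  have hZ₀s : SmoothNear Z₀ θ := hX₀.lieBracket hY
  -- `m` solves `dU(X₀ + m Y, Z₀) = 0`. Replacing `Z₀` by `Z` changes nothing, since they differ by
  -- a multiple of `Y` and `dU(X, Y) = 0`.
  set m : J1 → ℝ := fun η =>
    -(dContactForm η (X₀ η) (Z₀ η) / dContactForm η (Y η) (Z₀ η)) with hm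
  have hms : SmoothNear m θ := ((hX₀.dContactForm hZ₀s).div (hY.dContactForm hZ₀s) hne).neg
  set X : J1 → J1 := fun η => X₀ η + m η • Y η with hXdef
  have hX : SmoothNear X θ := hX₀.add (hms.smul hY)
  set Z := VectorField.lieBracket ℝ X Y with hZdef
  have hZ : SmoothNear Z θ := hX.lieBracket hY
  set T := VectorField.lieBracket ℝ Y Z with hTdef
  have hT : SmoothNear T θ := hY.lieBracket hZ
  have hZZ₀ : ∀ᶠ η in 𝓝 θ, Z η = Z₀ η + (-fderiv ℝ m η (Y η)) • Y η := by
    filter_upwards [hX₀.eventually, hY.eventually, hms.eventually] with η h1 h2 h3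
    rw [hZdef, show X = X₀ + fun η => m η • Y η from rfl,
      VectorField.lieBracket_add_left h1.differentiableAt (h3.smul h2).differentiableAt,
      VectorField.lieBracket_smul_left h3.differentiableAt h2.differentiableAt]
    simp [hZ₀def]
  have hDX : ∀ᶠ η in 𝓝 θ, D η = Submodule.span ℝ {X η, Y η} := by
    filter_upwards [hD₀] with η h
    rw [h, hXdef]
    apply le_antisymm <;> rw [Submodule.span_le] <;>
      rintro v (rfl | rfl) <;> rw [SetLike.mem_coe, Submodule.mem_span_pair]
    · exact ⟨1, -m η, by simp⟩
    · exact ⟨0, 1, by simp⟩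
    · exact ⟨1, m η, by simp⟩
    · exact ⟨0, 1, by simp⟩
  have hXD : ∀ᶠ η in 𝓝 θ, X η ∈ D η := by
    filter_upwards [hDX] with η h
    rw [h]
    exact Submodule.subset_span (by simp)
  have hYD : ∀ᶠ η in 𝓝 θ, Y η ∈ D η := by
    filter_upwards [hDX] with η h
    rw [h]
    exact Submodule.subset_span (by simp)
  have hdXY : ∀ᶠ η in 𝓝 θ, dContactForm η (X η) (Y η) = 0 := by
    filter_upwards [hΩn, hXD, hYD] with η h1 h2 h3 using ((hL η h1 _).1 h2).2 _ h3
  have hUX : ∀ᶠ η in 𝓝 θ, contactForm η (X η) = 0 := by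
    filter_upwards [hΩn, hXD] with η h1 h2 using ((hL η h1 _).1 h2).1
  have hUY : ∀ᶠ η in 𝓝 θ, contactForm η (Y η) = 0 := by
    filter_upwards [hΩn, hYD] with η h1 h2 using ((hL η h1 _).1 h2).1
  have hUZ : ∀ᶠ η in 𝓝 θ, contactForm η (Z η) = 0 := by
    filter_upwards [hX.eventually, hY.eventually, hUX.eventually_nhds, hUY.eventually_nhds, hdXY]
      with η h1 h2 h3 h4 h5
    rw [hZdef, contactForm_lieBracket h1 h2 h3 h4, h5, neg_zero]
  have hdYZ : ∀ᶠ η in 𝓝 θ, dContactForm η (Y η) (Z η) = dContactForm η (Y η) (Z₀ η) := by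
    filter_upwards [hZZ₀] with η h1
    rw [h1, dContactForm_add_smul_right, dContactForm_self]
    ring
  have hdXZ : ∀ᶠ η in 𝓝 θ, dContactForm η (X η) (Z η) = 0 := by
    filter_upwards [hZZ₀, hdYZ, hdXY, (hY.dContactForm hZ₀s).eventually_ne hne] with η h1 h2 h3 h4
    rw [h1, dContactForm_add_smul_right, h3, hXdef, dContactForm_add_smul_left, hm]
    field_simp
    ring
  have hUXZ : ∀ᶠ η in 𝓝 θ, contactForm η (VectorField.lieBracket ℝ X Z η) = 0 := by
    filter_upwards [hX.eventually, hZ.eventually, hUX.eventually_nhds, hUZ.eventually_nhds, hdXZ]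
      with η h1 h2 h3 h4 h5
    rw [contactForm_lieBracket h1 h2 h3 h4, h5, neg_zero]
  have hUT : contactForm θ (T θ) ≠ 0 := by
    rw [hTdef, contactForm_lieBracket hY hZ hUY hUZ, hdYZ.self_of_nhds]
    exact neg_ne_zero.2 hne
  have hUTn : ∀ᶠ η in 𝓝 θ, contactForm η (T η) ≠ 0 :=
    ((smoothNear_contactForm θ).clm_apply hT).eventually_ne hUT
  have hliθ : LinearIndependent ℝ ![X θ, Y θ, Z θ, T θ] := by
    rw [Fintype.linearIndependent_iff]
    intro c hc
    simp only [Fin.sum_univ_four, Matrix.cons_val] at hc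
    have h3 : c 3 = 0 := by
      have h := congrArg (contactForm θ) hc
      simp only [map_add, map_smul, hUX.self_of_nhds, hUY.self_of_nhds, hUZ.self_of_nhds, map_zero,
        mul_zero, zero_add, smul_eq_mul] at h
      exact (mul_eq_zero.1 h).resolve_right hUT
    rw [h3, zero_smul, add_zero] at hc
    have h2 : c 2 = 0 := by
      by_contra h2
      apply hZ₀
      have e1 : Z₀ θ = (c 2)⁻¹ • (-(c 0) • X θ - c 1 • Y θ + c 2 • fderiv ℝ m θ (Y θ) • Y θ) := by
        rw [eq_inv_smul_iff₀ h2]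
        rw [hZZ₀.self_of_nhds] at hc
        rw [← sub_eq_zero, ← hc]
        module
      rw [e1]
      refine Submodule.smul_mem _ _ (Submodule.add_mem _ (Submodule.sub_mem _ ?_ ?_) ?_)
      · exact Submodule.smul_mem _ _ hXD.self_of_nhds
      · exact Submodule.smul_mem _ _ hYD.self_of_nhds
      · exact Submodule.smul_mem _ _ (Submodule.smul_mem _ _ hYD.self_of_nhds)
    rw [h2, zero_smul, add_zero, hXdef] at hc
    have h01 := LinearIndependent.pair_iff.1 hli₀ (c 0) (c 0 * m θ + c 1) (by
      rw [← hc]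
      module)
    have h1 : c 1 = 0 := by
      have := h01.2
      rwa [h01.1, zero_mul, zero_add] at this
    intro i
    fin_cases i
    · exact h01.1
    · exact h1
    · exact h2
    · exact h3
  have hli : ∀ᶠ η in 𝓝 θ, LinearIndependent ℝ ![X η, Y η, Z η, T η] := by
    have := eventually_linearIndependent (A := ![X, Y, Z, T]) (θ := θ)
      (by
        intro i
        fin_cases i
        · exact hX
        · exact hY
        · exact hZ
        · exact hT) (by rwa [frame_four])
    simpa only [frame_four] using this
  have hXD' : ∀ᶠ η in 𝓝 θ, X η ∈ derivedDist Ω D η :=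
    hXD.mono fun η h => le_derivedDist Ω D η h
  have hYD' : ∀ᶠ η in 𝓝 θ, Y η ∈ derivedDist Ω D η :=
    hYD.mono fun η h => le_derivedDist Ω D η h
  have hZD' : ∀ᶠ η in 𝓝 θ, Z η ∈ derivedDist Ω D η := by
    filter_upwards [hΩn, hX.eventually, hY.eventually, hXD.eventually_nhds, hYD.eventually_nhds]
      with η h1 h2 h3 h4 h5 using lieBracket_mem_derivedDist hΩ h1 h2 h3 h4 h5
  have hTD'' : ∀ᶠ η in 𝓝 θ, T η ∈ derivedDist Ω (derivedDist Ω D) η := by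
    filter_upwards [hΩn, hY.eventually, hZ.eventually, hYD'.eventually_nhds, hZD'.eventually_nhds]
      with η h1 h2 h3 h4 h5 using lieBracket_mem_derivedDist hΩ h1 h2 h3 h4 h5
  have hXZD'' : ∀ᶠ η in 𝓝 θ,
      VectorField.lieBracket ℝ X Z η ∈ derivedDist Ω (derivedDist Ω D) η := by
    filter_upwards [hΩn, hX.eventually, hZ.eventually, hXD'.eventually_nhds, hZD'.eventually_nhds]
      with η h1 h2 h3 h4 h5 using lieBracket_mem_derivedDist hΩ h1 h2 h3 h4 h5
  have hD'' : ∀ᶠ η in 𝓝 θ,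
      derivedDist Ω (derivedDist Ω D) η = Submodule.span ℝ {X η, Y η, Z η, T η} := by
    filter_upwards [hΩn, hXD', hYD', hZD', hTD'', hli] with η h1 h2 h3 h4 h5 h6
    symm
    apply Submodule.eq_of_le_of_finrank_le
    · rw [Submodule.span_le]
      rintro v (rfl | rfl | rfl | rfl)
      · exact le_derivedDist _ _ _ h2
      · exact le_derivedDist _ _ _ h3
      · exact le_derivedDist _ _ _ h4
      · exact h5
    · rw [finrank_span_quadruple h6]
      exact Nat.lt_succ_iff.1 (hng η h1)
  -- `[X, Z]` lies in `D''` and in the kernel of `U`; among the four frame fields only `T` has `U ≠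
  -- 0`, so its coefficient vanishes.
  have hXZ : ∀ᶠ η in 𝓝 θ,
      VectorField.lieBracket ℝ X Z η ∈ Submodule.span ℝ {X η, Y η, Z η} := by
    filter_upwards [hXZD'', hD'', hUX, hUY, hUZ, hUTn, hUXZ] with η h1 h2 h3 h4 h5 h6 h7
    rw [h2, mem_span_quadruple] at h1
    obtain ⟨r, s, t, u, h⟩ := h1
    rw [← h] at h7
    simp only [map_add, map_smul, h3, h4, h5, mul_zero, zero_add, smul_eq_mul] at h7
    rw [(mul_eq_zero.1 h7).resolve_right h6, zero_smul, add_zero] at h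
    exact Submodule.mem_span_triple.2 ⟨r, s, t, h⟩
  refine ⟨X, Y, Z, T, ⟨hX, hY, hZ, hT, rfl, rfl, hDX, hli, hUX, hUY, hUZ, hUT, hXZ, ?_⟩, hD''⟩
  filter_upwards [hX.eventually, hY.eventually, hZ.eventually, hXZ.eventually_nhds, hli]
    with η h1 h2 h3 h4 h5
  -- Jacobi gives `[X, T] = [[X, Y], Z] + [Y, [X, Z]]`. The first term is `[Z, Z] = 0`, and the
  -- second is the bracket of `Y` with a section of `⟨X, Y, Z⟩`.
  have hjac := VectorField.leibniz_identity_lieBracket (𝕜 := ℝ) (n := ∞)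
    (by simp; exact WithTop.coe_le_coe.2 le_top) h1.contDiffAt h2.contDiffAt h3.contDiffAt
  rw [← hTdef, ← hZdef, VectorField.lieBracket_self, Pi.zero_apply, zero_add] at hjac
  rw [hjac]
  have hmem : ∀ v ∈ ({X η, Y η, Z η, T η} : Set J1),
      v ∈ Submodule.span ℝ {X η, Y η, Z η, T η} := fun v hv => Submodule.subset_span hv
  refine lieBracket_mem_of_frames (A := ![Y]) (B := ![X, Y, Z]) ?_ ?_ ?_ ?_ h2 (h1.lieBracket h3)
    ?_ ?_ ?_ ?_ ?_
  · intro i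
    fin_cases i
    exact h2
  · intro i
    fin_cases i
    · exact h1
    · exact h2
    · exact h3
  · rw [frame_one]
    have := h5.ne_zero 1
    simpa using this
  · rw [frame_three]
    exact h5.three_of_four
  · refine Eventually.of_forall fun ζ => ?_
    rw [range_frame_one]
    exact Submodule.mem_span_singleton_self _
  · simpa only [range_frame_three] using h4
  · intro i
    fin_cases i
    exact hmem _ (by simp)
  · intro i
    fin_cases i
    · exact hmem _ (by simp)
    · exact hmem _ (by simp)
    · exact hmem _ (by simp)
  · intro i j
    fin_cases i
    fin_cases j
    · show VectorField.lieBracket ℝ Y X η ∈ _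
      rw [VectorField.lieBracket_swap]
      exact Submodule.neg_mem _ (hmem _ (by simp [hZdef]))
    · show VectorField.lieBracket ℝ Y Y η ∈ _
      rw [VectorField.lieBracket_self]
      exact Submodule.zero_mem _
    · exact hmem _ (by simp [hTdef])

theorem exists_adaptedFrame {Ω : Set J1} (hΩ : IsOpen Ω) {D : J1 → Submodule ℝ J1}
    (hD : IsRankTwoDist Ω D) (hL : IsLagrangianOn Ω D)
    (hng : ∀ θ ∈ Ω, Module.finrank ℝ (derivedDist Ω (derivedDist Ω D) θ) < 5) {θ : J1}
    (hθ : θ ∈ Ω) (hne : derivedDist Ω D θ ≠ D θ) :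
    ∃ X Y Z T : J1 → J1, IsAdaptedFrame D θ X Y Z T ∧ ∀ᶠ η in 𝓝 θ,
      derivedDist Ω (derivedDist Ω D) η = Submodule.span ℝ {X η, Y η, Z η, T η} := by
  obtain ⟨X, Y, hX, hY, hXY⟩ := hD.exists_frame hθ
  have hΩn : ∀ᶠ η in 𝓝 θ, η ∈ Ω := hΩ.mem_nhds hθ
  obtain ⟨hli, hDθ⟩ := hXY.self_of_nhds
  have hXD : ∀ᶠ η in 𝓝 θ, X η ∈ D η := by
    filter_upwards [hXY] with η h
    rw [h.2]
    exact Submodule.subset_span (by simp)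
  have hYD : ∀ᶠ η in 𝓝 θ, Y η ∈ D η := by
    filter_upwards [hXY] with η h
    rw [h.2]
    exact Submodule.subset_span (by simp)
  have hZ : VectorField.lieBracket ℝ X Y θ ∉ D θ := by
    intro hZ
    refine hne (le_antisymm ?_ (le_derivedDist _ _ _))
    refine derivedDist_le_of_frame (A := ![X, Y]) ?_ ?_ ?_ ?_ ?_
    · intro i
      fin_cases i
      · exact hX
      · exact hY
    · rwa [frame_two]
    · filter_upwards [hXY] with η h
      rw [h.2, range_frame_two]
    · intro i
      fin_cases i
      · exact hXD.self_of_nhds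
      · exact hYD.self_of_nhds
    · intro i j
      fin_cases i <;> fin_cases j
      · show VectorField.lieBracket ℝ X X θ ∈ _
        rw [VectorField.lieBracket_self]
        exact Submodule.zero_mem _
      · exact hZ
      · show VectorField.lieBracket ℝ Y X θ ∈ _
        rw [VectorField.lieBracket_swap]
        exact Submodule.neg_mem _ hZ
      · show VectorField.lieBracket ℝ Y Y θ ∈ _
        rw [VectorField.lieBracket_self]
        exact Submodule.zero_mem _
  by_cases h1 : dContactForm θ (Y θ) (VectorField.lieBracket ℝ X Y θ) = 0
  -- If the bracket were `dU`-orthogonal to both fields, it would lie in `D`, which is its own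
  -- orthogonal complement. Otherwise the roles of `X` and `Y` are exchanged.
  · by_cases h2 : dContactForm θ (X θ) (VectorField.lieBracket ℝ X Y θ) = 0
    · exfalso
      apply hZ
      have hUX : ∀ᶠ η in 𝓝 θ, contactForm η (X η) = 0 := by
        filter_upwards [hΩn, hXD] with η h1 h2 using ((hL η h1 _).1 h2).1
      have hUY : ∀ᶠ η in 𝓝 θ, contactForm η (Y η) = 0 := by
        filter_upwards [hΩn, hYD] with η h1 h2 using ((hL η h1 _).1 h2).1
      refine (hL θ hθ _).2 ⟨?_, fun w hw => ?_⟩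
      · rw [mem_contactDist, contactForm_lieBracket hX hY hUX hUY,
          ((hL θ hθ _).1 hXD.self_of_nhds).2 _ hYD.self_of_nhds, neg_zero]
      · rw [hDθ] at hw
        obtain ⟨a, b, rfl⟩ := Submodule.mem_span_pair.1 hw
        simp only [dContactForm] at h1 h2 ⊢
        simp only [map_add, map_smul, add_apply, smul_apply, smul_eq_mul]
        linear_combination -a * h2 - b * h1
    · refine exists_adaptedFrame_of_ne hΩ hL hng hθ hY hX (LinearIndependent.pair_symm_iff.1 hli) ?_
        ?_ ?_
      · filter_upwards [hXY] with η h
        rw [h.2, pair_comm]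
      · rw [VectorField.lieBracket_swap]
        exact fun h => hZ (by simpa using Submodule.neg_mem _ h)
      · rw [VectorField.lieBracket_swap]
        intro h
        apply h2
        simp only [dContactForm, map_neg, neg_apply] at h ⊢
        linear_combination -h
  · exact exists_adaptedFrame_of_ne hΩ hL hng hθ hX hY hli (hXY.mono fun η h => h.2) hZ h1

end Distributions

/-! ### Common computation of the normal forms (b) and (c) -/

section NormalFormChart

theorem fderiv_mul_apply {E : Type*} [NormedAddCommGroup E] [NormedSpace ℝ E] {u w : E → ℝ}
    {θ : E} (hu : SmoothNear u θ) (hw : SmoothNear w θ) (v : E) :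
    fderiv ℝ (fun η => u η * w η) θ v = fderiv ℝ u θ v * w θ + u θ * fderiv ℝ w θ v := by
  rw [fderiv_fun_mul hu.differentiableAt hw.differentiableAt]
  simp
  ring

theorem fderiv_sub_apply {E : Type*} [NormedAddCommGroup E] [NormedSpace ℝ E] {u w : E → ℝ}
    {θ : E} (hu : SmoothNear u θ) (hw : SmoothNear w θ) (v : E) :
    fderiv ℝ (fun η => u η - w η) θ v = fderiv ℝ u θ v - fderiv ℝ w θ v := by
  rw [fderiv_fun_sub hu.differentiableAt hw.differentiableAt]
  rfl

theorem fderiv_congr_apply {E : Type*} [NormedAddCommGroup E] [NormedSpace ℝ E] {u w : E → ℝ}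
    {θ : E} (h : ∀ᶠ η in 𝓝 θ, u η = w η) (v : E) : fderiv ℝ u θ v = fderiv ℝ w θ v := by
  rw [Filter.EventuallyEq.fderiv_eq h]

/-- Contact coordinates adapted to a lagrangian frame `X, Y` such that `x, y, z` are first integrals
of `X` and `dx + ε z dy` vanishes on `Y`. The cases `ε = 0` and `ε = 1` yield the two
non-integrable normal forms. -/
theorem exists_normalForm_chart {Ω : Set J1} (hΩ : IsOpen Ω) {D : J1 → Submodule ℝ J1}
    (hD : IsRankTwoDist Ω D) {θ : J1} (hθ : θ ∈ Ω) {X Y Z T : J1 → J1}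
    (h : IsAdaptedFrame D θ X Y Z T) (ε : ℝ) {x y z p q lam : J1 → ℝ}
    (hx : SmoothNear x θ) (hy : SmoothNear y θ) (hz : SmoothNear z θ) (hp : SmoothNear p θ)
    (hq : SmoothNear q θ) (hl : SmoothNear lam θ)
    (hU : ∀ᶠ η in 𝓝 θ, ∀ v, contactForm η v =
      lam η * (fderiv ℝ z η v - p η * fderiv ℝ x η v - q η * fderiv ℝ y η v))
    (hXx : ∀ᶠ η in 𝓝 θ, fderiv ℝ x η (X η) = 0) (hXy : ∀ᶠ η in 𝓝 θ, fderiv ℝ y η (X η) = 0)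
    (hXz : ∀ᶠ η in 𝓝 θ, fderiv ℝ z η (X η) = 0)
    (hYx : ∀ᶠ η in 𝓝 θ, fderiv ℝ x η (Y η) = -(ε * z η) * fderiv ℝ y η (Y η))
    (hYy : fderiv ℝ y θ (Y θ) ≠ 0) :
    ∃ Φ : OpenPartialHomeomorph J1 J1, IsContactChartAt Ω θ Φ ∧
      Φ θ = ![x θ, y θ, z θ, p θ, q θ] ∧
      ∃ b : J1 → ℝ, ContDiffOn ℝ ∞ b Φ.target ∧
        IsSpannedInChart Φ D (fun η => dP + (ε * η 2) • dQ)
          (fun η => hatY η - (ε * η 2) • hatX η + b η • dQ) ∧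
        ∀ η ∈ Φ.target, fderiv ℝ b η (dP + (ε * η 2) • dQ) ≠ ε * (η 4 - ε * η 2 * η 3) := by
  have hX := h.smoothX
  have hY := h.smoothY
  have hZ := h.smoothZ
  have hYys := hy.along hY
  have hYqs := hq.along hY
  have hYps := hp.along hY
  have hXps := hp.along hX
  have hζ : SmoothNear (fun η => ε * z η) θ := (SmoothNear.const ε).mul hz
  have hXζ : ∀ᶠ η in 𝓝 θ, fderiv ℝ (fun η => ε * z η) η (X η) = 0 := by
    filter_upwards [hz.eventually, hXz] with η h1 h2
    rw [fderiv_mul_apply (SmoothNear.const ε) h1, h2]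
    simp
  have hlam : ∀ᶠ η in 𝓝 θ, lam η ≠ 0 := by
    filter_upwards [hU] with η h1 h0
    have := h1 dZ
    rw [h0, zero_mul] at this
    simp [contactForm_apply, dZ] at this
  have hYne : ∀ᶠ η in 𝓝 θ, fderiv ℝ y η (Y η) ≠ 0 := hYys.eventually_ne hYy
  have hYz : ∀ᶠ η in 𝓝 θ, fderiv ℝ z η (Y η) = (q η - ε * z η * p η) * fderiv ℝ y η (Y η) := by
    filter_upwards [hU, h.contactY, hYx, hlam] with η h1 h2 h3 h4
    rw [h1] at h2
    have := (mul_eq_zero.1 h2).resolve_left h4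
    rw [h3] at this
    linear_combination this
  -- This is `dU(X, Y) = -U(Z) = 0` written in the new coordinates; with `Xx = Xy = Xz = 0` it
  -- forces `X` to be a multiple of `∂_p + ε z ∂_q`.
  have hXq : ∀ᶠ η in 𝓝 θ, fderiv ℝ q η (X η) = ε * z η * fderiv ℝ p η (X η) := by
    filter_upwards [hX.eventually, hY.eventually, hx.eventually, hy.eventually, hz.eventually,
      hp.eventually, hq.eventually, hl.eventually, hU.eventually_nhds, h.contactX.eventually_nhds,
      h.contactY.eventually_nhds, h.contactZ, hXx, hXy, hXz, hYx, hYne, hlam, hYz]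
      with η a1 a2 a3 a4 a5 a6 a7 a8 a9 b1 b2 b3 b4 b5 b6 b7 b8 b9 c1
    have e1 := contactForm_lieBracket a1 a2 b1 b2
    rw [h.brXY, b3, dContactForm_eq_of_contactForm_eq a3 a4 a5 a6 a7 a8 a9, b4, b5, b6, b7, c1] at e1
    have e2 : lam η * fderiv ℝ y η (Y η) *
        (fderiv ℝ q η (X η) - ε * z η * fderiv ℝ p η (X η)) = 0 := by
      linear_combination -e1
    have e3 := (mul_eq_zero.1 e2).resolve_left (mul_ne_zero b9 b8)
    linarith
  have hbr : ∀ {f : J1 → ℝ}, SmoothNear f θ → ∀ᶠ η in 𝓝 θ, fderiv ℝ f η (Z η) =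
      fderiv ℝ (fun η => fderiv ℝ f η (Y η)) η (X η) -
        fderiv ℝ (fun η => fderiv ℝ f η (X η)) η (Y η) := by
    intro f hf
    filter_upwards [hf.eventually, hX.eventually, hY.eventually] with η h1 h2 h3
    rw [← h.brXY, fderiv_lieBracket h1 h2 h3]
  have hZy : ∀ᶠ η in 𝓝 θ, fderiv ℝ y η (Z η) =
      fderiv ℝ (fun η => fderiv ℝ y η (Y η)) η (X η) := by
    filter_upwards [hbr hy, hXy.eventually_nhds] with η h1 h2
    rw [h1, fderiv_eq_zero_of_eventually h2, zero_apply, sub_zero]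
  have hZx : ∀ᶠ η in 𝓝 θ, fderiv ℝ x η (Z η) = -(ε * z η) * fderiv ℝ y η (Z η) := by
    filter_upwards [hbr hx, hXx.eventually_nhds, hYx.eventually_nhds, hZy, hζ.eventually,
      hYys.eventually, hXζ] with η h1 h2 h3 h4 h5 h6 h7
    rw [h1, fderiv_eq_zero_of_eventually h2, zero_apply, sub_zero, fderiv_congr_apply h3,
      fderiv_mul_apply h5.neg h6, h4, fderiv_fun_neg, neg_apply, h7]
    ring
  -- `b` is the `∂_q` coefficient left after subtracting from `Y` the multiple `Yp` of the first
  -- generator and dividing by `Yy`.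
  set b : J1 → ℝ := fun η =>
    (fderiv ℝ q η (Y η) - ε * z η * fderiv ℝ p η (Y η)) / fderiv ℝ y η (Y η) with hb
  have hbs : SmoothNear b θ := (hYqs.sub (hζ.mul hYps)).div hYys hYy
  have hbY : ∀ᶠ η in 𝓝 θ, b η * fderiv ℝ y η (Y η) =
      fderiv ℝ q η (Y η) - ε * z η * fderiv ℝ p η (Y η) := by
    filter_upwards [hYne] with η h1
    exact div_mul_cancel₀ _ h1
  have hXb : ∀ᶠ η in 𝓝 θ, fderiv ℝ y η (Y η) * (fderiv ℝ b η (X η)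
      - ε * (q η - ε * z η * p η) * fderiv ℝ p η (X η)) =
      fderiv ℝ q η (Z η) - ε * z η * fderiv ℝ p η (Z η) - b η * fderiv ℝ y η (Z η) := by
    filter_upwards [hbY.eventually_nhds, hbs.eventually, hYys.eventually, hYqs.eventually,
      hYps.eventually, hXps.eventually, hζ.eventually, hXζ, hZy, hbr hq, hbr hp,
      hXq.eventually_nhds, hYz, hz.eventually]
      with η a1 a2 a3 a4 a5 a6 a7 a8 a9 b1 b2 b3 b4 b5
    have e1 := fderiv_congr_apply a1 (X η)
    rw [fderiv_mul_apply a2 a3, fderiv_sub_apply a4 (a7.mul a5), fderiv_mul_apply a7 a5, a8,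
      ← a9] at e1
    rw [fderiv_congr_apply b3, fderiv_mul_apply a7 a6, fderiv_mul_apply (SmoothNear.const ε) b5,
      b4] at b1
    simp only [fderiv_fun_const, Pi.zero_apply, zero_apply, zero_mul, zero_add] at b1
    linear_combination e1 - b1 + ε * z η * b2
  obtain ⟨Φ, hΦ, hN, hval, hd⟩ := exists_contactChart hΩ hθ hx hy hz hp hq hl hU
    (N := {η | ContDiffAt ℝ ∞ b η ∧ D η = Submodule.span ℝ {X η, Y η} ∧
      LinearIndependent ℝ ![X η, Y η, Z η, T η] ∧
      (fderiv ℝ x η (X η) = 0 ∧ fderiv ℝ y η (X η) = 0 ∧ fderiv ℝ z η (X η) = 0 ∧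
        fderiv ℝ q η (X η) = ε * z η * fderiv ℝ p η (X η)) ∧
      (fderiv ℝ x η (Y η) = -(ε * z η) * fderiv ℝ y η (Y η) ∧
        fderiv ℝ z η (Y η) = (q η - ε * z η * p η) * fderiv ℝ y η (Y η) ∧
        b η * fderiv ℝ y η (Y η) = fderiv ℝ q η (Y η) - ε * z η * fderiv ℝ p η (Y η) ∧
        fderiv ℝ y η (Y η) ≠ 0) ∧
      fderiv ℝ x η (Z η) = -(ε * z η) * fderiv ℝ y η (Z η) ∧
      fderiv ℝ z η (Z η) = (q η - ε * z η * p η) * fderiv ℝ y η (Z η) ∧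
      fderiv ℝ y η (Y η) * (fderiv ℝ b η (X η)
        - ε * (q η - ε * z η * p η) * fderiv ℝ p η (X η)) =
        fderiv ℝ q η (Z η) - ε * z η * fderiv ℝ p η (Z η) - b η * fderiv ℝ y η (Z η)})
    (by
      filter_upwards [hbs, h.dist_eq, h.li, hXx, hXy, hXz, hXq, hYx, hYz, hbY, hYne, hZx, hXb, hU,
        h.contactZ, hlam]
        with η a1 a2 a3 a4 a5 a6 a7 a8 a9 b1 b2 b3 b4 b5 b6 b7
      refine ⟨a1, a2, a3, ⟨a4, a5, a6, a7⟩, ⟨a8, a9, b1, b2⟩, b3, ?_, b4⟩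
      rw [b5] at b6
      have := (mul_eq_zero.1 b6).resolve_left b7
      rw [b3] at this
      linear_combination this)
  have hdX : ∀ η ∈ Φ.source, fderiv ℝ Φ η (X η) =
      fderiv ℝ p η (X η) • (dP + (ε * Φ η 2) • dQ) := by
    intro η hη
    obtain ⟨-, -, -, ⟨a1, a2, a3, a4⟩, -⟩ := hN hη
    rw [(hd η hη).2, a1, a2, a3, a4]
    ext j
    fin_cases j <;> simp [hval, dP, dQ]
    ring
  have hpX : ∀ η ∈ Φ.source, fderiv ℝ p η (X η) ≠ 0 := by
    intro η hη h0
    have h1 := hdX η hη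
    rw [h0, zero_smul, ← (fderiv ℝ Φ η).map_zero] at h1
    exact (hN hη).2.2.1.ne_zero 0 ((hd η hη).1 h1)
  have htgt : ∀ η ∈ Φ.target, ContDiffAt ℝ ∞ (fun η => b (Φ.symm η)) η := by
    intro η hη
    exact (hN (Φ.map_target hη)).1.comp η
      ((hΦ.2.2.2.1 η hη).contDiffAt (Φ.open_target.mem_nhds hη))
  refine ⟨Φ, hΦ, hval θ, fun η => b (Φ.symm η), fun η hη => (htgt η hη).contDiffWithinAt, ?_, ?_⟩
  · refine isSpannedInChart_of_forall_mem (fun η hη => hD.finrank_eq (hΦ.2.1 hη))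
      (fun η hη => (hd η hη).1) ?_
    intro η hη v hv
    obtain ⟨-, a1, -, -, ⟨b1, b2, b3, b4⟩, -⟩ := hN hη
    rw [a1] at hv
    obtain ⟨r, s, rfl⟩ := Submodule.mem_span_pair.1 hv
    refine Submodule.mem_span_pair.2 ⟨r * fderiv ℝ p η (X η) + s * fderiv ℝ p η (Y η),
      s * fderiv ℝ y η (Y η), ?_⟩
    rw [map_add, map_smul, map_smul, hdX η hη, (hd η hη).2 (Y η), b1, b2]
    simp only [Φ.left_inv hη]
    have b5 : fderiv ℝ q η (Y η) =
      b η * fderiv ℝ y η (Y η) + ε * z η * fderiv ℝ p η (Y η) := by linear_combination -b3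
    rw [b5]
    ext j
    fin_cases j <;> simp [hval, dP, dQ, hatX, hatY] <;> ring
  · intro w hw
    obtain ⟨η, hη, rfl⟩ : ∃ η ∈ Φ.source, Φ η = w := ⟨Φ.symm w, Φ.map_target hw, Φ.right_inv hw⟩
    obtain ⟨a0, -, a2, ⟨c1, c2, c3, c4⟩, ⟨b1, b2, b3, b4⟩, d1, d2, d3⟩ := hN hη
    intro heq
    have hchain : fderiv ℝ (fun η => b (Φ.symm η)) (Φ η) (fderiv ℝ Φ η (X η)) =
        fderiv ℝ b η (X η) := by
      have e1 : DifferentiableAt ℝ Φ η := ((hΦ.2.2.1 η hη).contDiffAt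
        (Φ.open_source.mem_nhds hη)).differentiableAt (by simp)
      have e2 := ((htgt _ (Φ.map_source hη)).differentiableAt (by simp)).hasFDerivAt.comp η
        e1.hasFDerivAt
      have e3 : b =ᶠ[𝓝 η] (fun η => b (Φ.symm η)) ∘ Φ := by
        filter_upwards [Φ.open_source.mem_nhds hη] with ζ hζ
        simp [Φ.left_inv hζ]
      rw [(e2.congr_of_eventuallyEq e3).fderiv]
      rfl
    rw [hdX η hη, map_smul, heq, hval] at hchain
    simp only [smul_eq_mul, Matrix.cons_val] at hchain
    rw [← hchain] at d3
    have e4 : fderiv ℝ q η (Z η) - ε * z η * fderiv ℝ p η (Z η)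
        - b η * fderiv ℝ y η (Z η) = 0 := by
      rw [← d3]
      ring
    -- If the generators commuted, this combination would be killed by `dx, dy, dz` and satisfy `dq
    -- = ε z dp`, hence be a multiple of `X`. That contradicts the independence of `X, Y, Z`.
    set w : J1 := fderiv ℝ y η (Y η) • Z η - fderiv ℝ y η (Z η) • Y η with hwdef
    have e5 : fderiv ℝ Φ η w = (fderiv ℝ p η w / fderiv ℝ p η (X η)) •
        fderiv ℝ Φ η (X η) := by
      have e6 : fderiv ℝ q η w = ε * z η * fderiv ℝ p η w := by
        rw [hwdef]
        simp only [map_sub, map_smul, smul_eq_mul]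
        linear_combination fderiv ℝ y η (Y η) * e4 + fderiv ℝ y η (Z η) * b3
      have e7 : fderiv ℝ y η w = 0 := by
        rw [hwdef]
        simp only [map_sub, map_smul, smul_eq_mul]
        ring
      have e8 : fderiv ℝ x η w = 0 := by
        rw [hwdef]
        simp only [map_sub, map_smul, smul_eq_mul, d1, b1]
        ring
      have e9 : fderiv ℝ z η w = 0 := by
        rw [hwdef]
        simp only [map_sub, map_smul, smul_eq_mul, d2, b2]
        ring
      have e10 := hpX η hη
      rw [hdX η hη, smul_smul, div_mul_cancel₀ _ e10, (hd η hη).2, e6, e7, e8, e9]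
      ext j
      fin_cases j <;> simp [hval, dP, dQ]
      ring
    rw [← map_smul] at e5
    have e11 := (hd η hη).1 e5
    have e12 := Fintype.linearIndependent_iff.1 a2 ![-(fderiv ℝ p η w / fderiv ℝ p η (X η)),
      -fderiv ℝ y η (Z η), fderiv ℝ y η (Y η), 0] (by
        simp only [Fin.sum_univ_four, Matrix.cons_val]
        rw [← sub_eq_zero] at e11
        rw [← e11, hwdef]
        module) 2
    exact b4 e12

end NormalFormChart

/-! ### Bracket identities and coefficient elimination -/

section Brackets

variable {E : Type*} [NormedAddCommGroup E] [NormedSpace ℝ E]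

theorem lieBracket_add_smul_right {θ : E} {V B C : E → E} {c : E → ℝ} (hB : SmoothNear B θ)
    (hC : SmoothNear C θ) (hc : SmoothNear c θ) :
    VectorField.lieBracket ℝ V (fun η => B η + c η • C η) θ =
      VectorField.lieBracket ℝ V B θ + (fderiv ℝ c θ (V θ) • C θ +
        c θ • VectorField.lieBracket ℝ V C θ) := by
  rw [← VectorField.lieBracket_smul_right hc.differentiableAt hC.differentiableAt,
    ← VectorField.lieBracket_add_right hB.differentiableAt (hc.smul hC).differentiableAt]
  rfl

theorem lieBracket_add_smul_left {θ : E} {V B C : E → E} {c : E → ℝ} (hB : SmoothNear B θ)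
    (hC : SmoothNear C θ) (hc : SmoothNear c θ) :
    VectorField.lieBracket ℝ (fun η => B η + c η • C η) V θ =
      VectorField.lieBracket ℝ B V θ + (-fderiv ℝ c θ (V θ) • C θ +
        c θ • VectorField.lieBracket ℝ C V θ) := by
  rw [← VectorField.lieBracket_smul_left hc.differentiableAt hC.differentiableAt,
    ← VectorField.lieBracket_add_left hB.differentiableAt (hc.smul hC).differentiableAt]
  rfl

theorem lieBracket_mem_of_frame_right [FiniteDimensional ℝ E] {k : ℕ} {θ : E} {B : Fin k → E → E}
    {V W : E → E} (hB : ∀ j, SmoothNear (B j) θ) (hBli : LinearIndependent ℝ fun j => B j θ)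
    (hV : SmoothNear V θ) (hW : SmoothNear W θ)
    (hWB : ∀ᶠ η in 𝓝 θ, W η ∈ Submodule.span ℝ (range fun j => B j η))
    {M : Submodule ℝ E} (hVM : V θ ∈ M) (hBM : ∀ j, B j θ ∈ M)
    (hVB : ∀ j, VectorField.lieBracket ℝ V (B j) θ ∈ M) : VectorField.lieBracket ℝ V W θ ∈ M := by
  obtain ⟨b, hb, hWb⟩ := exists_smooth_coeffs hB hBli hW hWB
  exact lieBracket_mem_of_eventuallyEq_sum (A := fun _ : Fin 1 => V) (a := fun _ _ => 1)
    (fun _ => hV) hB (fun _ => SmoothNear.const 1) hb (Eventually.of_forall fun η => by simp) hWb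
    (fun _ => hVM) hBM (fun _ => hVB)

theorem jacobi_lieBracket {θ : E} {U V W : E → E} (hU : SmoothNear U θ) (hV : SmoothNear V θ)
    (hW : SmoothNear W θ) :
    VectorField.lieBracket ℝ (VectorField.lieBracket ℝ U V) W θ =
      VectorField.lieBracket ℝ U (VectorField.lieBracket ℝ V W) θ -
        VectorField.lieBracket ℝ V (VectorField.lieBracket ℝ U W) θ := by
  rw [VectorField.leibniz_identity_lieBracket (𝕜 := ℝ) (n := ∞)
    (by simp; exact WithTop.coe_le_coe.2 le_top) hU.contDiffAt hV.contDiffAt hW.contDiffAt]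
  abel

/-- Among `a, b, c + μ b` only `b` is not killed by `l`, so an element of the span killed by `l` has
no `b` component. Applied with `l = dy`, it turns membership in a larger distribution into
involutivity of the part tangent to the levels of `y`. -/
theorem mem_span_pair_of_apply_eq_zero {a b c v : E} {μ : ℝ} {l : E →L[ℝ] ℝ}
    (hv : v ∈ Submodule.span ℝ {a, b, c}) (ha : l a = 0) (hb : l b ≠ 0) (hc : l (c + μ • b) = 0)
    (hlv : l v = 0) : v ∈ Submodule.span ℝ {c + μ • b, a} := by
  obtain ⟨r, s, t, rfl⟩ := Submodule.mem_span_triple.1 hv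
  have h1 : (s - t * μ) * l b = 0 := by
    simp only [map_add, map_smul, smul_eq_mul] at hc hlv
    linear_combination hlv - r * ha - t * hc
  have h2 : s = t * μ := by
    have := (mul_eq_zero.1 h1).resolve_right hb
    linarith
  refine Submodule.mem_span_pair.2 ⟨t, r, ?_⟩
  rw [h2]
  module

theorem mem_span_triple_of_apply_eq_zero {a b c d v : E} {μ ν : ℝ} {l : E →L[ℝ] ℝ}
    (hv : v ∈ Submodule.span ℝ {a, b, c, d}) (ha : l a = 0) (hb : l b ≠ 0)
    (hc : l (c + μ • b) = 0) (hd : l (d + ν • b) = 0)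
    (hlv : l v = 0) : v ∈ Submodule.span ℝ {d + ν • b, c + μ • b, a} := by
  obtain ⟨r, s, t, u, rfl⟩ := mem_span_quadruple.1 hv
  have h1 : (s - t * μ - u * ν) * l b = 0 := by
    simp only [map_add, map_smul, smul_eq_mul] at hc hd hlv
    linear_combination hlv - r * ha - t * hc - u * hd
  have h2 : s = t * μ + u * ν := by
    have := (mul_eq_zero.1 h1).resolve_right hb
    linarith
  refine Submodule.mem_span_triple.2 ⟨u, t, r, ?_⟩
  rw [h2]
  module

end Brackets

/-! ### Darboux form from three functions -/

section Darboux

/-- If the contact form vanishes on the common kernel of `dx, dy, dz`, it is proportional to some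
`dz - p dx - q dy`. -/
theorem exists_contactForm_eq {θ : J1} {x y z : J1 → ℝ} {A B : J1 → J1} (hx : SmoothNear x θ)
    (hy : SmoothNear y θ) (hz : SmoothNear z θ)
    (hli : ∀ᶠ η in 𝓝 θ, LinearIndependent ℝ ![A η, B η])
    (hUA : ∀ᶠ η in 𝓝 θ, contactForm η (A η) = 0) (hUB : ∀ᶠ η in 𝓝 θ, contactForm η (B η) = 0)
    (hxA : ∀ᶠ η in 𝓝 θ, fderiv ℝ x η (A η) = 0) (hxB : ∀ᶠ η in 𝓝 θ, fderiv ℝ x η (B η) = 0)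
    (hyA : ∀ᶠ η in 𝓝 θ, fderiv ℝ y η (A η) = 0) (hyB : ∀ᶠ η in 𝓝 θ, fderiv ℝ y η (B η) = 0)
    (hzA : ∀ᶠ η in 𝓝 θ, fderiv ℝ z η (A η) = 0) (hzB : ∀ᶠ η in 𝓝 θ, fderiv ℝ z η (B η) = 0)
    {t v r : J1} (hxt : fderiv ℝ x θ t = 0) (hyt : fderiv ℝ y θ t = 0) (hzt : fderiv ℝ z θ t ≠ 0)
    (hUt : contactForm θ t ≠ 0) (hyv : fderiv ℝ y θ v ≠ 0) (hxr : fderiv ℝ x θ r ≠ 0)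
    (hyr : fderiv ℝ y θ r = 0) :
    ∃ p q lam : J1 → ℝ, SmoothNear p θ ∧ SmoothNear q θ ∧ SmoothNear lam θ ∧
      ∀ᶠ η in 𝓝 θ, ∀ v, contactForm η v =
        lam η * (fderiv ℝ z η v - p η * fderiv ℝ x η v - q η * fderiv ℝ y η v) := by
  set g : J1 → Fin 3 → ℝ := fun η => ![x η, y η, z η] with hgdef
  have hg : SmoothNear g θ := by
    filter_upwards [hx, hy, hz] with η h1 h2 h3
    refine contDiffAt_pi.2 fun i => ?_
    fin_cases i
    · exact h1
    · exact h2
    · exact h3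
  have hgd : ∀ᶠ η in 𝓝 θ, ∀ v, fderiv ℝ g η v =
      ![fderiv ℝ x η v, fderiv ℝ y η v, fderiv ℝ z η v] := by
    filter_upwards [hg] with η h v
    have h1 := fun i => fderiv_coord (h.differentiableAt (by simp)) i v
    ext i
    rw [← h1]
    fin_cases i <;> rfl
  -- The system is triangular on `v, r, t`: `dy` fixes the coefficient of `v`, then `dx` that of
  -- `r`, then `dz` that of `t`.
  have hsurj : Function.Surjective (fderiv ℝ g θ) := by
    intro w
    set b := w 1 / fderiv ℝ y θ v with hb
    set a := (w 0 - b * fderiv ℝ x θ v) / fderiv ℝ x θ r with ha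
    set c := (w 2 - a * fderiv ℝ z θ r - b * fderiv ℝ z θ v) / fderiv ℝ z θ t with hc
    refine ⟨a • r + b • v + c • t, ?_⟩
    rw [hgd.self_of_nhds]
    simp only [map_add, map_smul, smul_eq_mul, hxt, hyt, hyr]
    ext i
    fin_cases i
    · simp [ha]
      field_simp
      ring
    · simp [hb]
      field_simp
    · simp [hc]
      field_simp
      ring
  have hker : ∀ᶠ η in 𝓝 θ, ∀ v, fderiv ℝ g η v = 0 → contactForm η v = 0 := by
    filter_upwards [eventually_surjective hg.fderiv hsurj, hgd, hli, hUA, hUB, hxA, hxB, hyA, hyB,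
      hzA, hzB] with η h1 h2 h3 h4 h5 a1 a2 a3 a4 a5 a6 v hv
    have h6 := LinearMap.finrank_range_add_finrank_ker (fderiv ℝ g η : J1 →ₗ[ℝ] Fin 3 → ℝ)
    rw [LinearMap.range_eq_top.2 h1, finrank_top] at h6
    simp only [Module.finrank_fin_fun] at h6
    have h7 : Module.finrank ℝ (Submodule.span ℝ {A η, B η}) = 2 := by
      have h8 := finrank_span_eq_card h3
      rwa [Matrix.range_cons, Matrix.range_cons, Matrix.range_empty, union_empty, singleton_union,
        Fintype.card_fin] at h8
    have h8 : Submodule.span ℝ {A η, B η} =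
        LinearMap.ker (fderiv ℝ g η : J1 →ₗ[ℝ] Fin 3 → ℝ) := by
      apply Submodule.eq_of_le_of_finrank_le
      · rw [Submodule.span_le]
        rintro w (rfl | rfl)
        · show fderiv ℝ g η (A η) = 0
          rw [h2, a1, a3, a5]
          simp
        · show fderiv ℝ g η (B η) = 0
          rw [h2, a2, a4, a6]
          simp
      · omega
    have h9 : v ∈ Submodule.span ℝ {A η, B η} := by
      rw [h8]
      exact hv
    obtain ⟨r, s, rfl⟩ := Submodule.mem_span_pair.1 h9
    simp [h4, h5]
  obtain ⟨c, hc, hU⟩ := exists_contactForm_eq_sum hg hsurj hker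
  have hU' : ∀ᶠ η in 𝓝 θ, ∀ v, contactForm η v = c 0 η * fderiv ℝ x η v + c 1 η * fderiv ℝ y η v
      + c 2 η * fderiv ℝ z η v := by
    filter_upwards [hU] with η h v
    rw [h, Fin.sum_univ_three]
    rfl
  -- On `t`, where `dx` and `dy` vanish, `U` reduces to its `dz` term.
  have hc2 : c 2 θ ≠ 0 := by
    intro h0
    apply hUt
    rw [hU'.self_of_nhds, hxt, hyt, h0]
    ring
  refine ⟨fun η => -(c 0 η / c 2 η), fun η => -(c 1 η / c 2 η), c 2, ((hc 0).div (hc 2) hc2).neg,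
    ((hc 1).div (hc 2) hc2).neg, hc 2, ?_⟩
  filter_upwards [hU', (hc 2).eventually_ne hc2] with η h1 h2 v
  rw [h1]
  field_simp
  ring

end Darboux

/-! ### Brackets relative to the second derived distribution -/

section AdaptedFrame

namespace IsAdaptedFrame

variable {D : J1 → Submodule ℝ J1} {θ : J1} {X Y Z T : J1 → J1}

theorem eventually (h : IsAdaptedFrame D θ X Y Z T) :
    ∀ᶠ η in 𝓝 θ, IsAdaptedFrame D η X Y Z T := by
  have hUT := ((smoothNear_contactForm θ).clm_apply h.smoothT).eventually_ne h.contactT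
  filter_upwards [h.smoothX.eventually, h.smoothY.eventually, h.smoothZ.eventually,
    h.smoothT.eventually, h.dist_eq.eventually_nhds, h.li.eventually_nhds,
    h.contactX.eventually_nhds, h.contactY.eventually_nhds, h.contactZ.eventually_nhds, hUT,
    h.brXZ.eventually_nhds, h.brXT.eventually_nhds] with η h1 h2 h3 h4 h5 h6 h7 h8 h9 a1 a2 a3
  exact ⟨h1, h2, h3, h4, h.brXY, h.brYZ, h5, h6, h7, h8, h9, a1, a2, a3⟩

/-- The second derived distribution. -/
abbrev flag (X Y Z T : J1 → J1) (η : J1) : Submodule ℝ J1 :=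
  Submodule.span ℝ {X η, Y η, Z η, T η}

theorem memX (η : J1) : X η ∈ flag X Y Z T η := Submodule.subset_span (by simp)

theorem memY (η : J1) : Y η ∈ flag X Y Z T η := Submodule.subset_span (by simp)

theorem memZ (η : J1) : Z η ∈ flag X Y Z T η := Submodule.subset_span (by simp)

theorem memT (η : J1) : T η ∈ flag X Y Z T η := Submodule.subset_span (by simp)

theorem triple_le_flag (η : J1) : Submodule.span ℝ {X η, Y η, Z η} ≤ flag X Y Z T η := by
  refine Submodule.span_mono ?_
  rintro v (rfl | rfl | rfl) <;> simp

theorem lieBracketX_mem (h : IsAdaptedFrame D θ X Y Z T) :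
    VectorField.lieBracket ℝ X Y θ ∈ flag X Y Z T θ ∧
      VectorField.lieBracket ℝ X Z θ ∈ flag X Y Z T θ ∧
      VectorField.lieBracket ℝ X T θ ∈ flag X Y Z T θ := by
  refine ⟨?_, triple_le_flag θ h.brXZ.self_of_nhds, h.brXT.self_of_nhds⟩
  rw [h.brXY]
  exact memZ θ

theorem smooth_frame (h : IsAdaptedFrame D θ X Y Z T) (j : Fin 4) :
    SmoothNear (![X, Y, Z, T] j) θ := by
  fin_cases j
  · exact h.smoothX
  · exact h.smoothY
  · exact h.smoothZ
  · exact h.smoothT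

theorem lieBracket_mem (h : IsAdaptedFrame D θ X Y Z T) {V W : J1 → J1} (hV : SmoothNear V θ)
    (hW : SmoothNear W θ) (hWm : ∀ᶠ η in 𝓝 θ, W η ∈ flag X Y Z T η)
    (hVm : V θ ∈ flag X Y Z T θ) (hVX : VectorField.lieBracket ℝ V X θ ∈ flag X Y Z T θ)
    (hVY : VectorField.lieBracket ℝ V Y θ ∈ flag X Y Z T θ)
    (hVZ : VectorField.lieBracket ℝ V Z θ ∈ flag X Y Z T θ)
    (hVT : VectorField.lieBracket ℝ V T θ ∈ flag X Y Z T θ) :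
    VectorField.lieBracket ℝ V W θ ∈ flag X Y Z T θ := by
  refine lieBracket_mem_of_frame_right (B := ![X, Y, Z, T]) h.smooth_frame ?_ hV hW ?_ hVm ?_ ?_
  · rw [frame_four]
    exact h.li.self_of_nhds
  · simpa only [range_frame_four] using hWm
  · intro j
    fin_cases j
    · exact memX θ
    · exact memY θ
    · exact memZ θ
    · exact memT θ
  · intro j
    fin_cases j
    · exact hVX
    · exact hVY
    · exact hVZ
    · exact hVT

theorem lieBracketX_mem_of_mem (h : IsAdaptedFrame D θ X Y Z T) {W : J1 → J1}
    (hW : SmoothNear W θ) (hWm : ∀ᶠ η in 𝓝 θ, W η ∈ flag X Y Z T η) :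
    VectorField.lieBracket ℝ X W θ ∈ flag X Y Z T θ := by
  obtain ⟨h1, h2, h3⟩ := h.lieBracketX_mem
  refine h.lieBracket_mem h.smoothX hW hWm (memX θ) ?_ h1 h2 h3
  rw [VectorField.lieBracket_self]
  exact Submodule.zero_mem _

end IsAdaptedFrame

end AdaptedFrame

section FirstIntegrals

variable {E : Type*} [NormedAddCommGroup E] [NormedSpace ℝ E]

theorem IsFirstIntegral.fderiv_coord_eq_zero {k m : ℕ} {θ : E} {V : Fin k → E → E}
    {f : E → Fin m → ℝ} (hf : IsFirstIntegral θ V f) (i : Fin k) (j : Fin m) :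
    ∀ᶠ η in 𝓝 θ, fderiv ℝ (fun η => f η j) η (V i η) = 0 := by
  filter_upwards [hf.1.eventually, hf.2.2] with η h1 h2
  rw [fderiv_coord h1.differentiableAt, (h2 _).2 (Submodule.subset_span ⟨i, rfl⟩)]
  rfl

theorem IsFirstIntegral.exists_fderiv_coord_ne {k m : ℕ} {θ : E} {V : Fin k → E → E}
    {f : E → Fin m → ℝ} (hf : IsFirstIntegral θ V f) {v : E}
    (hv : v ∉ Submodule.span ℝ (range fun i => V i θ)) :
    ∃ j, fderiv ℝ (fun η => f η j) θ v ≠ 0 := by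
  by_contra! h
  refine hv ((hf.2.2.self_of_nhds v).1 ?_)
  ext j
  rw [← fderiv_coord hf.1.differentiableAt, h]
  rfl

theorem span_quadruple_add_smul (a b c d : E) (μ ν : ℝ) :
    Submodule.span ℝ {b, d + ν • b, c + μ • b, a} = Submodule.span ℝ {a, b, c, d} := by
  apply le_antisymm <;> rw [Submodule.span_le] <;>
    rintro v (rfl | rfl | rfl | rfl) <;> rw [SetLike.mem_coe, mem_span_quadruple]
  · exact ⟨0, 1, 0, 0, by module⟩
  · exact ⟨0, ν, 0, 1, by module⟩
  · exact ⟨0, μ, 1, 0, by module⟩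
  · exact ⟨1, 0, 0, 0, by module⟩
  · exact ⟨0, 0, 0, 1, by module⟩
  · exact ⟨1, 0, 0, 0, by module⟩
  · exact ⟨-μ, 0, 1, 0, by module⟩
  · exact ⟨-ν, 1, 0, 0, by module⟩

end FirstIntegrals

/-! ### First integrals of `⟨X, S⟩` and form (b) -/

namespace IsAdaptedFrame

variable {D : J1 → Submodule ℝ J1} {θ : J1} {X Y Z T : J1 → J1} {μ ν : J1 → ℝ}

theorem contactT_add (h : IsAdaptedFrame D θ X Y Z T) (c : ℝ) :
    contactForm θ (T θ + c • Y θ) ≠ 0 := by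
  rw [map_add, map_smul, h.contactY.self_of_nhds, smul_zero, add_zero]
  exact h.contactT

theorem contactZ_add (h : IsAdaptedFrame D θ X Y Z T) (c : ℝ) :
    contactForm θ (Z θ + c • Y θ) = 0 := by
  rw [map_add, map_smul, h.contactY.self_of_nhds, h.contactZ.self_of_nhds, smul_zero, add_zero]

theorem linearIndependent_S (h : IsAdaptedFrame D θ X Y Z T) (c : ℝ) :
    LinearIndependent ℝ ![X θ, Z θ + c • Y θ] := by
  have h1 := Fintype.linearIndependent_iff.1 h.li.self_of_nhds
  refine LinearIndependent.pair_iff.2 fun s t hst => ?_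
  have h2 := h1 ![s, t * c, t, 0] (by
    rw [← hst, Fin.sum_univ_four]
    simp only [Matrix.cons_val]
    module)
  exact ⟨h2 0, h2 2⟩

theorem notMem_span_S (h : IsAdaptedFrame D θ X Y Z T) (c : ℝ) :
    Y θ ∉ Submodule.span ℝ {Z θ + c • Y θ, X θ} := by
  have h1 := Fintype.linearIndependent_iff.1 h.li.self_of_nhds
  intro hY
  obtain ⟨s, t, hst⟩ := Submodule.mem_span_pair.1 hY
  have h2 := h1 ![t, s * c - 1, s, 0] (by
    rw [Fin.sum_univ_four]
    simp only [Matrix.cons_val]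
    rw [← sub_eq_zero] at hst
    rw [← hst]
    module)
  have h3 : s = 0 := h2 2
  have h4 : s * c - 1 = 0 := h2 1
  rw [h3] at h4
  linarith

theorem T_notMem_span_S (h : IsAdaptedFrame D θ X Y Z T) (c c' : ℝ) :
    T θ + c • Y θ ∉ Submodule.span ℝ {Z θ + c' • Y θ, X θ} := by
  intro hm
  obtain ⟨a, b, hab⟩ := Submodule.mem_span_pair.1 hm
  apply h.contactT_add c
  rw [← hab, map_add, map_smul, map_smul, h.contactZ_add, h.contactX.self_of_nhds]
  simp

theorem lieBracket_S_Y (h : IsAdaptedFrame D θ X Y Z T) (hμ : SmoothNear μ θ) :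
    VectorField.lieBracket ℝ (fun η => Z η + μ η • Y η) Y θ ∈ flag X Y Z T θ := by
  rw [lieBracket_add_smul_left h.smoothZ h.smoothY hμ, VectorField.lieBracket_self,
    VectorField.lieBracket_swap, h.brYZ]
  simp only [Pi.zero_apply, smul_zero, add_zero]
  exact Submodule.add_mem _ (Submodule.neg_mem _ (memT θ)) (Submodule.smul_mem _ _ (memY θ))

theorem lieBracket_S_Z (h : IsAdaptedFrame D θ X Y Z T) (hμ : SmoothNear μ θ) :
    VectorField.lieBracket ℝ (fun η => Z η + μ η • Y η) Z θ ∈ flag X Y Z T θ := by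
  rw [lieBracket_add_smul_left h.smoothZ h.smoothY hμ, VectorField.lieBracket_self, h.brYZ]
  simp only [Pi.zero_apply, zero_add]
  exact Submodule.add_mem _ (Submodule.smul_mem _ _ (memY θ)) (Submodule.smul_mem _ _ (memT θ))

theorem mem_S (η : J1) : Z η + μ η • Y η ∈ flag X Y Z T η :=
  Submodule.add_mem _ (memZ η) (Submodule.smul_mem _ _ (memY η))

theorem smooth_S (h : IsAdaptedFrame D θ X Y Z T) (hμ : SmoothNear μ θ) :
    SmoothNear (fun η => Z η + μ η • Y η) θ := h.smoothZ.add (hμ.smul h.smoothY)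

theorem smooth_T' (h : IsAdaptedFrame D θ X Y Z T) (hν : SmoothNear ν θ) :
    SmoothNear (fun η => T η + ν η • Y η) θ := h.smoothT.add (hν.smul h.smoothY)

theorem exists_firstIntegral_two (h : IsAdaptedFrame D θ X Y Z T) (hμ : SmoothNear μ θ)
    (hXS : ∀ᶠ η in 𝓝 θ, VectorField.lieBracket ℝ X (fun η => Z η + μ η • Y η) η ∈
      Submodule.span ℝ {Z η + μ η • Y η, X η}) :
    ∃ f : J1 → Fin 3 → ℝ, IsFirstIntegral θ ![fun η => Z η + μ η • Y η, X] f := by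
  have hli := h.linearIndependent_S (μ θ)
  obtain ⟨f, hf⟩ := exists_firstIntegral_one h.smoothX (hli.ne_zero 0)
  refine hf.exists_cons (fun i => by fin_cases i; exact h.smoothX) (h.smooth_S hμ) ?_ ?_
  · rw [range_frame_one, Submodule.mem_span_singleton]
    rintro ⟨a, ha⟩
    exact (LinearIndependent.pair_iff' (hli.ne_zero 0)).1 hli a ha
  · filter_upwards [hXS] with η h1 i
    fin_cases i
    show _ ∈ Submodule.span ℝ (range fun j => ![fun η => Z η + μ η • Y η, X] j η)
    rw [range_frame_two]
    exact h1

/-- Subtracting a multiple of `Y` from `T` makes it tangent to the levels of `y`. Brackets of `X`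
and `S` with the result stay in `flag` and still kill `y`, hence lie in the span of the three
tangent fields. -/
theorem exists_firstIntegral_three (h : IsAdaptedFrame D θ X Y Z T) (hμ : SmoothNear μ θ)
    (hST : ∀ᶠ η in 𝓝 θ,
      VectorField.lieBracket ℝ (fun η => Z η + μ η • Y η) T η ∈ flag X Y Z T η)
    {f : J1 → Fin 3 → ℝ} (hf : IsFirstIntegral θ ![fun η => Z η + μ η • Y η, X] f)
    {y : J1 → ℝ} (hy : SmoothNear y θ) (hyX : ∀ᶠ η in 𝓝 θ, fderiv ℝ y η (X η) = 0)
    (hyS : ∀ᶠ η in 𝓝 θ, fderiv ℝ y η (Z η + μ η • Y η) = 0) (hyY : fderiv ℝ y θ (Y θ) ≠ 0) :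
    ∃ ν : J1 → ℝ, SmoothNear ν θ ∧ (∀ᶠ η in 𝓝 θ, fderiv ℝ y η (T η + ν η • Y η) = 0) ∧
      ∃ g : J1 → Fin 2 → ℝ,
        IsFirstIntegral θ ![fun η => T η + ν η • Y η, fun η => Z η + μ η • Y η, X] g := by
  have hyYn := (hy.along h.smoothY).eventually_ne hyY
  set ν : J1 → ℝ := fun η => -(fderiv ℝ y η (T η) / fderiv ℝ y η (Y η)) with hνdef
  have hν : SmoothNear ν θ := ((hy.along h.smoothT).div (hy.along h.smoothY) hyY).neg
  have hyT : ∀ᶠ η in 𝓝 θ, fderiv ℝ y η (T η + ν η • Y η) = 0 := by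
    filter_upwards [hyYn] with η h1
    rw [map_add, map_smul, hνdef, smul_eq_mul]
    field_simp
    ring
  refine ⟨ν, hν, hyT, ?_⟩
  refine hf.exists_cons (Y := fun η => T η + ν η • Y η)
    (fun i => by fin_cases i; exacts [h.smooth_S hμ, h.smoothX]) (h.smooth_T' hν) ?_ ?_
  · rw [range_frame_two]
    exact h.T_notMem_span_S _ _
  · filter_upwards [h.eventually, hμ.eventually, hν.eventually, hy.eventually,
      hST.eventually_nhds, hyX.eventually_nhds, hyS.eventually_nhds, hyT.eventually_nhds, hyYn]
      with η a1 a2 a3 a4 a5 a6 a7 a8 a9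
    have key : ∀ V : J1 → J1, SmoothNear V η → (∀ᶠ ζ in 𝓝 η, fderiv ℝ y ζ (V ζ) = 0) →
        VectorField.lieBracket ℝ V T η ∈ flag X Y Z T η →
        VectorField.lieBracket ℝ V Y η ∈ flag X Y Z T η →
        VectorField.lieBracket ℝ V (fun η => T η + ν η • Y η) η ∈
          Submodule.span ℝ {T η + ν η • Y η, Z η + μ η • Y η, X η} := by
      intro V hV hyV hVT hVY
      refine mem_span_triple_of_apply_eq_zero (l := fderiv ℝ y η) ?_ a6.self_of_nhds a9
        a7.self_of_nhds a8.self_of_nhds ?_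
      · rw [lieBracket_add_smul_right a1.smoothT a1.smoothY a3]
        exact Submodule.add_mem _ hVT (Submodule.add_mem _ (Submodule.smul_mem _ _ (memY η))
          (Submodule.smul_mem _ _ hVY))
      · rw [fderiv_lieBracket a4 hV (a1.smooth_T' a3), fderiv_eq_zero_of_eventually hyV,
          fderiv_eq_zero_of_eventually a8]
        simp
    intro i
    show _ ∈ Submodule.span ℝ
      (range fun j => ![fun η => T η + ν η • Y η, fun η => Z η + μ η • Y η, X] j η)
    rw [range_frame_three]
    fin_cases i
    · exact key _ (a1.smooth_S a2) a7 a5.self_of_nhds (a1.lieBracket_S_Y a2)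
    · exact key _ a1.smoothX a6 a1.lieBracketX_mem.2.2 a1.lieBracketX_mem.1

/-- Here `flag` is integrable and `x` is its first integral, so `dx(Y) = 0`. The function `y` is a
first integral of `X` transversal to `Y`, `S = Z + μ Y` is the correction tangent to its levels, and
`z` is a first integral of `⟨X, S⟩` varying along `T + ν Y`. -/
theorem hasNormalFormB (h : IsAdaptedFrame D θ X Y Z T) {Ω : Set J1} (hΩ : IsOpen Ω)
    (hD : IsRankTwoDist Ω D) (hθ : θ ∈ Ω)
    (hYT : ∀ᶠ η in 𝓝 θ, VectorField.lieBracket ℝ Y T η ∈ flag X Y Z T η) :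
    HasNormalFormB Ω D θ := by
  -- Since `Z = [X, Y]`, Jacobi reduces `[Z, T]` to brackets of `X` and `Y` with sections of `flag`.
  have hZT : ∀ᶠ η in 𝓝 θ, VectorField.lieBracket ℝ Z T η ∈ flag X Y Z T η := by
    filter_upwards [h.eventually, hYT.eventually_nhds] with η a1 a2
    have hJ := jacobi_lieBracket a1.smoothX a1.smoothY a1.smoothT
    rw [a1.brXY] at hJ
    rw [hJ]
    refine Submodule.sub_mem _
      (a1.lieBracketX_mem_of_mem (a1.smoothY.lieBracket a1.smoothT) a2) ?_
    refine a1.lieBracket_mem a1.smoothY (a1.smoothX.lieBracket a1.smoothT) a1.brXT (memY η) ?_ ?_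
      ?_ a2.self_of_nhds
    · rw [VectorField.lieBracket_swap]
      exact Submodule.neg_mem _ a1.lieBracketX_mem.1
    · rw [VectorField.lieBracket_self]
      exact Submodule.zero_mem _
    · rw [a1.brYZ]
      exact memT η
  obtain ⟨f₁, hf₁⟩ := exists_firstIntegral_one h.smoothX (h.li.self_of_nhds.ne_zero 0)
  obtain ⟨i, hi⟩ := hf₁.exists_fderiv_coord_ne (v := Y θ) (by
    rw [range_frame_one]
    intro hm
    exact h.notMem_span_S 0 (Submodule.span_mono (by simp) hm))
  set y : J1 → ℝ := fun η => f₁ η i with hydef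
  have hy : SmoothNear y θ := hf₁.1.apply i
  have hyX : ∀ᶠ η in 𝓝 θ, fderiv ℝ y η (X η) = 0 := hf₁.fderiv_coord_eq_zero 0 i
  have hyYn := (hy.along h.smoothY).eventually_ne hi
  set μ : J1 → ℝ := fun η => -(fderiv ℝ y η (Z η) / fderiv ℝ y η (Y η)) with hμdef
  have hμ : SmoothNear μ θ := ((hy.along h.smoothZ).div (hy.along h.smoothY) hi).neg
  have hyS : ∀ᶠ η in 𝓝 θ, fderiv ℝ y η (Z η + μ η • Y η) = 0 := by
    filter_upwards [hyYn] with η h1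
    rw [map_add, map_smul, hμdef, smul_eq_mul]
    field_simp
    ring
  have hXS : ∀ᶠ η in 𝓝 θ, VectorField.lieBracket ℝ X (fun η => Z η + μ η • Y η) η ∈
      Submodule.span ℝ {Z η + μ η • Y η, X η} := by
    filter_upwards [h.eventually, hμ.eventually, hy.eventually, hyX.eventually_nhds,
      hyS.eventually_nhds, hyYn] with η a1 a2 a3 a4 a5 a6
    refine mem_span_pair_of_apply_eq_zero (l := fderiv ℝ y η) ?_ a4.self_of_nhds a6
      a5.self_of_nhds ?_
    · rw [lieBracket_add_smul_right a1.smoothZ a1.smoothY a2, a1.brXY]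
      exact Submodule.add_mem _ a1.brXZ.self_of_nhds (Submodule.add_mem _
        (Submodule.smul_mem _ _ (Submodule.subset_span (by simp)))
        (Submodule.smul_mem _ _ (Submodule.subset_span (by simp))))
    · rw [fderiv_lieBracket a3 a1.smoothX (a1.smooth_S a2), fderiv_eq_zero_of_eventually a4,
        fderiv_eq_zero_of_eventually a5]
      simp
  have hST : ∀ᶠ η in 𝓝 θ,
      VectorField.lieBracket ℝ (fun η => Z η + μ η • Y η) T η ∈ flag X Y Z T η := by
    filter_upwards [h.eventually, hμ.eventually, hYT, hZT] with η a1 a2 a3 a4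
    rw [lieBracket_add_smul_left a1.smoothZ a1.smoothY a2]
    exact Submodule.add_mem _ a4 (Submodule.add_mem _ (Submodule.smul_mem _ _ (memY η))
      (Submodule.smul_mem _ _ a3))
  obtain ⟨f₂, hf₂⟩ := h.exists_firstIntegral_two hμ hXS
  obtain ⟨ν, hν, hyT, f₃, hf₃⟩ := h.exists_firstIntegral_three hμ hST hf₂ hy hyX hyS hi
  obtain ⟨f₄, hf₄⟩ : ∃ g : J1 → Fin 1 → ℝ, IsFirstIntegral θ
      ![Y, fun η => T η + ν η • Y η, fun η => Z η + μ η • Y η, X] g := by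
    refine hf₃.exists_cons (Y := Y)
      (fun i => by fin_cases i; exacts [h.smooth_T' hν, h.smooth_S hμ, h.smoothX]) h.smoothY ?_ ?_
    · rw [range_frame_three]
      intro hm
      obtain ⟨a, b, c, habc⟩ := Submodule.mem_span_triple.1 hm
      apply hi
      rw [← habc, map_add, map_add, map_smul, map_smul, map_smul, hyT.self_of_nhds,
        hyS.self_of_nhds, hyX.self_of_nhds]
      simp
    · filter_upwards [h.eventually, hμ.eventually, hν.eventually, hYT] with η a1 a2 a3 a4 i
      show _ ∈ Submodule.span ℝ
        (range fun j => ![Y, fun η => T η + ν η • Y η, fun η => Z η + μ η • Y η, X] j η)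
      rw [range_frame_four, span_quadruple_add_smul]
      fin_cases i
      · show VectorField.lieBracket ℝ (fun η => T η + ν η • Y η) Y η ∈ _
        rw [lieBracket_add_smul_left a1.smoothT a1.smoothY a3, VectorField.lieBracket_self,
          VectorField.lieBracket_swap]
        simp only [Pi.zero_apply, smul_zero, add_zero]
        exact Submodule.add_mem _ (Submodule.neg_mem _ a4) (Submodule.smul_mem _ _ (memY η))
      · exact a1.lieBracket_S_Y a2
      · exact a1.lieBracketX_mem.1
  set x : J1 → ℝ := fun η => f₄ η 0 with hxdef
  have hx : SmoothNear x θ := hf₄.1.apply 0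
  have hxY : ∀ᶠ η in 𝓝 θ, fderiv ℝ x η (Y η) = 0 := hf₄.fderiv_coord_eq_zero 0 0
  have hxT : ∀ᶠ η in 𝓝 θ, fderiv ℝ x η (T η + ν η • Y η) = 0 := hf₄.fderiv_coord_eq_zero 1 0
  have hxS : ∀ᶠ η in 𝓝 θ, fderiv ℝ x η (Z η + μ η • Y η) = 0 := hf₄.fderiv_coord_eq_zero 2 0
  have hxX : ∀ᶠ η in 𝓝 θ, fderiv ℝ x η (X η) = 0 := hf₄.fderiv_coord_eq_zero 3 0
  obtain ⟨j, hj⟩ := hf₂.exists_fderiv_coord_ne (v := T θ + ν θ • Y θ) (by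
    rw [range_frame_two]
    exact h.T_notMem_span_S _ _)
  set z : J1 → ℝ := fun η => f₂ η j with hzdef
  have hz : SmoothNear z θ := hf₂.1.apply j
  have hzS : ∀ᶠ η in 𝓝 θ, fderiv ℝ z η (Z η + μ η • Y η) = 0 := hf₂.fderiv_coord_eq_zero 0 j
  have hzX : ∀ᶠ η in 𝓝 θ, fderiv ℝ z η (X η) = 0 := hf₂.fderiv_coord_eq_zero 1 j
  obtain ⟨R, hR⟩ := hf₄.2.1 (fun _ => 1)
  have hxR : fderiv ℝ x θ R = 1 := by
    rw [hxdef, fderiv_coord hf₄.1.differentiableAt, hR]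
  -- The vector `r` is `R` made tangent to the level of `y` by a multiple of `Y`, which does not
  -- affect `dx` because `dx(Y) = 0`.
  obtain ⟨p, q, lam, hp, hq, hl, hU⟩ := exists_contactForm_eq (A := X)
    (B := fun η => Z η + μ η • Y η) (t := T θ + ν θ • Y θ) (v := Y θ)
    (r := R - (fderiv ℝ y θ R / fderiv ℝ y θ (Y θ)) • Y θ) hx hy hz
    (h.eventually.mono fun η a => a.linearIndependent_S (μ η)) h.contactX
    (h.eventually.mono fun η a => a.contactZ_add (μ η)) hxX hxS hyX hyS hzX hzS
    hxT.self_of_nhds hyT.self_of_nhds hj (h.contactT_add _) hi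
    (by
      rw [map_sub, map_smul, hxY.self_of_nhds, hxR]
      simp)
    (by
      rw [map_sub, map_smul, smul_eq_mul]
      field_simp
      ring)
  obtain ⟨Φ, hΦ, -, b, hb, hs, hd⟩ := exists_normalForm_chart hΩ hD hθ h 0 hx hy hz hp hq hl hU
    hxX hyX hzX (hxY.mono fun η a => by rw [a]; ring) hi
  refine ⟨Φ, hΦ, b, hb, ?_, ?_⟩
  · simpa using hs
  · simpa using hd

end IsAdaptedFrame

/-! ### Normalisation of the base point and derivative of the slope -/

section Coordinates

variable {E : Type*} [NormedAddCommGroup E] [NormedSpace ℝ E]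

/-- A change of coordinates making `z` vanish at `θ`. -/
theorem exists_normalized_coordinates {θ : E} {x y z : E → ℝ} (hx : SmoothNear x θ)
    (hy : SmoothNear y θ) (hz : SmoothNear z θ) (w : ℝ) :
    ∃ x' z' : E → ℝ, SmoothNear x' θ ∧ SmoothNear z' θ ∧ z' θ = 0 ∧ ∀ᶠ η in 𝓝 θ, ∀ v,
      fderiv ℝ x' η v = fderiv ℝ x η v + (z η - z' η) * fderiv ℝ y η v ∧
      fderiv ℝ z' η v = fderiv ℝ z η v - w * fderiv ℝ y η v := by
  -- With `x' = x + φ(y)` and `z' = z - φ'(y)` the form `dx + z dy` is preserved. The linear term of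
  -- `φ` is chosen to cancel `z θ`, and its second derivative `w` remains free to shift `q`.
  set φ : ℝ → ℝ := fun s => z θ * s + w / 2 * (s - y θ) ^ 2 with hφ
  have hφs : ContDiff ℝ ∞ φ := by fun_prop
  have hφd : ∀ s, HasDerivAt φ (z θ + w * (s - y θ)) s := by
    intro s
    have h1 := ((hasDerivAt_id s).const_mul (z θ)).add
      ((((hasDerivAt_id s).sub_const (y θ)).pow 2).const_mul (w / 2))
    refine h1.congr_deriv ?_
    simp
    ring
  refine ⟨fun η => x η + φ (y η), fun η => z η - (z θ + w * (y η - y θ)),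
    hx.add ((SmoothNear.of_contDiff hφs).comp hy),
    hz.sub ((SmoothNear.const _).add ((SmoothNear.const w).mul (hy.sub (SmoothNear.const _)))),
    by simp, ?_⟩
  filter_upwards [hx.eventually, hy.eventually, hz.eventually] with η h1 h2 h3 v
  have d1 := h1.differentiableAt.hasFDerivAt
  have d2 := h2.differentiableAt.hasFDerivAt
  have d3 := h3.differentiableAt.hasFDerivAt
  constructor
  · rw [HasFDerivAt.fderiv (f := fun η => x η + φ (y η))
      (d1.add ((hφd (y η)).comp_hasFDerivAt η d2))]
    simp
  · rw [HasFDerivAt.fderiv (f := fun η => z η - (z θ + w * (y η - y θ)))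
      (d3.sub (((d2.sub_const (y θ)).const_mul w).const_add (z θ)))]
    simp

/-- The derivative of `-(Yx) / (Yy)` along a field annihilating `x` and `y`. -/
theorem fderiv_slope_apply {θ : E} {x y z : E → ℝ} {V Y : E → E} (hx : SmoothNear x θ)
    (hy : SmoothNear y θ) (hz : SmoothNear z θ) (hV : SmoothNear V θ) (hY : SmoothNear Y θ)
    (hzxy : ∀ᶠ η in 𝓝 θ, z η * fderiv ℝ y η (Y η) = -fderiv ℝ x η (Y η))
    (hxV : ∀ᶠ η in 𝓝 θ, fderiv ℝ x η (V η) = 0) (hyV : ∀ᶠ η in 𝓝 θ, fderiv ℝ y η (V η) = 0) :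
    fderiv ℝ y θ (Y θ) * fderiv ℝ z θ (V θ) =
      -(fderiv ℝ x θ (VectorField.lieBracket ℝ V Y θ) +
        z θ * fderiv ℝ y θ (VectorField.lieBracket ℝ V Y θ)) := by
  have h1 := fderiv_congr_apply (u := fun η => z η * fderiv ℝ y η (Y η))
    (w := fun η => -fderiv ℝ x η (Y η)) hzxy (V θ)
  rw [fderiv_mul_apply hz (hy.along hY), fderiv_fun_neg] at h1
  rw [fderiv_lieBracket hx hV hY, fderiv_lieBracket hy hV hY, fderiv_eq_zero_of_eventually hxV,
    fderiv_eq_zero_of_eventually hyV]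
  simp only [neg_apply, zero_apply] at h1 ⊢
  linear_combination h1

end Coordinates

/-! ### The additional open condition in form (c) -/

section Charts

theorem IsSpannedInChart.restrOpen {Φ : OpenPartialHomeomorph J1 J1} {D : J1 → Submodule ℝ J1}
    {X Y : J1 → J1} (h : IsSpannedInChart Φ D X Y) {S : Set J1} (hS : IsOpen S) :
    IsSpannedInChart (Φ.restrOpen S hS) D X Y := fun η hη => h η hη.1

/-- The normal form (c) follows, after shrinking the chart, once `Φ θ` lies on `z = q = 0`. -/
theorem hasNormalFormC_of_chart {Ω : Set J1} {D : J1 → Submodule ℝ J1} {θ : J1}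
    {Φ : OpenPartialHomeomorph J1 J1} (hΦ : IsContactChartAt Ω θ Φ) (h2 : Φ θ 2 = 0)
    (h4 : Φ θ 4 = 0) {b : J1 → ℝ} (hb : ContDiffOn ℝ ∞ b Φ.target)
    (hs : IsSpannedInChart Φ D (fun η => dP + η 2 • dQ)
      (fun η => hatY η - η 2 • hatX η + b η • dQ))
    (hd : ∀ η ∈ Φ.target, fderiv ℝ b η (dP + η 2 • dQ) ≠ η 4 - η 2 * η 3) :
    HasNormalFormC Ω D θ := by
  have hc := hb.continuousOn_fderiv_of_isOpen Φ.open_target (by simp)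
  have hψ : ContinuousOn (fun η => fderiv ℝ b η dP + η 2 * fderiv ℝ b η dZ) Φ.target :=
    (hc.clm_apply continuousOn_const).add
      ((continuous_apply (2 : Fin 5)).continuousOn.mul (hc.clm_apply continuousOn_const))
  have hU := hψ.isOpen_inter_preimage Φ.open_target (isOpen_compl_singleton (x := (0 : ℝ)))
  have hS := Φ.isOpen_inter_preimage hU
  have hθt : Φ θ ∈ Φ.target := Φ.map_source hΦ.1
  -- At `z = q = 0` both inequalities of form (c) reduce to `∂_p b ≠ 0`.
  have h0 : fderiv ℝ b (Φ θ) dP + Φ θ 2 * fderiv ℝ b (Φ θ) dZ ≠ 0 := by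
    have := hd _ hθt
    rw [h2, h4] at this
    simpa [h2] using this
  refine ⟨_, hΦ.restrOpen hS ⟨hΦ.1, hθt, h0⟩, b, hb.mono fun w hw => hw.1, hs.restrOpen hS,
    fun η hη => ?_⟩
  have hη1 : η ∈ Φ.target := hη.1
  have hη2 := ((Φ.restrOpen _ hS).map_target hη).2.2.2
  have hη3 : Φ (Φ.symm η) = η := Φ.right_inv hη1
  constructor
  · change fderiv ℝ b (Φ (Φ.symm η)) dP + Φ (Φ.symm η) 2 * fderiv ℝ b (Φ (Φ.symm η)) dZ ≠ 0 at hη2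
    rwa [hη3] at hη2
  · have := hd η hη1
    rwa [map_add, map_smul, smul_eq_mul] at this

end Charts

/-! ### The non-integrable second derived distribution and form (c) -/

namespace IsAdaptedFrame

variable {D : J1 → Submodule ℝ J1} {θ : J1} {X Y Z T : J1 → J1} {μ ν : J1 → ℝ}

theorem eventually_linearIndependent_five (h : IsAdaptedFrame D θ X Y Z T)
    (hYT : VectorField.lieBracket ℝ Y T θ ∉ flag X Y Z T θ) :
    ∀ᶠ η in 𝓝 θ,
      LinearIndependent ℝ fun i => ![VectorField.lieBracket ℝ Y T, X, Y, Z, T] i η := by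
  apply eventually_linearIndependent
  · intro i
    refine Fin.cases (h.smoothY.lieBracket h.smoothT) (fun j => ?_) i
    exact h.smooth_frame j
  · have h1 : LinearIndependent ℝ (Fin.cons (VectorField.lieBracket ℝ Y T θ)
        (fun i => ![X, Y, Z, T] i θ) : Fin 5 → J1) := by
      refine linearIndependent_finCons.2 ⟨?_, ?_⟩
      · rw [frame_four]
        exact h.li.self_of_nhds
      · rwa [range_frame_four]
    have e : (fun i => ![VectorField.lieBracket ℝ Y T, X, Y, Z, T] i θ) =
        (Fin.cons (VectorField.lieBracket ℝ Y T θ) (fun i => ![X, Y, Z, T] i θ) :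
          Fin 5 → J1) := by
      ext i : 1
      exact Fin.cases rfl (fun j => rfl) i
    rw [e]
    exact h1

theorem eventually_notMem_flag (h : IsAdaptedFrame D θ X Y Z T)
    (hYT : VectorField.lieBracket ℝ Y T θ ∉ flag X Y Z T θ) :
    ∀ᶠ η in 𝓝 θ, VectorField.lieBracket ℝ Y T η ∉ flag X Y Z T η := by
  filter_upwards [h.eventually_linearIndependent_five hYT] with η h1 h2
  have h3 := h1.notMem_span_image (s := {0}ᶜ) (x := 0) (by simp)
  apply h3
  refine Submodule.span_mono ?_ h2
  rintro v (rfl | rfl | rfl | rfl)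
  · exact ⟨1, by simp, rfl⟩
  · exact ⟨2, by simp, rfl⟩
  · exact ⟨3, by simp, rfl⟩
  · exact ⟨4, by simp, rfl⟩

/-- The line field transversal to `⟨X, Y⟩` in the derived distribution can be chosen characteristic
for the second derived distribution. -/
theorem exists_characteristic (h : IsAdaptedFrame D θ X Y Z T)
    (hYT : VectorField.lieBracket ℝ Y T θ ∉ flag X Y Z T θ) :
    ∃ μ : J1 → ℝ, SmoothNear μ θ ∧ ∀ᶠ η in 𝓝 θ,
      VectorField.lieBracket ℝ (fun η => Z η + μ η • Y η) T η ∈ flag X Y Z T η := by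
  have hli := h.eventually_linearIndependent_five hYT
  obtain ⟨c, hc, hZT⟩ := exists_smooth_coeffs
    (A := ![VectorField.lieBracket ℝ Y T, X, Y, Z, T]) (V := VectorField.lieBracket ℝ Z T)
    (by
      intro i
      refine Fin.cases (h.smoothY.lieBracket h.smoothT) (fun j => ?_) i
      exact h.smooth_frame j) hli.self_of_nhds (h.smoothZ.lieBracket h.smoothT)
    (by
      filter_upwards [hli] with η h1
      rw [h1.span_eq_top_of_card_eq_finrank (by simp)]
      trivial)
  -- `c 0` is the coefficient of `[Y, T]` in `[Z, T]`; adding `-c 0` times `Y` to `Z` cancels it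
  -- modulo `flag`.
  refine ⟨fun η => -c 0 η, (hc 0).neg, ?_⟩
  filter_upwards [h.eventually, (hc 0).neg.eventually, hZT] with η a1 a2 a3
  rw [lieBracket_add_smul_left a1.smoothZ a1.smoothY a2, a3, Fin.sum_univ_succ, Fin.sum_univ_four]
  have e : ∀ (q r s : J1) (d : ℝ), d • q + r + (s + -d • q) = r + s := fun q r s d => by module
  rw [show (![VectorField.lieBracket ℝ Y T, X, Y, Z, T] 0 : J1 → J1) =
    VectorField.lieBracket ℝ Y T from rfl, e]
  refine Submodule.add_mem _ (Submodule.add_mem _ (Submodule.add_mem _ (Submodule.add_mem _ ?_ ?_)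
    ?_) ?_) (Submodule.smul_mem _ _ (memY η)) <;> refine Submodule.smul_mem _ _ ?_
  · exact memX η
  · exact memY η
  · exact memZ η
  · exact memT η

/-- Both `X` and `S` are characteristic for `flag`, so by Jacobi their bracket is too. A component
along `Y` would contradict `[Y, T] ∉ flag`. -/
theorem lieBracket_X_S_mem (h : IsAdaptedFrame D θ X Y Z T)
    (hYT : VectorField.lieBracket ℝ Y T θ ∉ flag X Y Z T θ) (hμ : SmoothNear μ θ)
    (hST : ∀ᶠ η in 𝓝 θ,
      VectorField.lieBracket ℝ (fun η => Z η + μ η • Y η) T η ∈ flag X Y Z T η) :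
    ∀ᶠ η in 𝓝 θ, VectorField.lieBracket ℝ X (fun η => Z η + μ η • Y η) η ∈
      Submodule.span ℝ {Z η + μ η • Y η, X η} := by
  set S : J1 → J1 := fun η => Z η + μ η • Y η with hS
  have hSs : SmoothNear S θ := h.smooth_S hμ
  have hli : LinearIndependent ℝ ![Y θ, S θ, X θ] := by
    refine LinearIndependent.three_of_notMem ?_ (h.notMem_span_S _)
    exact LinearIndependent.pair_symm_iff.1 (h.linearIndependent_S _)
  obtain ⟨c, hc, hXS⟩ := exists_smooth_coeffs (A := ![Y, S, X])
    (V := VectorField.lieBracket ℝ X S)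
    (by
      intro i
      fin_cases i
      exacts [h.smoothY, hSs, h.smoothX])
    (by rwa [frame_three]) (h.smoothX.lieBracket hSs)
    (by
      filter_upwards [h.eventually, hμ.eventually] with η a1 a2
      rw [range_frame_three, hS, lieBracket_add_smul_right a1.smoothZ a1.smoothY a2, a1.brXY]
      have hY : Y η ∈ Submodule.span ℝ {Y η, Z η + μ η • Y η, X η} :=
        Submodule.subset_span (by simp)
      have hX : X η ∈ Submodule.span ℝ {Y η, Z η + μ η • Y η, X η} :=
        Submodule.subset_span (by simp)
      have hZ : Z η ∈ Submodule.span ℝ {Y η, Z η + μ η • Y η, X η} := by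
        have := Submodule.sub_mem (Submodule.span ℝ {Y η, Z η + μ η • Y η, X η})
          (Submodule.subset_span (a := Z η + μ η • Y η) (by simp))
          (Submodule.smul_mem _ (μ η) hY)
        rwa [add_sub_cancel_right] at this
      refine Submodule.add_mem _ (Submodule.span_le.2 ?_ a1.brXZ.self_of_nhds)
        (Submodule.add_mem _ (Submodule.smul_mem _ _ hY) (Submodule.smul_mem _ _ hZ))
      rintro v (rfl | rfl | rfl)
      exacts [hX, hY, hZ])
  have hXS' : ∀ᶠ η in 𝓝 θ, VectorField.lieBracket ℝ X S η =
      c 1 η • S η + c 2 η • X η + c 0 η • Y η := by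
    filter_upwards [hXS] with η a1
    rw [a1, Fin.sum_univ_three]
    simp only [Matrix.cons_val]
    abel
  filter_upwards [h.eventually, hμ.eventually, (hc 0).eventually, (hc 1).eventually,
    (hc 2).eventually, hXS'.eventually_nhds, hST.eventually_nhds, h.eventually_notMem_flag hYT]
    with η a1 a2 c0 c1 c2 a3 a4 a5
  have hSη : SmoothNear S η := a1.smooth_S a2
  have hSX : VectorField.lieBracket ℝ S X η ∈ flag X Y Z T η := by
    rw [VectorField.lieBracket_swap]
    exact Submodule.neg_mem _ (a1.lieBracketX_mem_of_mem hSη (Eventually.of_forall mem_S))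
  have hJ : VectorField.lieBracket ℝ (VectorField.lieBracket ℝ X S) T η ∈ flag X Y Z T η := by
    rw [jacobi_lieBracket a1.smoothX hSη a1.smoothT]
    exact Submodule.sub_mem _ (a1.lieBracketX_mem_of_mem (hSη.lieBracket a1.smoothT) a4)
      (a1.lieBracket_mem hSη (a1.smoothX.lieBracket a1.smoothT) a1.brXT (mem_S η) hSX
        (a1.lieBracket_S_Y a2) (a1.lieBracket_S_Z a2) a4.self_of_nhds)
  have hB : SmoothNear (fun η => c 1 η • S η + c 2 η • X η) η :=
    (c1.smul hSη).add (c2.smul a1.smoothX)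
  have hBT : VectorField.lieBracket ℝ (fun η => c 1 η • S η + c 2 η • X η) T η ∈
      flag X Y Z T η := by
    rw [lieBracket_add_smul_left (c1.smul hSη) a1.smoothX c2,
      VectorField.lieBracket_smul_left c1.differentiableAt hSη.differentiableAt]
    refine Submodule.add_mem _ (Submodule.add_mem _ ?_ ?_) (Submodule.add_mem _ ?_ ?_) <;>
      refine Submodule.smul_mem _ _ ?_
    · exact mem_S η
    · exact a4.self_of_nhds
    · exact memX η
    · exact a1.lieBracketX_mem.2.2
  have h0 : c 0 η = 0 := by
    by_contra h0
    apply a5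
    rw [Filter.EventuallyEq.lieBracket_vectorField_eq a3 EventuallyEq.rfl,
      lieBracket_add_smul_left hB a1.smoothY c0, ← add_assoc] at hJ
    have := (Submodule.add_mem_iff_right _ (Submodule.add_mem _ hBT
      (Submodule.smul_mem _ _ (memY η)))).1 hJ
    exact (Submodule.smul_mem_iff _ h0).1 this
  rw [a3.self_of_nhds, h0, zero_smul, add_zero]
  exact Submodule.mem_span_pair.2 ⟨_, _, rfl⟩

/-- The functions `x, y` are constant along `X`, `S` and `T + ν Y`, so `flag` is the kernel of `dx +
z dy` with `z` the slope along `Y`. Characteristic fields preserve this slope, while `T + ν Y` moves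
it because `[Y, T] ∉ flag`; hence `x, y, z` are independent. -/
theorem hasNormalFormC (h : IsAdaptedFrame D θ X Y Z T) {Ω : Set J1} (hΩ : IsOpen Ω)
    (hD : IsRankTwoDist Ω D) (hθ : θ ∈ Ω)
    (hYT : VectorField.lieBracket ℝ Y T θ ∉ flag X Y Z T θ) : HasNormalFormC Ω D θ := by
  obtain ⟨μ, hμ, hST⟩ := h.exists_characteristic hYT
  obtain ⟨f, hf⟩ := h.exists_firstIntegral_two hμ (h.lieBracket_X_S_mem hYT hμ hST)
  obtain ⟨i, hi⟩ := hf.exists_fderiv_coord_ne (v := Y θ) (by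
    rw [range_frame_two]
    exact h.notMem_span_S _)
  set y : J1 → ℝ := fun η => f η i with hydef
  have hy : SmoothNear y θ := hf.1.apply i
  have hyS : ∀ᶠ η in 𝓝 θ, fderiv ℝ y η (Z η + μ η • Y η) = 0 := hf.fderiv_coord_eq_zero 0 i
  have hyX : ∀ᶠ η in 𝓝 θ, fderiv ℝ y η (X η) = 0 := hf.fderiv_coord_eq_zero 1 i
  have hyYn := (hy.along h.smoothY).eventually_ne hi
  obtain ⟨ν, hν, hyT, g, hg⟩ := h.exists_firstIntegral_three hμ hST hf hy hyX hyS hi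
  -- The kernel of `dy` has dimension at least four and three vectors cannot span it; `R` selects a
  -- first integral `x` independent of `y`.
  obtain ⟨R, hyR, hR⟩ : ∃ R, fderiv ℝ y θ R = 0 ∧ R ∉ Submodule.span ℝ
      (range fun i => ![fun η => T η + ν η • Y η, fun η => Z η + μ η • Y η, X] i θ) := by
    by_contra! hcon
    have h1 : LinearMap.ker (fderiv ℝ y θ : J1 →ₗ[ℝ] ℝ) ≤ _ := fun R hR => hcon R hR
    have h2 := Submodule.finrank_mono h1
    have h3 := finrank_range_le_card (R := ℝ)
      (b := fun i => ![fun η => T η + ν η • Y η, fun η => Z η + μ η • Y η, X] i θ)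
    have h4 := LinearMap.finrank_range_add_finrank_ker (fderiv ℝ y θ : J1 →ₗ[ℝ] ℝ)
    have h5 := Submodule.finrank_le (LinearMap.range (fderiv ℝ y θ : J1 →ₗ[ℝ] ℝ))
    rw [Set.finrank, Fintype.card_fin] at h3
    rw [Module.finrank_fin_fun] at h4
    rw [Module.finrank_self] at h5
    omega
  obtain ⟨j, hj⟩ := hg.exists_fderiv_coord_ne hR
  set x : J1 → ℝ := fun η => g η j with hxdef
  have hx : SmoothNear x θ := hg.1.apply j
  have hxT : ∀ᶠ η in 𝓝 θ, fderiv ℝ x η (T η + ν η • Y η) = 0 := hg.fderiv_coord_eq_zero 0 j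
  have hxS : ∀ᶠ η in 𝓝 θ, fderiv ℝ x η (Z η + μ η • Y η) = 0 := hg.fderiv_coord_eq_zero 1 j
  have hxX : ∀ᶠ η in 𝓝 θ, fderiv ℝ x η (X η) = 0 := hg.fderiv_coord_eq_zero 2 j
  set z : J1 → ℝ := fun η => -(fderiv ℝ x η (Y η) / fderiv ℝ y η (Y η)) with hzdef
  have hz : SmoothNear z θ := ((hx.along h.smoothY).div (hy.along h.smoothY) hi).neg
  have hzxy : ∀ᶠ η in 𝓝 θ, z η * fderiv ℝ y η (Y η) = -fderiv ℝ x η (Y η) := by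
    filter_upwards [hyYn] with η a1
    rw [hzdef]
    field_simp
  have hflag : ∀ᶠ η in 𝓝 θ, ∀ v ∈ flag X Y Z T η,
      fderiv ℝ x η v + z η * fderiv ℝ y η v = 0 := by
    filter_upwards [hyX, hyS, hyT, hxX, hxS, hxT, hzxy] with η a1 a2 a3 a4 a5 a6 a7 v hv
    rw [flag, ← span_quadruple_add_smul _ _ _ _ (μ η) (ν η), mem_span_quadruple] at hv
    obtain ⟨r, s, t, u, rfl⟩ := hv
    rw [map_add (fderiv ℝ x η), map_add (fderiv ℝ x η), map_add (fderiv ℝ x η),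
      map_add (fderiv ℝ y η), map_add (fderiv ℝ y η), map_add (fderiv ℝ y η)]
    simp only [map_smul (fderiv ℝ x η), map_smul (fderiv ℝ y η), a1, a2, a3, a4, a5, a6,
      smul_eq_mul]
    linear_combination r * a7
  have hzV : ∀ V : J1 → J1, SmoothNear V θ → (∀ᶠ η in 𝓝 θ, fderiv ℝ x η (V η) = 0) →
      (∀ᶠ η in 𝓝 θ, fderiv ℝ y η (V η) = 0) →
      (∀ᶠ η in 𝓝 θ, VectorField.lieBracket ℝ V Y η ∈ flag X Y Z T η) →
      ∀ᶠ η in 𝓝 θ, fderiv ℝ z η (V η) = 0 := by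
    intro V hV hxV hyV hVY
    filter_upwards [hx.eventually, hy.eventually, hz.eventually, hV.eventually,
      h.smoothY.eventually, hzxy.eventually_nhds, hxV.eventually_nhds, hyV.eventually_nhds, hVY,
      hflag, hyYn] with η a1 a2 a3 a4 a5 a6 a7 a8 a9 b1 b2
    have := fderiv_slope_apply a1 a2 a3 a4 a5 a6 a7 a8
    rw [b1 _ a9, neg_zero] at this
    exact (mul_eq_zero.1 this).resolve_left b2
  have hzX : ∀ᶠ η in 𝓝 θ, fderiv ℝ z η (X η) = 0 :=
    hzV X h.smoothX hxX hyX (h.eventually.mono fun η a => a.lieBracketX_mem.1)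
  have hzS : ∀ᶠ η in 𝓝 θ, fderiv ℝ z η (Z η + μ η • Y η) = 0 := by
    refine hzV _ (h.smooth_S hμ) hxS hyS ?_
    filter_upwards [h.eventually, hμ.eventually] with η a1 a2 using a1.lieBracket_S_Y a2
  -- If this derivative vanished, the slope formula would put `[T + ν Y, Y]` in the kernel of `dx +
  -- z dy`, which is `flag` by dimension.
  have hzT : fderiv ℝ z θ (T θ + ν θ • Y θ) ≠ 0 := by
    intro h0
    have h1 := fderiv_slope_apply hx hy hz (h.smooth_T' hν) h.smoothY hzxy hxT hyT
    rw [h0, mul_zero, eq_comm, neg_eq_zero] at h1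
    have h2 : flag X Y Z T θ =
        LinearMap.ker ((fderiv ℝ x θ + z θ • fderiv ℝ y θ : J1 →L[ℝ] ℝ) : J1 →ₗ[ℝ] ℝ) := by
      apply Submodule.eq_of_le_of_finrank_le
      · exact fun v hv => hflag.self_of_nhds v hv
      · rw [finrank_span_quadruple h.li.self_of_nhds]
        have h3 := Submodule.finrank_lt (s := LinearMap.ker
          ((fderiv ℝ x θ + z θ • fderiv ℝ y θ : J1 →L[ℝ] ℝ) : J1 →ₗ[ℝ] ℝ)) (by
            intro htop
            have h4 : R ∈ LinearMap.ker
              ((fderiv ℝ x θ + z θ • fderiv ℝ y θ : J1 →L[ℝ] ℝ) : J1 →ₗ[ℝ] ℝ) := by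
              rw [htop]
              trivial
            have h5 : fderiv ℝ x θ R + z θ * fderiv ℝ y θ R = 0 := h4
            rw [hyR, mul_zero, add_zero] at h5
            exact hj h5)
        rw [Module.finrank_fin_fun] at h3
        omega
    have h3 : VectorField.lieBracket ℝ (fun η => T η + ν η • Y η) Y θ ∈ flag X Y Z T θ := by
      rw [h2]
      exact h1
    rw [lieBracket_add_smul_left h.smoothT h.smoothY hν, VectorField.lieBracket_self,
      VectorField.lieBracket_swap] at h3
    simp only [Pi.zero_apply, smul_zero, add_zero] at h3
    have h4 := (Submodule.add_mem_iff_left _ (Submodule.smul_mem _ _ (memY θ))).1 h3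
    exact hYT (by simpa using Submodule.neg_mem _ h4)
  obtain ⟨p, q, lam, hp, hq, hl, hU⟩ := exists_contactForm_eq (A := X)
    (B := fun η => Z η + μ η • Y η) (t := T θ + ν θ • Y θ) (v := Y θ) (r := R) hx hy hz
    (h.eventually.mono fun η a => a.linearIndependent_S (μ η)) h.contactX
    (h.eventually.mono fun η a => a.contactZ_add (μ η)) hxX hxS hyX hyS hzX hzS
    hxT.self_of_nhds hyT.self_of_nhds hzT (h.contactT_add _) hi hj hyR
  -- In the normalised coordinates the new `q` at `θ` is `q - w - p z`; this `w` makes it zero.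
  set w : ℝ := q θ - p θ * z θ with hw
  obtain ⟨x', z', hx', hz', hz'θ, hd⟩ := exists_normalized_coordinates hx hy hz w
  obtain ⟨Φ, hΦ, hval, b, hb, hs, hbr⟩ := exists_normalForm_chart hΩ hD hθ h 1 hx' hy hz' hp
    (q := fun η => q η - w - p η * (z η - z' η)) ((hq.sub (SmoothNear.const w)).sub
      (hp.mul (hz.sub hz'))) hl
    (by
      filter_upwards [hU, hd] with η a1 a2 v
      rw [a1, (a2 v).1, (a2 v).2]
      ring)
    (by
      filter_upwards [hd, hxX, hyX] with η a1 a2 a3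
      rw [(a1 _).1, a2, a3]
      ring) hyX
    (by
      filter_upwards [hd, hzX, hyX] with η a1 a2 a3
      rw [(a1 _).2, a2, a3]
      ring)
    (by
      filter_upwards [hd, hzxy] with η a1 a2
      rw [(a1 _).1]
      linear_combination a2) hi
  refine hasNormalFormC_of_chart hΦ ?_ ?_ hb (by simpa using hs) (by simpa using hbr)
  · rw [hval]
    exact hz'θ
  · rw [hval]
    show q θ - w - p θ * (z θ - z' θ) = 0
    rw [hz'θ, hw]
    ring

end IsAdaptedFrame

/-! ### Openness, density and the three cases -/

section MainTheorem

theorem IsContactChartAt.of_mem_source {Ω : Set J1} {θ η : J1} {Φ : OpenPartialHomeomorph J1 J1}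
    (h : IsContactChartAt Ω θ Φ) (hη : η ∈ Φ.source) : IsContactChartAt Ω η Φ := ⟨hη, h.2⟩

/-- Having one of the three normal forms is an open condition. -/
theorem eventually_hasNormalForm {Ω : Set J1} {D : J1 → Submodule ℝ J1} {θ : J1}
    (h : HasNormalFormA Ω D θ ∨ HasNormalFormB Ω D θ ∨ HasNormalFormC Ω D θ) :
    ∀ᶠ η in 𝓝 θ, HasNormalFormA Ω D η ∨ HasNormalFormB Ω D η ∨ HasNormalFormC Ω D η := by
  rcases h with ⟨Φ, hΦ, h⟩ | ⟨Φ, hΦ, h⟩ | ⟨Φ, hΦ, h⟩ <;>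
    filter_upwards [Φ.open_source.mem_nhds hΦ.1] with η hη
  · exact Or.inl ⟨Φ, hΦ.of_mem_source hη, h⟩
  · exact Or.inr (Or.inl ⟨Φ, hΦ.of_mem_source hη, h⟩)
  · exact Or.inr (Or.inr ⟨Φ, hΦ.of_mem_source hη, h⟩)

/-- A nongeneric lagrangian distribution has a normal form at points arbitrarily close to any given
one. -/
theorem frequently_hasNormalForm {Ω : Set J1} (hΩ : IsOpen Ω) {D : J1 → Submodule ℝ J1}
    (hD : IsRankTwoDist Ω D) (hL : IsLagrangianOn Ω D)
    (hng : ∀ θ ∈ Ω, Module.finrank ℝ (derivedDist Ω (derivedDist Ω D) θ) < 5) {θ : J1}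
    (hθ : θ ∈ Ω) :
    ∃ᶠ η in 𝓝 θ,
      η ∈ Ω ∧ (HasNormalFormA Ω D η ∨ HasNormalFormB Ω D η ∨ HasNormalFormC Ω D η) := by
  have hΩn : ∀ᶠ η in 𝓝 θ, η ∈ Ω := hΩ.mem_nhds hθ
  by_cases hint : ∀ᶠ η in 𝓝 θ, derivedDist Ω D η = D η
  · exact (Eventually.and hΩn (eventually_hasNormalForm
      (Or.inl (hasNormalFormA_of_integrable hΩ hD hL hθ hint)))).frequently
  · have hfr := (not_eventually.1 hint).and_eventually hΩn
    -- Points with `D' ≠ D` accumulate at `θ`; it suffices to find normal forms arbitrarily close to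
    -- each of them.
    refine frequently_frequently_nhds.1 (hfr.mono fun η hη => ?_)
    obtain ⟨X, Y, Z, T, h, -⟩ := exists_adaptedFrame hΩ hD hL hng hη.2 hη.1
    have hΩη : ∀ᶠ ζ in 𝓝 η, ζ ∈ Ω := hΩ.mem_nhds hη.2
    by_cases hYT : ∀ᶠ ζ in 𝓝 η, VectorField.lieBracket ℝ Y T ζ ∈ IsAdaptedFrame.flag X Y Z T ζ
    · exact (Eventually.and hΩη (eventually_hasNormalForm
        (Or.inr (Or.inl (h.hasNormalFormB hΩ hD hη.2 hYT))))).frequently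
    -- Points with `[Y, T] ∉ flag` accumulate here, and the same adapted frame serves at all nearby
    -- points.
    · refine ((not_eventually.1 hYT).and_eventually (h.eventually.and hΩη)).mono ?_
      rintro ζ ⟨h1, h2, h3⟩
      exact ⟨h3, Or.inr (Or.inr (h2.hasNormalFormC hΩ hD h3 h1))⟩

theorem hasNormalFormB_of_integrable {Ω : Set J1} (hΩ : IsOpen Ω) {D : J1 → Submodule ℝ J1}
    (hD : IsRankTwoDist Ω D) (hL : IsLagrangianOn Ω D)
    (hng : ∀ θ ∈ Ω, Module.finrank ℝ (derivedDist Ω (derivedDist Ω D) θ) < 5) {θ : J1}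
    (hθ : θ ∈ Ω) (hne : derivedDist Ω D θ ≠ D θ)
    (hint : ∀ᶠ η in 𝓝 θ, derivedDist Ω (derivedDist Ω (derivedDist Ω D)) η
      = derivedDist Ω (derivedDist Ω D) η) : HasNormalFormB Ω D θ := by
  obtain ⟨X, Y, Z, T, h, hflag⟩ := exists_adaptedFrame hΩ hD hL hng hθ hne
  refine h.hasNormalFormB hΩ hD hθ ?_
  filter_upwards [h.eventually, hΩ.mem_nhds hθ, hint, hflag.eventually_nhds] with η a1 a2 a3 a4
  have h1 : ∀ V : J1 → J1, (∀ ζ, V ζ ∈ IsAdaptedFrame.flag X Y Z T ζ) →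
      ∀ᶠ ζ in 𝓝 η, V ζ ∈ derivedDist Ω (derivedDist Ω D) ζ := fun V hV =>
    a4.mono fun ζ hζ => by rw [hζ]; exact hV ζ
  have h2 := lieBracket_mem_derivedDist hΩ a2 a1.smoothY a1.smoothT
    (h1 Y IsAdaptedFrame.memY) (h1 T IsAdaptedFrame.memT)
  rwa [a3, a4.self_of_nhds] at h2

/-- By contraposition: if `[Y, T]` were in `flag` at `θ`, then `X` and `Y`, and so every section of
`D`, would bracket sections of `D''` into `D''` there. -/
theorem hasNormalFormC_of_lieBracket_notMem {Ω : Set J1} (hΩ : IsOpen Ω)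
    {D : J1 → Submodule ℝ J1} (hD : IsRankTwoDist Ω D) (hL : IsLagrangianOn Ω D)
    (hng : ∀ θ ∈ Ω, Module.finrank ℝ (derivedDist Ω (derivedDist Ω D) θ) < 5) {θ : J1}
    (hθ : θ ∈ Ω) (hne : derivedDist Ω D θ ≠ D θ) {V₁ V₂ : J1 → J1} (h1 : SmoothNear V₁ θ)
    (h2 : SmoothNear V₂ θ) (hV₁ : ∀ᶠ η in 𝓝 θ, V₁ η ∈ D η)
    (hV₂ : ∀ᶠ η in 𝓝 θ, V₂ η ∈ derivedDist Ω (derivedDist Ω D) η)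
    (hbr : VectorField.lieBracket ℝ V₁ V₂ θ ∉ derivedDist Ω (derivedDist Ω D) θ) :
    HasNormalFormC Ω D θ := by
  obtain ⟨X, Y, Z, T, h, hflag⟩ := exists_adaptedFrame hΩ hD hL hng hθ hne
  refine h.hasNormalFormC hΩ hD hθ fun hYT => hbr ?_
  rw [hflag.self_of_nhds]
  have hV₂' : ∀ᶠ η in 𝓝 θ, V₂ η ∈ IsAdaptedFrame.flag X Y Z T η := by
    filter_upwards [hV₂, hflag] with η a1 a2
    rwa [a2] at a1
  have hYX : VectorField.lieBracket ℝ Y X θ ∈ IsAdaptedFrame.flag X Y Z T θ := by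
    rw [VectorField.lieBracket_swap]
    exact Submodule.neg_mem _ h.lieBracketX_mem.1
  have hYY : VectorField.lieBracket ℝ Y Y θ ∈ IsAdaptedFrame.flag X Y Z T θ := by
    rw [VectorField.lieBracket_self]
    exact Submodule.zero_mem _
  have hYZ : VectorField.lieBracket ℝ Y Z θ ∈ IsAdaptedFrame.flag X Y Z T θ := by
    rw [h.brYZ]
    exact IsAdaptedFrame.memT θ
  have key : ∀ {V}, SmoothNear V θ → (∀ᶠ η in 𝓝 θ, V η ∈ IsAdaptedFrame.flag X Y Z T η) →
      VectorField.lieBracket ℝ V X θ ∈ IsAdaptedFrame.flag X Y Z T θ ∧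
      VectorField.lieBracket ℝ V Y θ ∈ IsAdaptedFrame.flag X Y Z T θ := by
    intro V hV hVm
    rw [VectorField.lieBracket_swap, VectorField.lieBracket_swap (W := Y)]
    exact ⟨Submodule.neg_mem _ (h.lieBracketX_mem_of_mem hV hVm), Submodule.neg_mem _
      (h.lieBracket_mem h.smoothY hV hVm (IsAdaptedFrame.memY θ) hYX hYY hYZ hYT)⟩
  obtain ⟨k1, k2⟩ := key h2 hV₂'
  rw [VectorField.lieBracket_swap]
  refine Submodule.neg_mem _ (lieBracket_mem_of_frame_right (B := ![X, Y]) ?_ ?_ h2 h1 ?_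
    hV₂'.self_of_nhds ?_ ?_)
  · intro j
    fin_cases j
    exacts [h.smoothX, h.smoothY]
  · rw [frame_two]
    exact h.li.self_of_nhds.three_of_four.two_of_three
  · filter_upwards [hV₁, h.dist_eq] with η a1 a2
    rwa [range_frame_two, ← a2]
  · intro j
    fin_cases j
    exacts [IsAdaptedFrame.memX θ, IsAdaptedFrame.memY θ]
  · intro j
    fin_cases j
    exacts [k1, k2]

end MainTheorem

theorem mainTheorem4 (Ω : Set J1) (hΩ : IsOpen Ω) (D : J1 → Submodule ℝ J1)
    (hD : IsRankTwoDist Ω D) (hL : IsLagrangianOn Ω D)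
    (hng : ∀ θ ∈ Ω, Module.finrank ℝ (derivedDist Ω (derivedDist Ω D) θ) < 5) :
    (∃ G : Set J1, IsOpen G ∧ G ⊆ Ω ∧ Ω ⊆ closure G ∧
      ∀ θ ∈ G, HasNormalFormA Ω D θ ∨ HasNormalFormB Ω D θ ∨ HasNormalFormC Ω D θ) ∧
    (∀ θ ∈ Ω, (∀ᶠ η in 𝓝 θ, derivedDist Ω D η = D η) → HasNormalFormA Ω D θ) ∧
    (∀ θ ∈ Ω, Module.finrank ℝ (derivedDist Ω D θ) = 3 →
      (∀ᶠ η in 𝓝 θ, derivedDist Ω (derivedDist Ω (derivedDist Ω D)) η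
        = derivedDist Ω (derivedDist Ω D) η) → HasNormalFormB Ω D θ) ∧
    (∀ θ ∈ Ω, Module.finrank ℝ (derivedDist Ω D θ) = 3 →
      (∃ (W : Set J1) (X Y : J1 → J1), IsOpen W ∧ θ ∈ W ∧ W ⊆ Ω ∧
        IsSectionOn D W X ∧ IsSectionOn (derivedDist Ω (derivedDist Ω D)) W Y ∧
        VectorField.lieBracket ℝ X Y θ ∉ derivedDist Ω (derivedDist Ω D) θ) →
      HasNormalFormC Ω D θ) := by
  have hne : ∀ θ ∈ Ω, Module.finrank ℝ (derivedDist Ω D θ) = 3 → derivedDist Ω D θ ≠ D θ := by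
    intro θ hθ h3 heq
    rw [heq, hD.finrank_eq hθ] at h3
    omega
  refine ⟨⟨{θ | θ ∈ Ω ∧ (HasNormalFormA Ω D θ ∨ HasNormalFormB Ω D θ ∨ HasNormalFormC Ω D θ)},
    ?_, fun θ hθ => hθ.1, fun θ hθ => ?_, fun θ hθ => hθ.2⟩, ?_, ?_, ?_⟩
  · exact isOpen_iff_mem_nhds.2 fun θ hθ =>
      Eventually.and (hΩ.mem_nhds hθ.1) (eventually_hasNormalForm hθ.2)
  · exact mem_closure_iff_frequently.2 (frequently_hasNormalForm hΩ hD hL hng hθ)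
  · exact fun θ hθ h => hasNormalFormA_of_integrable hΩ hD hL hθ h
  · exact fun θ hθ h3 h => hasNormalFormB_of_integrable hΩ hD hL hng hθ (hne θ hθ h3) h
  · rintro θ hθ h3 ⟨W, V₁, V₂, hW, hθW, -, h1, h2, h⟩
    exact hasNormalFormC_of_lieBracket_notMem hΩ hD hL hng hθ (hne θ hθ h3)
      (h1.smoothNear hW hθW) (h2.smoothNear hW hθW) (h1.eventually_mem hW hθW)
      (h2.eventually_mem hW hθW) h
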